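/- **Setting.** Let $(\mathcal V,d)$ be a countable metric space all of whose balls are finite, with $\kappa_{\mu_0}<\infty$ for some $\mu_0>0$, where $\kappa_a=\sup_{x\in\mathcal V}\sum_{y\in\mathcal V}e^{-a\,d(x,y)}$. To each $x\in\mathcal V$ attach the Hilbert space $\mathbb C^{n_x}$, $n_x\ge 1$; for finite $V\subset\mathcal V$ put $\mathcal H_V=\bigotimes_{x\in V}\mathbb C^{n_x}$, and let $\mathcal A_V$ be the algebra of operators on $\mathcal H_V$, with the operator norm; for $X\subset V$, $\mathcal A_X$ is embedded in $\mathcal A_V$ by $A\mapsto A\otimes 1$. Let $\Phi$ be an interaction, that is, $\Phi(X)=\Phi(X)^*\in\mathcal A_X$ for every finite $X\subset\mathcal V$, such that, for some $R,J>0$, $\Phi(X)=0$ whenever $\operatorname{diam}X>R$, $\|\Phi(X)\|\le J$ for all $X$, and $$N_\Phi=\sup_{x}\sum_{X\ni x,\ \Phi(X)\ne0}|X|<\infty ,\qquad C_\Phi=\sup_x\sum_{X\ni x,\ \Phi(X)\neq0}1 .$$ Put $H_V=\sum_{X\subset V}\Phi(X)$ and $\tau^V_t(A)=e^{itH_V}Ae^{-itH_V}$.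 For finite $X\subset\mathcal V$, let $\partial_\Phi X$ be the set of $x\in X$ that belong to some finite $Y\not\subset X$ with $\Phi(Y)\ne0$. For $\mu>0$, call $c,v>0$ *Lieb–Robinson constants at rate $\mu$* if for every finite $V\subset\mathcal V$, all disjoint $X,Y\subset V$, all $A\in\mathcal A_X$, $B\in\mathcal A_Y$ and all $t\in\mathbb R$, $$\|[\tau^V_t(A),B]\|\le c\,\|A\|\,\|B\|\min\bigl(|\partial_\Phi X|,|\partial_\Phi Y|\bigr)e^{-\mu(d(X,Y)-v|t|)} .$$ For $\mathcal X\subset V$ with $V$ finite, and $\ell>R$, write $\partial X$ for the set of $x\in X$ with $d(x,y)\le R$ for some $y\in V\setminus X$ (for any $X\subset V$), and $\mathcal X_{\rm int}(\ell)=\{x\in\mathcal X: d(x,y)\ge\ell\ \forall y\in\partial\mathcal X\}$, $\mathcal X_{\rm bd}(\ell)=\{x\in V: d(x,y)<\ell\text{ for some }y\in\partial\mathcal X\}$, $\mathcal X_{\rm ext}(\ell)=\{x\in V\setminus\mathcal X: d(x,y)\ge\ell\ \forall y\in\partial\mathcal X\}$. **Corollary 2.3.** For every $\mu\ge2\mu_0$,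 Lieb–Robinson constants at rate $\mu$ exist. Let $c,v$ be any such constants. Let $V\subset\mathcal V$ be finite and such that $H_V$ has a unique (up to phase) normalized ground state $\psi_0$, with projection $P_0=|\psi_0\rangle\langle\psi_0|$ and with a gap of length $\gamma>0$ above its ground state energy $E_0$ (every other eigenvalue of $H_V$ is at least $E_0+\gamma$). Let $\mathcal X\subset V$ and $C>0$ satisfy $$\max\{|\partial\mathcal X_{\rm int}(\ell)|,\ |\mathcal X_{\rm bd}(\ell)|,\ |\partial\mathcal X_{\rm ext}(\ell)|\}\le C\,\ell\,|\partial\mathcal X|\qquad\text{for all }\ell>R .$$ Define $\xi>0$ by $\dfrac2\xi=\dfrac{\mu\gamma^2}{\mu^2v^2+\gamma^2}$. Then for every $\ell>R$ there exist orthogonal projections $P_{\mathcal X}\in\mathcal A_{\mathcal X}$ and $P_{\mathcal X^c}\in\mathcal A_{V\setminus\mathcal X}$ and an observable $P_{\mathcal X_{\rm bd}}\in\mathcal A_{\mathcal X_{\rm bd}(3\ell)}$ with $\|P_{\mathcal X_{\rm bd}}\|\le1$ such that $$\|P_{\mathcal X_{\rm bd}}P_{\mathcal X}P_{\mathcal X^c}-P_0\|\le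 K\,C_\Phi N_\Phi\,|\partial\mathcal X|^2\,\ell^{7/2}e^{-\ell/(2\xi)} ,$$ and such that also the non-negative operator $P_{\mathcal X^c}P_{\mathcal X}P_{\mathcal X_{\rm bd}}^*P_{\mathcal X_{\rm bd}}P_{\mathcal X}P_{\mathcal X^c}$ satisfies $$\|P_{\mathcal X^c}P_{\mathcal X}P_{\mathcal X_{\rm bd}}^*P_{\mathcal X_{\rm bd}}P_{\mathcal X}P_{\mathcal X^c}-P_0\|\le K\,C_\Phi N_\Phi\,|\partial\mathcal X|^2\,\ell^{7/2}e^{-\ell/(2\xi)} .$$ Here $K$ depends only on $J, C_\Phi, N_\Phi, \mu, c, v, \gamma, R, \kappa_{\mu/2}$ and $C$; in particular not on $\ell$, $V$ or $\mathcal X$. -/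

import Mathlib

open scoped Matrix.Norms.L2Operator ComplexOrder ENNReal Matrix

namespace SpinSystem

noncomputable section

/-- Product-basis labels of `⨂_{x ∈ V} ℂ^(n x)`: one basis label for each site of `V`. -/
abbrev Conf {𝒱 : Type*} (n : 𝒱 → ℕ) (V : Finset 𝒱) : Type _ :=
  (x : ↥V) → Fin (n x)

/-- The Hilbert space `ℋ_V = ⨂_{x ∈ V} ℂ^(n x)`, written in its product orthonormal basis. -/
abbrev Hilb {𝒱 : Type*} (n : 𝒱 → ℕ) (V : Finset 𝒱) : Type _ :=
  EuclideanSpace ℂ (Conf n V)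

/-- The algebra `𝒜_V = ⨂_{x ∈ V} M_(n x)` of observables on `ℋ_V`, written in the product basis.
Its norm `‖·‖` is the operator norm of `ℋ_V`. -/
abbrev Obs {𝒱 : Type*} (n : 𝒱 → ℕ) (V : Finset 𝒱) : Type _ :=
  Matrix (Conf n V) (Conf n V) ℂ

/-- The embedding `𝒜_X → 𝒜_V`, `A ↦ A ⊗ 𝟙`, for `X ⊆ V`. -/
def embed {𝒱 : Type*} [DecidableEq 𝒱] {n : 𝒱 → ℕ} {X V : Finset 𝒱} (h : X ⊆ V)
    (A : Obs n X) : Obs n V :=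
  Matrix.of fun σ τ =>
    if ∀ y : ↥V, (y : 𝒱) ∉ X → σ y = τ y then
      A (fun x => σ ⟨x, h x.2⟩) (fun x => τ ⟨x, h x.2⟩)
    else 0

/-- An interaction: a self-adjoint `Φ(X) ∈ 𝒜_X` for every finite set `X` of sites. -/
structure Interaction {𝒱 : Type*} (n : 𝒱 → ℕ) where
  term : (X : Finset 𝒱) → Obs n X
  isHermitian : ∀ X, (term X).IsHermitian

/-- The local Hamiltonian `H_V = ∑_{X ⊆ V} Φ(X)`. -/
def hamiltonian {𝒱 : Type*} [DecidableEq 𝒱] {n : 𝒱 → ℕ} (Φ : Interaction n) (V : Finset 𝒱) :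
    Obs n V :=
  ∑ X ∈ V.powerset.attach, embed (Finset.mem_powerset.1 X.2) (Φ.term X.1)

/-- The finite volume dynamics `τ_t^V(A) = e^{itH_V} A e^{-itH_V}`. -/
def evolve {𝒱 : Type*} [DecidableEq 𝒱] {n : 𝒱 → ℕ} (Φ : Interaction n) (V : Finset 𝒱)
    (t : ℝ) (A : Obs n V) : Obs n V :=
  NormedSpace.exp ((Complex.I * (t : ℂ)) • hamiltonian Φ V) * A *
    NormedSpace.exp ((-(Complex.I * (t : ℂ))) • hamiltonian Φ V)

/-- `κ_a = sup_x ∑_y e^{-a d(x,y)}`, with values in `[0, ∞]`. -/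
def kappa (𝒱 : Type*) [MetricSpace 𝒱] (a : ℝ) : ℝ≥0∞ :=
  ⨆ x : 𝒱, ∑' y : 𝒱, ENNReal.ofReal (Real.exp (-a * dist x y))

/-- `Φ` has range at most `R`: `Φ(X) = 0` whenever the diameter of `X` exceeds `R`. -/
def Interaction.HasRange {𝒱 : Type*} [MetricSpace 𝒱] {n : 𝒱 → ℕ} (Φ : Interaction n)
    (R : ℝ) : Prop :=
  ∀ X : Finset 𝒱, R < Metric.diam (X : Set 𝒱) → Φ.term X = 0

/-- `Φ` is uniformly bounded by `J`. -/
def Interaction.BoundedBy {𝒱 : Type*} [DecidableEq 𝒱] {n : 𝒱 → ℕ} (Φ : Interaction n)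
    (J : ℝ) : Prop :=
  ∀ X : Finset 𝒱, ‖Φ.term X‖ ≤ J

open Classical in
/-- The characteristic function `χ_Φ`: `1` if `Φ(X) ≠ 0`, and `0` otherwise. -/
def Interaction.chi {𝒱 : Type*} {n : 𝒱 → ℕ} (Φ : Interaction n) (X : Finset 𝒱) : ℝ≥0∞ :=
  if Φ.term X ≠ 0 then 1 else 0

/-- `N_Φ = sup_x ∑_{X ∋ x} |X| χ_Φ(X)`, with values in `[0, ∞]`. -/
def Interaction.bigN {𝒱 : Type*} {n : 𝒱 → ℕ} (Φ : Interaction n) : ℝ≥0∞ :=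
  ⨆ x : 𝒱, ∑' X : {X : Finset 𝒱 // x ∈ X}, ((X : Finset 𝒱).card : ℝ≥0∞) * Φ.chi X

/-- `C_Φ = sup_x ∑_{X ∋ x} χ_Φ(X)`, with values in `[0, ∞]`. -/
def Interaction.bigC {𝒱 : Type*} {n : 𝒱 → ℕ} (Φ : Interaction n) : ℝ≥0∞ :=
  ⨆ x : 𝒱, ∑' X : {X : Finset 𝒱 // x ∈ X}, Φ.chi X

/-- `ψ₀` is the unique normalized ground state (up to a phase) of the self-adjoint `H`, and the
spectrum of `H` above the ground state energy `E₀` starts no lower than `E₀ + γ`. -/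
def IsGappedGroundState {𝒱 : Type*} [DecidableEq 𝒱] {n : 𝒱 → ℕ} {V : Finset 𝒱}
    (H : Obs n V) (ψ₀ : Hilb n V) (γ : ℝ) : Prop :=
  ‖ψ₀‖ = 1 ∧ 0 < γ ∧ ∃ E₀ : ℝ,
    Module.End.eigenspace (Matrix.toEuclideanLin H) (E₀ : ℂ) = Submodule.span ℂ {ψ₀} ∧
    ∀ E : ℝ, Module.End.HasEigenvalue (Matrix.toEuclideanLin H) (E : ℂ) → E ≠ E₀ → E₀ + γ ≤ E

/-- The orthogonal projection `|ψ⟩⟨ψ|` onto the line spanned by a unit vector `ψ`. -/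
def projOnto {𝒱 : Type*} [DecidableEq 𝒱] {n : 𝒱 → ℕ} {V : Finset 𝒱} (ψ : Hilb n V) : Obs n V :=
  Matrix.of fun σ τ => ψ σ * star (ψ τ)

open Classical in
/-- `∂_Φ X`: the sites of `X` lying in some finite `Y` with `Y ⊄ X` and `Φ(Y) ≠ 0`. -/
def phiBoundary {𝒱 : Type*} {n : 𝒱 → ℕ} (Φ : Interaction n) (X : Finset 𝒱) : Finset 𝒱 :=
  X.filter fun x => ∃ Y : Finset 𝒱, x ∈ Y ∧ (∃ y ∈ Y, y ∉ X) ∧ Φ.term Y ≠ 0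

/-- `d(X,Y) = min {d(x,y) : x ∈ X, y ∈ Y}` (only relevant for nonempty `X` and `Y`). -/
def setDist {𝒱 : Type*} [MetricSpace 𝒱] (X Y : Finset 𝒱) : ℝ :=
  sInf {r : ℝ | ∃ x ∈ X, ∃ y ∈ Y, r = dist x y}

/-- The numbers `c` and `v` are Lieb-Robinson constants of `Φ` for the decay rate `μ`; they are
the same for all finite volumes `V`. -/
def IsLiebRobinson {𝒱 : Type*} [DecidableEq 𝒱] [MetricSpace 𝒱] {n : 𝒱 → ℕ}
    (Φ : Interaction n) (μ c v : ℝ) : Prop :=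
  0 < c ∧ 0 < v ∧
  ∀ (V X Y : Finset 𝒱) (hX : X ⊆ V) (hY : Y ⊆ V), Disjoint X Y →
    ∀ (A : Obs n X) (B : Obs n Y) (t : ℝ),
      ‖evolve Φ V t (embed hX A) * embed hY B - embed hY B * evolve Φ V t (embed hX A)‖ ≤
        c * ‖A‖ * ‖B‖ * (min (phiBoundary Φ X).card (phiBoundary Φ Y).card : ℕ) *
          Real.exp (-μ * (setDist X Y - v * |t|))

open Classical in
/-- The `R`-boundary `∂X` of `X` in `V`. -/
def bdry {𝒱 : Type*} [MetricSpace 𝒱] (R : ℝ) (V X : Finset 𝒱) : Finset 𝒱 :=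
  X.filter fun x => ∃ y ∈ V, y ∉ X ∧ dist x y ≤ R

open Classical in
/-- The `ℓ`-interior of `X` in `V`. -/
def interiorSet {𝒱 : Type*} [MetricSpace 𝒱] (R : ℝ) (V X : Finset 𝒱) (l : ℝ) : Finset 𝒱 :=
  X.filter fun x => ∀ y ∈ bdry R V X, l ≤ dist x y

open Classical in
/-- The `ℓ`-border of `X` in `V`. -/
def borderSet {𝒱 : Type*} [MetricSpace 𝒱] (R : ℝ) (V X : Finset 𝒱) (l : ℝ) : Finset 𝒱 :=
  V.filter fun x => ∃ y ∈ bdry R V X, dist x y < l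

open Classical in
/-- The `ℓ`-exterior of `X` in `V`. -/
def exteriorSet {𝒱 : Type*} [MetricSpace 𝒱] (R : ℝ) (V X : Finset 𝒱) (l : ℝ) : Finset 𝒱 :=
  V.filter fun x => x ∉ X ∧ ∀ y ∈ bdry R V X, l ≤ dist x y

theorem borderSet_subset {𝒱 : Type*} [MetricSpace 𝒱] (R : ℝ) (V X : Finset 𝒱) (l : ℝ) :
    borderSet R V X l ⊆ V :=
  Finset.filter_subset _ _

/-- The structural assumption on `X ⊆ V`: at every length scale `ℓ > R`,
`max {|∂X_int|, |X_bd|, |∂X_ext|} ≤ C ℓ |∂X|`. -/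
def HasRegularBoundary {𝒱 : Type*} [MetricSpace 𝒱] (R : ℝ) (V X : Finset 𝒱) (C : ℝ) : Prop :=
  ∀ l : ℝ, R < l →
    ((bdry R V (interiorSet R V X l)).card : ℝ) ≤ C * l * (bdry R V X).card ∧
    ((borderSet R V X l).card : ℝ) ≤ C * l * (bdry R V X).card ∧
    ((bdry R V (exteriorSet R V X l)).card : ℝ) ≤ C * l * (bdry R V X).card

/-- The length `ξ` with `2/ξ = μ γ² / (μ² v² + γ²)`. -/
def xi (μ v γ : ℝ) : ℝ := 2 * (μ ^ 2 * v ^ 2 + γ ^ 2) / (μ * γ ^ 2)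

end

end SpinSystem

/-! Put k = H − E₀ and split H = A₁ + A₂ + B: A₁ and A₂ collect the terms that meet the ℓ-interior
and the ℓ-exterior, B the remaining ones near the boundary. Averaging the Heisenberg dynamics over a
Gaussian time of variance w fixes H, so k = (Ã₁ − a₁) + (Ã₂ − a₂) + D, with aᵢ the ground state
expectation of Aᵢ and D equal to the average of B up to a scalar.

The gap enters through F = ∫ e^{itk}: it equals P₀ + rk, where F − P₀ and r are of order e^{-wγ²/2}
(`exists_kernel_projection`). Hence (Ãᵢ − aᵢ)P₀ = r[k,Aᵢ]P₀ is tiny, because [k,Aᵢ] has only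
boundary size (`norm_smear_sub_mul_le`, `norm_commutator_meeting_le`). Locality enters through the
Lieb–Robinson bound: up to errors e^{-μℓ + wμ²v²/2}, with polynomial factors, the averages Ãᵢ may be
computed with the dynamics inside 𝒳 or inside its complement (`norm_heisenberg_meeting_sub_le`).

Let P and Q be the spectral projections onto [-δ,δ] of these strictly local versions of Ãᵢ − aᵢ.
Both almost fix the ground state, and k − D is of order δ on the range of PQ. Therefore P₀ ≈ F P Q ≈
∫ e^{itk} e^{-it(k-D)} P Q. The integrand solves an equation driven only by the evolved D, so
replacing D and the dynamics by versions living in the 3ℓ-border gives the border observable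
(`norm_averagedPropagator_mul_sub_le`, `exists_approximation`).

The variance w = 2μℓ/(μ²v²+γ²) makes the gap error and the locality error both equal to ρ² with ρ =
e^{-ℓ/ξ}. Taking δ = ρ, the division by δ leaves ℓ⁴ρ, which `pow_four_mul_exp_le` turns into the
claimed rate. If no term crosses the boundary, the ground state factorises exactly; if ℓ ≤ 3R, a
large constant suffices.

Lieb–Robinson constants come from iterating a commutator inequality on weighted sums over sites, a
contraction by 1/2 (`lieb_robinson_step`, `lieb_robinson_weighted`). -/

namespace SpinSystem

/-! ### Unitary groups and Heisenberg dynamics in a C*-algebra. -/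

section Dynamics

variable {𝓐 : Type*} [CStarAlgebra 𝓐]

/-- The one-parameter group `e^{itK}`. -/
noncomputable def propagator (K : 𝓐) (t : ℝ) : 𝓐 := NormedSpace.exp ((Complex.I * (t : ℂ)) • K)

/-- The Heisenberg dynamics `e^{itK} A e^{-itK}`. -/
noncomputable def heisenberg (K : 𝓐) (t : ℝ) (A : 𝓐) : 𝓐 := propagator K t * A * propagator K (-t)

theorem propagator_zero (K : 𝓐) : propagator K 0 = 1 := by
  simp [propagator, NormedSpace.exp_zero]

theorem propagator_add (K : 𝓐) (s t : ℝ) :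
    propagator K (s + t) = propagator K s * propagator K t := by
  let := NormedAlgebra.restrictScalars ℚ ℂ 𝓐
  rw [propagator, propagator, propagator, ← NormedSpace.exp_add_of_commute]
  · rw [← add_smul]; push_cast; ring_nf
  · exact ((Commute.refl K).smul_left _).smul_right _

theorem propagator_mul_neg (K : 𝓐) (t : ℝ) : propagator K t * propagator K (-t) = 1 := by
  rw [← propagator_add, add_neg_cancel, propagator_zero]

theorem propagator_neg_mul (K : 𝓐) (t : ℝ) : propagator K (-t) * propagator K t = 1 := by
  rw [← propagator_add, neg_add_cancel, propagator_zero]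

theorem commute_propagator {K A : 𝓐} (h : Commute K A) (t : ℝ) : Commute (propagator K t) A := by
  let := NormedAlgebra.restrictScalars ℚ ℂ 𝓐
  exact (h.smul_left _).exp_left

theorem propagator_add_of_commute {K L : 𝓐} (h : Commute K L) (t : ℝ) :
    propagator (K + L) t = propagator K t * propagator L t := by
  let := NormedAlgebra.restrictScalars ℚ ℂ 𝓐
  rw [propagator, smul_add, NormedSpace.exp_add_of_commute ((h.smul_left _).smul_right _)]
  rfl

theorem star_propagator {K : 𝓐} (hK : IsSelfAdjoint K) (t : ℝ) :
    star (propagator K t) = propagator K (-t) := by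
  rw [propagator, NormedSpace.star_exp, propagator]
  congr 1
  rw [star_smul, hK.star_eq]
  simp

theorem propagator_mem_unitary {K : 𝓐} (hK : IsSelfAdjoint K) (t : ℝ) :
    propagator K t ∈ unitary 𝓐 := by
  rw [Unitary.mem_iff, star_propagator hK]
  exact ⟨propagator_neg_mul K t, propagator_mul_neg K t⟩

theorem norm_propagator_le {K : 𝓐} (hK : IsSelfAdjoint K) (t : ℝ) : ‖propagator K t‖ ≤ 1 := by
  nontriviality 𝓐
  exact (CStarRing.norm_of_mem_unitary (propagator_mem_unitary hK t)).le

theorem hasDerivAt_propagator (K : 𝓐) (t : ℝ) :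
    HasDerivAt (propagator K) (propagator K t * (Complex.I • K)) t := by
  have h := (hasDerivAt_exp_smul_const (𝕂 := ℝ) (Complex.I • K) t)
  have e : ∀ u : ℝ, u • (Complex.I • K) = (Complex.I * (u : ℂ)) • K := by
    intro u
    rw [← Complex.coe_smul, smul_smul, mul_comm]
  simp only [e] at h
  exact h

theorem hasDerivAt_propagator' (K : 𝓐) (t : ℝ) :
    HasDerivAt (propagator K) ((Complex.I • K) * propagator K t) t := by
  have h := hasDerivAt_propagator K t
  rwa [(commute_propagator ((Commute.refl K).smul_right Complex.I) t).eq] at h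

theorem hasDerivAt_propagator_neg (K : 𝓐) (t : ℝ) :
    HasDerivAt (fun s => propagator K (-s)) (-((Complex.I • K) * propagator K (-t))) t := by
  have h := (hasDerivAt_propagator' K (-t)).scomp t (hasDerivAt_neg t)
  simpa [Function.comp_def] using h

theorem continuous_propagator (K : 𝓐) : Continuous (propagator K) :=
  continuous_iff_continuousAt.2 fun t => (hasDerivAt_propagator K t).continuousAt

theorem continuous_heisenberg (K A : 𝓐) : Continuous fun t => heisenberg K t A := by
  unfold heisenberg
  exact ((continuous_propagator K).mul continuous_const).mul
    ((continuous_propagator K).comp continuous_neg)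

theorem norm_heisenberg {K : 𝓐} (hK : IsSelfAdjoint K) (t : ℝ) (A : 𝓐) :
    ‖heisenberg K t A‖ = ‖A‖ := by
  rw [heisenberg, CStarRing.norm_mul_mem_unitary _ (propagator_mem_unitary hK _),
    CStarRing.norm_mem_unitary_mul _ (propagator_mem_unitary hK _)]

theorem heisenberg_zero (K A : 𝓐) : heisenberg K 0 A = A := by
  simp [heisenberg, propagator_zero]

theorem heisenberg_add_time (K : 𝓐) (s t : ℝ) (A : 𝓐) :
    heisenberg K (s + t) A = heisenberg K s (heisenberg K t A) := by
  simp only [heisenberg, neg_add_rev, propagator_add, mul_assoc]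

theorem heisenberg_add (K : 𝓐) (t : ℝ) (A B : 𝓐) :
    heisenberg K t (A + B) = heisenberg K t A + heisenberg K t B := by
  simp [heisenberg, mul_add, add_mul]

theorem heisenberg_sub (K : 𝓐) (t : ℝ) (A B : 𝓐) :
    heisenberg K t (A - B) = heisenberg K t A - heisenberg K t B := by
  simp [heisenberg, mul_sub, sub_mul]

theorem heisenberg_sum {ι : Type*} (K : 𝓐) (t : ℝ) (s : Finset ι) (A : ι → 𝓐) :
    heisenberg K t (∑ i ∈ s, A i) = ∑ i ∈ s, heisenberg K t (A i) := by
  simp [heisenberg, Finset.mul_sum, Finset.sum_mul]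

theorem heisenberg_smul (K : 𝓐) (t : ℝ) (c : ℂ) (A : 𝓐) :
    heisenberg K t (c • A) = c • heisenberg K t A := by
  simp [heisenberg]

theorem heisenberg_mul (K : 𝓐) (t : ℝ) (A B : 𝓐) :
    heisenberg K t (A * B) = heisenberg K t A * heisenberg K t B := by
  have h := propagator_neg_mul K t
  calc propagator K t * (A * B) * propagator K (-t)
      = propagator K t * A * 1 * B * propagator K (-t) := by simp only [mul_one, mul_assoc]
    _ = _ := by rw [← h]; simp only [heisenberg, mul_assoc]

theorem heisenberg_of_commute {K A : 𝓐} (h : Commute K A) (t : ℝ) : heisenberg K t A = A := by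
  rw [heisenberg, (commute_propagator h t).eq, mul_assoc, propagator_mul_neg, mul_one]

theorem heisenberg_one (K : 𝓐) (t : ℝ) : heisenberg K t 1 = 1 :=
  heisenberg_of_commute (Commute.one_right K) t

theorem heisenberg_add_of_commute {K L A : 𝓐} (hKL : Commute K L) (h : Commute L A) (t : ℝ) :
    heisenberg (K + L) t A = heisenberg K t A := by
  have h' : propagator L t * A * propagator L (-t) = A := heisenberg_of_commute h t
  rw [heisenberg, propagator_add_of_commute hKL, add_comm, propagator_add_of_commute hKL.symm,
    heisenberg]
  calc _ = propagator K t * (propagator L t * A * propagator L (-t)) * propagator K (-t) := by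
        simp only [mul_assoc]
    _ = _ := by rw [h']

theorem isSelfAdjoint_heisenberg {K A : 𝓐} (hK : IsSelfAdjoint K) (hA : IsSelfAdjoint A)
    (t : ℝ) : IsSelfAdjoint (heisenberg K t A) := by
  rw [IsSelfAdjoint, heisenberg, star_mul, star_mul, star_propagator hK, star_propagator hK,
    hA.star_eq, neg_neg, mul_assoc]

theorem hasDerivAt_heisenberg (K A : 𝓐) (t : ℝ) :
    HasDerivAt (fun s => heisenberg K s A)
      (Complex.I • heisenberg K t (K * A - A * K)) t := by
  have h := ((hasDerivAt_propagator K t).mul_const A).mul (hasDerivAt_propagator_neg K t)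
  refine h.congr_deriv ?_
  simp only [heisenberg, smul_mul_assoc, mul_smul_comm, mul_neg, ← smul_neg, ← smul_add]
  congr 1
  noncomm_ring

/-- The mean value inequality on the interval `[-|t|, |t|]`. -/
theorem norm_sub_le_abs_mul {E : Type*} [NormedAddCommGroup E] [NormedSpace ℝ E]
    {f f' : ℝ → E} (hf : ∀ s, HasDerivAt f (f' s) s) {t M : ℝ}
    (hM : ∀ s, |s| ≤ |t| → ‖f' s‖ ≤ M) : ‖f t - f 0‖ ≤ |t| * M := by
  have h := (convex_Icc (-|t|) |t|).norm_image_sub_le_of_norm_hasDerivWithin_le (f := f) (f' := f')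
    (C := M) (x := 0) (y := t) (fun s _ => (hf s).hasDerivWithinAt)
    (fun s hs => hM s (abs_le.2 hs)) ⟨by simp, by simp⟩ (abs_le.1 le_rfl)
  rwa [sub_zero, Real.norm_eq_abs, mul_comm] at h

/-- Duhamel comparison of two dynamics. -/
theorem norm_heisenberg_sub_le {K L : 𝓐} (hL : IsSelfAdjoint L) (A : 𝓐) {t M : ℝ}
    (hM : ∀ s, |s| ≤ |t| →
      ‖(K - L) * heisenberg K s A - heisenberg K s A * (K - L)‖ ≤ M) :
    ‖heisenberg K t A - heisenberg L t A‖ ≤ |t| * M := by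
  -- Evolving forward with K and back with L starts at A and has derivative i times the back-evolved
  -- commutator of K − L with the evolved A.
  set f : ℝ → 𝓐 := fun s => heisenberg L (-s) (heisenberg K s A) with hf
  have hd : ∀ s, HasDerivAt f (Complex.I • heisenberg L (-s)
      ((K - L) * heisenberg K s A - heisenberg K s A * (K - L))) s := by
    intro s
    have h1 := hasDerivAt_heisenberg K A s
    have h2 := ((hasDerivAt_propagator_neg L s).mul h1).mul (hasDerivAt_propagator L s)
    have e : f = fun s => propagator L (-s) * heisenberg K s A * propagator L s := by
      funext s; simp [hf, heisenberg]
    rw [e]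
    refine h2.congr_deriv ?_
    have e3 : heisenberg K s (K * A - A * K) = K * heisenberg K s A - heisenberg K s A * K := by
      have : heisenberg K s K = K := heisenberg_of_commute (Commute.refl K) s
      rw [heisenberg_sub, heisenberg_mul, heisenberg_mul, this]
    have e4 : L * propagator L (-s) = propagator L (-s) * L :=
      (commute_propagator (Commute.refl L) (-s)).eq.symm
    simp only [Pi.mul_apply]
    have e5 : propagator L s * L = L * propagator L s :=
      (commute_propagator (Commute.refl L) s).eq
    rw [e3]
    generalize heisenberg K s A = X
    simp only [heisenberg, neg_neg, smul_mul_assoc, mul_smul_comm, ← smul_neg, ← smul_add, neg_mul]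
    congr 1
    rw [e4, e5]
    noncomm_ring
  have h := norm_sub_le_abs_mul hd (t := t) (M := M) (fun s hs => by
    rw [norm_smul, Complex.norm_I, one_mul, norm_heisenberg hL]; exact hM s hs)
  have e : f t - f 0 = heisenberg L (-t) (heisenberg K t A - heisenberg L t A) := by
    simp only [hf, neg_zero, heisenberg_zero]
    rw [heisenberg_sub, ← heisenberg_add_time L (-t) t A, neg_add_cancel, heisenberg_zero]
  rwa [e, norm_heisenberg hL] at h

/-- The commutator vanishes at time 0 and its derivative involves A only through [K, A]. For A a
bulk sum of interaction terms this trades a norm of volume size for one of boundary size, at the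
price of a factor |t|. -/
theorem norm_commutator_heisenberg_le (K W A : 𝓐) (hWA : Commute W A) {t M : ℝ}
    (hM : ∀ s, |s| ≤ |t| →
      ‖W * heisenberg K s (K * A - A * K) - heisenberg K s (K * A - A * K) * W‖ ≤ M) :
    ‖W * heisenberg K t A - heisenberg K t A * W‖ ≤ |t| * M := by
  have hd : ∀ s, HasDerivAt (fun s => W * heisenberg K s A - heisenberg K s A * W)
      (Complex.I • (W * heisenberg K s (K * A - A * K) - heisenberg K s (K * A - A * K) * W)) s := by
    intro s
    have h1 := hasDerivAt_heisenberg K A s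
    refine HasDerivAt.congr_deriv ((h1.const_mul W).sub (h1.mul_const W)) ?_
    simp [smul_sub]
  have h := norm_sub_le_abs_mul hd (t := t) (M := M) (fun s hs => by
    rw [norm_smul, Complex.norm_I, one_mul]; exact hM s hs)
  simpa [heisenberg_zero, hWA.eq] using h

/-- In the interaction picture the propagator is driven by the evolved D alone. Its locality
therefore reduces to that of the evolved D, although K is spread over the whole volume. -/
theorem hasDerivAt_interaction_picture (K D : 𝓐) (t : ℝ) :
    HasDerivAt (fun s => propagator K s * propagator (K - D) (-s))
      (Complex.I • (heisenberg K t D * (propagator K t * propagator (K - D) (-t)))) t := by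
  refine HasDerivAt.congr_deriv ((hasDerivAt_propagator K t).mul (hasDerivAt_propagator_neg (K - D) t)) ?_
  have h : propagator K (-t) * propagator K t = 1 := propagator_neg_mul K t
  symm
  calc _ = Complex.I • (propagator K t * D * (propagator K (-t) * propagator K t)
        * propagator (K - D) (-t)) := by simp only [heisenberg, mul_assoc]
    _ = _ := by
      rw [h]
      simp only [mul_one, smul_mul_assoc, mul_smul_comm, ← smul_neg, ← smul_add, mul_neg]
      congr 1
      noncomm_ring

/-- The interaction-picture propagators of close generators are close. -/
theorem norm_interaction_picture_sub_le {K D K' D' : 𝓐} (hK : IsSelfAdjoint K)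
    (hD : IsSelfAdjoint D) (hK' : IsSelfAdjoint K') (hD' : IsSelfAdjoint D') {t M : ℝ}
    (hM : ∀ s, |s| ≤ |t| → ‖heisenberg K s D - heisenberg K' s D'‖ ≤ M) :
    ‖propagator K t * propagator (K - D) (-t) - propagator K' t * propagator (K' - D') (-t)‖ ≤
      |t| * M := by
  set u : ℝ → 𝓐 := fun s => propagator K s * propagator (K - D) (-s) with hu
  set u' : ℝ → 𝓐 := fun s => propagator K' s * propagator (K' - D') (-s) with hu'
  have hmem : ∀ s, u s ∈ unitary 𝓐 := fun s =>
    mul_mem (propagator_mem_unitary hK s) (propagator_mem_unitary (hK.sub hD) (-s))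
  have hmem' : ∀ s, u' s ∈ unitary 𝓐 := fun s =>
    mul_mem (propagator_mem_unitary hK' s) (propagator_mem_unitary (hK'.sub hD') (-s))
  -- The product u'* u starts at 1, and by unitarity the norm of its derivative is that of the
  -- difference of the two drivers.
  have hd : ∀ s, HasDerivAt (fun s => star (u' s) * u s)
      (Complex.I • (star (u' s) * (heisenberg K s D - heisenberg K' s D') * u s)) s := by
    intro s
    have h1 := (hasDerivAt_interaction_picture K' D' s).star
    have h2 := hasDerivAt_interaction_picture K D s
    refine HasDerivAt.congr_deriv (h1.mul h2) ?_
    have hs : star (heisenberg K' s D') = heisenberg K' s D' :=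
      (isSelfAdjoint_heisenberg hK' hD' s).star_eq
    change star (Complex.I • (heisenberg K' s D' * u' s)) * u s
      + star (u' s) * (Complex.I • (heisenberg K s D * u s)) = _
    rw [star_smul, star_mul, hs]
    simp only [mul_sub, sub_mul, smul_sub, smul_mul_assoc, mul_smul_comm, mul_assoc,
      RCLike.star_def, Complex.conj_I, neg_smul, neg_mul]
    abel
  have h := norm_sub_le_abs_mul hd (t := t) (M := M) (fun s hs => by
    rw [norm_smul, Complex.norm_I, one_mul, CStarRing.norm_mul_mem_unitary _ (hmem s),
      CStarRing.norm_mem_unitary_mul _ (Unitary.star_mem (hmem' s))]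
    exact hM s hs)
  have e0 : star (u' 0) * u 0 = 1 := by simp [hu, hu', propagator_zero]
  rw [e0, ← CStarRing.norm_mem_unitary_mul _ (hmem' t), mul_sub, ← mul_assoc,
    (Unitary.mem_iff.1 (hmem' t)).2, one_mul, mul_one] at h
  exact h

theorem norm_propagator_mul_sub_le {N : 𝓐} (hN : IsSelfAdjoint N) (P : 𝓐) (t : ℝ) :
    ‖propagator N t * P - P‖ ≤ |t| * ‖N * P‖ := by
  have hd : ∀ s, HasDerivAt (fun s => propagator N s * P)
      (propagator N s * (Complex.I • (N * P))) s := by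
    intro s
    convert (hasDerivAt_propagator N s).mul_const P using 1
    simp [mul_assoc]
  have h := norm_sub_le_abs_mul hd (t := t) (M := ‖N * P‖) (fun s hs => by
    rw [CStarRing.norm_mem_unitary_mul _ (propagator_mem_unitary hN s), norm_smul, Complex.norm_I,
      one_mul])
  simpa [propagator_zero] using h

/-- If `f` is conjugation of `B` by the interaction picture propagator of `K` and `W`, its
derivative has the norm of `[τ_s(W), B]`. -/
theorem norm_commutator_conj_le {K W B : 𝓐} (hK : IsSelfAdjoint K) (hW : IsSelfAdjoint W)
    {θ : ℝ} {g g' : ℝ → ℝ} (hg : ∀ s, HasDerivAt g (g' s) s) (hg0 : 0 ≤ g 0) {T : ℝ} (hT : 0 ≤ T)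
    (hθ : |θ| = 1)
    (hM : ∀ s, 0 ≤ s → s ≤ T →
      ‖heisenberg K (θ * s) W * B - B * heisenberg K (θ * s) W‖ ≤ g' s) (A : 𝓐) :
    ‖heisenberg K (θ * T) (heisenberg (K - W) (-(θ * T)) A) * B
        - B * heisenberg K (θ * T) (heisenberg (K - W) (-(θ * T)) A)‖
      ≤ ‖A * B - B * A‖ + 2 * ‖A‖ * g T := by
  set u : ℝ → 𝓐 := fun s => propagator K s * propagator (K - W) (-s) with hu
  have hmem : ∀ s, u s ∈ unitary 𝓐 := fun s =>
    mul_mem (propagator_mem_unitary hK s) (propagator_mem_unitary (hK.sub hW) (-s))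
  set f : ℝ → 𝓐 := fun s => star (u (θ * s)) * B * u (θ * s) - B with hf
  have hder : ∀ s, HasDerivAt f (θ • (Complex.I • (star (u (θ * s)) *
      (B * heisenberg K (θ * s) W - heisenberg K (θ * s) W * B) * u (θ * s)))) s := by
    intro s
    have hin : HasDerivAt (fun s : ℝ => θ * s) θ s := by
      simpa using (hasDerivAt_id s).const_mul θ
    have h2 := (hasDerivAt_interaction_picture K W (θ * s)).scomp s hin
    have h1 := h2.star
    have h3 := ((h1.mul_const B).mul h2).sub_const B
    refine HasDerivAt.congr_deriv (h3) ?_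
    have hs : star (heisenberg K (θ * s) W) = heisenberg K (θ * s) W :=
      (isSelfAdjoint_heisenberg hK hW _).star_eq
    change star (θ • (Complex.I • (heisenberg K (θ * s) W * u (θ * s)))) * B * u (θ * s)
      + star (u (θ * s)) * B * (θ • (Complex.I • (heisenberg K (θ * s) W * u (θ * s)))) = _
    rw [star_smul, star_smul, star_mul, hs]
    simp only [mul_sub, sub_mul, smul_sub, smul_mul_assoc, mul_smul_comm, mul_assoc,
      RCLike.star_def, Complex.conj_I, neg_smul, neg_mul, star_trivial, smul_neg]
    abel
  -- Comparison with a primitive g, instead of a uniform bound on the derivative, keeps the gain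
  -- from integrating an exponential rate; `lieb_robinson_step` depends on it.
  have hb : ‖f T‖ ≤ g T := by
    refine image_norm_le_of_norm_deriv_right_le_deriv_boundary (f := f) (a := 0) (b := T)
      (fun s _ => (hder s).continuousAt.continuousWithinAt)
      (fun s _ => (hder s).hasDerivWithinAt) ?_ hg (fun s hs => ?_) ⟨hT, le_rfl⟩
    · simpa [hf, hu, propagator_zero] using hg0
    · rw [norm_smul, norm_smul, Complex.norm_I, one_mul, CStarRing.norm_mul_mem_unitary _ (hmem _),
        CStarRing.norm_mem_unitary_mul _ (Unitary.star_mem (hmem _)), Real.norm_eq_abs, hθ, one_mul,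
        norm_sub_rev]
      exact hM s hs.1 hs.2.le
  have hU := hmem (θ * T)
  have e1 : heisenberg K (θ * T) (heisenberg (K - W) (-(θ * T)) A)
      = u (θ * T) * A * star (u (θ * T)) := by
    simp only [hu, heisenberg, star_mul, star_propagator hK, star_propagator (hK.sub hW), neg_neg,
      mul_assoc]
  have hUU := (Unitary.mem_iff.1 hU).2
  have hUU' := (Unitary.mem_iff.1 hU).1
  set U := u (θ * T)
  have e2 : U * A * star U * B - B * (U * A * star U)
      = U * (A * (star U * B * U) - (star U * B * U) * A) * star U := by
    have : U * (A * (star U * B * U) - (star U * B * U) * A) * star U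
      = U * A * star U * B * (U * star U) - (U * star U) * B * (U * A * star U) := by
        noncomm_ring
    rw [this, hUU, mul_one, one_mul]
  have e3 : A * (star U * B * U) - (star U * B * U) * A = (A * B - B * A) + (A * f T - f T * A) := by
    simp only [hf]; noncomm_ring
  rw [e1, e2, CStarRing.norm_mul_mem_unitary _ (Unitary.star_mem hU),
    CStarRing.norm_mem_unitary_mul _ hU, e3]
  refine (norm_add_le _ _).trans (add_le_add le_rfl ?_)
  have h1 : ‖A * f T‖ ≤ ‖A‖ * g T := (norm_mul_le _ _).trans (by gcongr)
  have h2 : ‖f T * A‖ ≤ ‖A‖ * g T := (norm_mul_le _ _).trans (by rw [mul_comm]; gcongr)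
  linarith [norm_sub_le (A * f T) (f T * A)]

end Dynamics

end SpinSystem

namespace SpinSystem

/-! ### Gaussian time averages and spectral projections. -/

section Smearing

open MeasureTheory ProbabilityTheory
open scoped NNReal

variable {𝓐 : Type*} [CStarAlgebra 𝓐]

theorem integrable_exp_mul_abs_gaussianReal (v : ℝ≥0) (a : ℝ) :
    Integrable (fun s => Real.exp (a * |s|)) (gaussianReal 0 v) := by
  refine ((integrable_exp_mul_gaussianReal (μ := 0) (v := v) a).add
    (integrable_exp_mul_gaussianReal (μ := 0) (v := v) (-a))).mono'
    (by fun_prop) (Filter.Eventually.of_forall fun s => ?_)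
  rw [Real.norm_eq_abs, Real.abs_exp, Pi.add_apply]
  rcases abs_cases s with h | h
  · rw [h.1]; linarith [Real.exp_pos (-a * s)]
  · rw [h.1]
    have : a * -s = -a * s := by ring
    rw [this]; linarith [Real.exp_pos (a * s)]

theorem integral_exp_mul_abs_gaussianReal_le (v : ℝ≥0) (a : ℝ) :
    ∫ s, Real.exp (a * |s|) ∂(gaussianReal 0 v) ≤ 2 * Real.exp (v * a ^ 2 / 2) := by
  have h1 := integrable_exp_mul_gaussianReal (μ := 0) (v := v) a
  have h2 := integrable_exp_mul_gaussianReal (μ := 0) (v := v) (-a)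
  have hm : ∀ b : ℝ, ∫ s, Real.exp (b * s) ∂(gaussianReal 0 v) = Real.exp (v * b ^ 2 / 2) := by
    intro b
    have := congrFun (mgf_id_gaussianReal (μ := 0) (v := v)) b
    simpa [mgf] using this
  calc ∫ s, Real.exp (a * |s|) ∂(gaussianReal 0 v)
      ≤ ∫ s, (Real.exp (a * s) + Real.exp (-a * s)) ∂(gaussianReal 0 v) := by
        refine integral_mono (integrable_exp_mul_abs_gaussianReal v a) (h1.add h2) fun s => ?_
        rcases abs_cases s with h | h
        · simp only [h.1]; linarith [Real.exp_pos (-a * s)]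
        · simp only [h.1]
          have : a * -s = -a * s := by ring
          rw [this]; linarith [Real.exp_pos (a * s)]
    _ = _ := by rw [integral_add h1 h2, hm, hm]; ring_nf

theorem integrable_of_continuous_of_norm_le {f : ℝ → 𝓐} (hf : Continuous f) {C : ℝ}
    (hC : ∀ t, ‖f t‖ ≤ C) (v : ℝ≥0) : Integrable f (gaussianReal 0 v) :=
  Integrable.of_bound hf.aestronglyMeasurable C (Filter.Eventually.of_forall hC)

/-- Gaussian time average of the Heisenberg dynamics. -/
noncomputable def smear (v : ℝ≥0) (K A : 𝓐) : 𝓐 := ∫ t, heisenberg K t A ∂(gaussianReal 0 v)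

theorem integrable_heisenberg {K : 𝓐} (hK : IsSelfAdjoint K) (v : ℝ≥0) (A : 𝓐) :
    Integrable (fun t => heisenberg K t A) (gaussianReal 0 v) :=
  integrable_of_continuous_of_norm_le (continuous_heisenberg K A)
    (fun t => (norm_heisenberg hK t A).le) v

theorem smear_of_commute {K A : 𝓐} (h : Commute K A) (v : ℝ≥0) : smear v K A = A := by
  simp [smear, heisenberg_of_commute h]

theorem smear_add {K : 𝓐} (hK : IsSelfAdjoint K) (v : ℝ≥0) (A B : 𝓐) :
    smear v K (A + B) = smear v K A + smear v K B := by
  simp only [smear, heisenberg_add]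
  exact integral_add (integrable_heisenberg hK v A) (integrable_heisenberg hK v B)

theorem isSelfAdjoint_smear {K A : 𝓐} (hK : IsSelfAdjoint K) (hA : IsSelfAdjoint A) (v : ℝ≥0) :
    IsSelfAdjoint (smear v K A) := by
  rw [IsSelfAdjoint, smear]
  have h := ((starL' ℝ : 𝓐 ≃L[ℝ] 𝓐) : 𝓐 →L[ℝ] 𝓐).integral_comp_comm (integrable_heisenberg hK v A)
  simp only [ContinuousLinearEquiv.coe_coe, starL'_apply] at h
  rw [← h]
  exact integral_congr_ae
    (Filter.Eventually.of_forall fun t => (isSelfAdjoint_heisenberg hK hA t).star_eq)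

theorem heisenberg_smear {K : 𝓐} (hK : IsSelfAdjoint K) (v : ℝ≥0) (A : 𝓐) (t : ℝ) :
    heisenberg K t (smear v K A) = ∫ s, heisenberg K (t + s) A ∂(gaussianReal 0 v) := by
  have h := ((ContinuousLinearMap.mul ℝ 𝓐 (propagator K t)).comp
    ((ContinuousLinearMap.mul ℝ 𝓐).flip (propagator K (-t)))).integral_comp_comm
    (integrable_heisenberg hK v A)
  simp only [ContinuousLinearMap.comp_apply, ContinuousLinearMap.flip_apply,
    ContinuousLinearMap.mul_apply'] at h
  rw [heisenberg, smear, mul_assoc, ← h]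
  refine integral_congr_ae (Filter.Eventually.of_forall fun s => ?_)
  simp only [heisenberg_add_time K t s]
  simp only [heisenberg, mul_assoc]

theorem integral_mul_right_gaussian {f : ℝ → 𝓐} {v : ℝ≥0} (hf : Integrable f (gaussianReal 0 v))
    (A : 𝓐) : (∫ t, f t ∂(gaussianReal 0 v)) * A = ∫ t, f t * A ∂(gaussianReal 0 v) := by
  have h := ((ContinuousLinearMap.mul ℝ 𝓐).flip A).integral_comp_comm hf
  simpa using h.symm

theorem cfc_mul_self_of_finite {M : 𝓐} (hM : IsSelfAdjoint M) (hfin : (spectrum ℝ M).Finite)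
    (g : ℝ → ℝ) : cfc g M * M = cfc (fun x => g x * x) M := by
  rw [cfc_mul g _ M (hfin.continuousOn _) (hfin.continuousOn _), cfc_id' ℝ M]

theorem self_mul_cfc_of_finite {M : 𝓐} (hM : IsSelfAdjoint M) (hfin : (spectrum ℝ M).Finite)
    (g : ℝ → ℝ) : M * cfc g M = cfc (fun x => x * g x) M := by
  rw [cfc_mul _ g M (hfin.continuousOn _) (hfin.continuousOn _), cfc_id' ℝ M]

/-- A spectral projection of `M` onto `[-δ, δ]`. -/
theorem exists_spectral_projection {M : 𝓐} (hM : IsSelfAdjoint M) (hfin : (spectrum ℝ M).Finite)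
    {δ : ℝ} (hδ : 0 ≤ δ) :
    ∃ p r : 𝓐, IsStarProjection p ∧ ‖M * p‖ ≤ δ ∧ 1 - p = r * M ∧ δ * ‖r‖ ≤ 1 := by
  classical
  have hc : ∀ f : ℝ → ℝ, ContinuousOn f (spectrum ℝ M) := fun f => hfin.continuousOn f
  set f : ℝ → ℝ := fun x => if |x| ≤ δ then 1 else 0 with hf
  -- The inverse of x off [-δ, δ]. The value δ = 0 is allowed and yields the kernel projection with
  -- its pseudo-inverse.
  set g : ℝ → ℝ := fun x => if |x| ≤ δ then 0 else x⁻¹ with hg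
  refine ⟨cfc f M, cfc g M, ⟨?_, cfc_predicate f M⟩, ?_, ?_, ?_⟩
  · rw [IsIdempotentElem, ← cfc_mul f f M (hc _) (hc _)]
    congr 1; funext x; simp [hf]
  · rw [self_mul_cfc_of_finite hM hfin]
    refine norm_cfc_le hδ fun x _ => ?_
    by_cases h : |x| ≤ δ <;> simp [hf, h, hδ]
  · rw [cfc_mul_self_of_finite hM hfin, ← cfc_one ℝ M, ← cfc_sub _ f M (hc _) (hc _)]
    refine cfc_congr fun x _ => ?_
    by_cases h : |x| ≤ δ
    · simp [hf, hg, h]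
    · have : x ≠ 0 := by rintro rfl; simp at h; linarith
      simp [hf, hg, h, this]
  · rcases hδ.eq_or_lt with rfl | hδ'
    · simp
    · have : ‖cfc g M‖ ≤ δ⁻¹ := by
        refine norm_cfc_le (by positivity) fun x _ => ?_
        by_cases h : |x| ≤ δ
        · simp [hg, h, hδ]
        · simp only [hg, h, if_false, norm_inv, Real.norm_eq_abs]
          exact inv_anti₀ hδ' (not_le.1 h).le
      calc δ * ‖cfc g M‖ ≤ δ * δ⁻¹ := by gcongr
        _ = 1 := mul_inv_cancel₀ hδ'.ne'

theorem integral_cexp_gaussianReal (v : ℝ≥0) (x : ℝ) :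
    ∫ s, Complex.exp (Complex.I * (s : ℂ) * (x : ℂ)) ∂(gaussianReal 0 v)
      = (Real.exp (-(v * x ^ 2 / 2)) : ℂ) := by
  have h := charFun_gaussianReal (μ := 0) (v := v) x
  rw [charFun_apply_real] at h
  simp only [Complex.ofReal_zero, mul_zero, zero_mul, zero_sub] at h
  rw [Complex.ofReal_exp]
  push_cast
  rw [← h]
  congr 1; funext s; congr 1; ring

theorem propagator_eq_cfc {k : 𝓐} (hk : IsSelfAdjoint k) (s : ℝ) :
    propagator k s = cfc (fun z : ℂ => Complex.exp (Complex.I * (s : ℂ) * z)) k := by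
  have hn : IsStarNormal k := hk.isStarNormal
  rw [cfc_comp_const_mul (Complex.I * (s : ℂ)) Complex.exp k]
  have hn' : IsStarNormal ((Complex.I * (s : ℂ)) • k) := by infer_instance
  have := CFC.exp_eq_normedSpace_exp (𝕜 := ℂ) (a := (Complex.I * (s : ℂ)) • k)
  rw [propagator, ← this]
  congr 1
  funext z
  rw [Complex.exp_eq_exp_ℂ]

/-- The functional calculus commutes with the integral, which on each spectral value is the
characteristic function of the Gaussian. -/
theorem integral_propagator_eq_cfc {k : 𝓐} (hk : IsSelfAdjoint k) (v : ℝ≥0) :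
    ∫ s, propagator k s ∂(gaussianReal 0 v) = cfc (fun x : ℝ => Real.exp (-(v * x ^ 2 / 2))) k := by
  have hn : IsStarNormal k := hk.isStarNormal
  simp only [propagator_eq_cfc hk]
  rw [← cfc_integral (𝕜 := ℂ) (fun (s : ℝ) (z : ℂ) => Complex.exp (Complex.I * (s : ℂ) * z))
    (fun _ => 1) k (by fun_prop) ?_ (hasFiniteIntegral_const _), cfc_real_eq_complex _ hk]
  · refine cfc_congr fun z hz => ?_
    obtain ⟨x, hx⟩ : ∃ x : ℝ, z = x := ⟨z.re, hk.mem_spectrum_eq_re hz⟩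
    subst hx
    simp only [Complex.ofReal_re]
    exact integral_cexp_gaussianReal v x
  · refine Filter.Eventually.of_forall fun s z hz => ?_
    have hx := hk.mem_spectrum_eq_re hz
    rw [hx, Complex.norm_exp]
    simp

/-- Gaussian averaging of `e^{isk}` approximates the kernel projection of a gapped `k`. -/
theorem exists_kernel_projection {k : 𝓐} (hk : IsSelfAdjoint k) (hfin : (spectrum ℝ k).Finite)
    {γ : ℝ} (hγ : 0 < γ) (hgap : ∀ x ∈ spectrum ℝ k, x = 0 ∨ γ ≤ x) (v : ℝ≥0) :
    ∃ p s r : 𝓐, IsSelfAdjoint p ∧ k * p = 0 ∧ 1 - p = s * k ∧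
      ∫ t, propagator k t ∂(gaussianReal 0 v) - p = r * k ∧
      ‖∫ t, propagator k t ∂(gaussianReal 0 v) - p‖ ≤ Real.exp (-(v * γ ^ 2 / 2)) ∧
      ‖r‖ ≤ Real.exp (-(v * γ ^ 2 / 2)) / γ := by
  classical
  have hc : ∀ f : ℝ → ℝ, ContinuousOn f (spectrum ℝ k) := fun f => hfin.continuousOn f
  set e : ℝ → ℝ := fun x => Real.exp (-(v * x ^ 2 / 2)) with he
  set f : ℝ → ℝ := fun x => if x = 0 then 1 else 0 with hf
  -- Since 0⁻¹ = 0, this is the pseudo-inverse of k. The function `h` is the Gaussian factor divided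
  -- by x off the kernel; the gap bounds it by e^{-vγ²/2}/γ.
  set g : ℝ → ℝ := fun x => x⁻¹ with hg
  set h : ℝ → ℝ := fun x => if x = 0 then 0 else e x / x with hh
  have hmono : ∀ x, γ ≤ x → e x ≤ Real.exp (-(v * γ ^ 2 / 2)) := by
    intro x hx
    refine Real.exp_le_exp.2 (neg_le_neg ?_)
    have : γ ^ 2 ≤ x ^ 2 := by gcongr
    have hv : (0 : ℝ) ≤ v := v.2
    gcongr
  have hsub : ∫ t, propagator k t ∂(gaussianReal 0 v) - cfc f k = cfc (fun x => e x - f x) k := by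
    rw [integral_propagator_eq_cfc hk, ← cfc_sub _ f k (hc _) (hc _)]
  refine ⟨cfc f k, cfc g k, cfc h k, cfc_predicate f k, ?_, ?_, ?_, ?_, ?_⟩
  · rw [self_mul_cfc_of_finite hk hfin, ← cfc_zero ℝ k]
    refine cfc_congr fun x _ => ?_
    by_cases h0 : x = 0 <;> simp [hf, h0]
  · rw [cfc_mul_self_of_finite hk hfin, ← cfc_one ℝ k, ← cfc_sub _ f k (hc _) (hc _)]
    refine cfc_congr fun x _ => ?_
    by_cases h0 : x = 0 <;> simp [hf, hg, h0]
  · rw [hsub]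
    rw [cfc_mul_self_of_finite hk hfin]
    refine cfc_congr fun x _ => ?_
    by_cases h0 : x = 0 <;> simp [hf, hh, he, h0]
  · rw [hsub]
    refine norm_cfc_le (by positivity) fun x hx => ?_
    rcases hgap x hx with rfl | h1
    · simp [he, hf]; positivity
    · have : x ≠ 0 := by linarith
      simp only [hf, this, if_false, sub_zero]
      rw [Real.norm_eq_abs, abs_of_pos (Real.exp_pos _)]
      exact hmono x h1
  · refine norm_cfc_le (by positivity) fun x hx => ?_
    rcases hgap x hx with rfl | h1
    · simp [hh]; positivity
    · have h0 : x ≠ 0 := by linarith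
      simp only [hh, h0, if_false]
      rw [norm_div, Real.norm_eq_abs, Real.norm_eq_abs, abs_of_pos (Real.exp_pos _),
        abs_of_pos (by linarith)]
      exact div_le_div₀ (by positivity) (hmono x h1) hγ h1

end Smearing

end SpinSystem

namespace SpinSystem

/-! ### Local algebras inside the algebra of a finite volume. -/

section Local

variable {𝒱 : Type*} [DecidableEq 𝒱] {n : 𝒱 → ℕ} {X Y Z V : Finset 𝒱}

theorem embed_apply (h : X ⊆ V) (A : Obs n X) (σ τ : Conf n V) :
    embed h A σ τ = if ∀ y : ↥V, (y : 𝒱) ∉ X → σ y = τ y then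
      A (fun x => σ ⟨x, h x.2⟩) (fun x => τ ⟨x, h x.2⟩) else 0 := rfl

theorem conf_eq_of_forall (h : X ⊆ V) {σ τ : Conf n V}
    (h1 : ∀ y : ↥V, (y : 𝒱) ∉ X → σ y = τ y)
    (h2 : (fun x : ↥X => σ ⟨x, h x.2⟩) = fun x : ↥X => τ ⟨x, h x.2⟩) : σ = τ := by
  funext y
  by_cases hy : (y : 𝒱) ∈ X
  · exact congrFun h2 ⟨y, hy⟩
  · exact h1 y hy

theorem embed_one (h : X ⊆ V) : embed h (1 : Obs n X) = 1 := by
  ext σ τ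
  rw [embed_apply, Matrix.one_apply, Matrix.one_apply]
  by_cases hστ : σ = τ
  · subst hστ; simp
  · rw [if_neg hστ]
    split_ifs with h1 h2
    · exact absurd (conf_eq_of_forall h h1 h2) hστ
    · rfl
    · rfl

theorem embed_mul (h : X ⊆ V) (A B : Obs n X) : embed h (A * B) = embed h A * embed h B := by
  ext σ τ
  rw [embed_apply, Matrix.mul_apply]
  -- In the matrix product only intermediate configurations that agree with σ off X contribute; `e`
  -- parametrises them by their restriction to X.
  set e : Conf n X → Conf n V := fun κ y =>
    if hy : (y : 𝒱) ∈ X then κ ⟨y, hy⟩ else σ y with he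
  have he1 : ∀ κ, (fun x : ↥X => e κ ⟨x, h x.2⟩) = κ := by
    intro κ; funext x; simp [he]
  have he2 : ∀ κ (y : ↥V), (y : 𝒱) ∉ X → e κ y = σ y := by
    intro κ y hy; simp [he, hy]
  have hinj : Function.Injective e := fun κ κ' hk => by rw [← he1 κ, ← he1 κ', hk]
  split_ifs with h1
  · rw [Matrix.mul_apply]
    refine Fintype.sum_of_injective e hinj _ _ (fun ρ hρ => ?_) (fun κ => ?_)
    · rw [embed_apply, if_neg, zero_mul]
      intro h2
      exact hρ ⟨fun x => ρ ⟨x, h x.2⟩, conf_eq_of_forall h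
        (fun y hy => (he2 (fun x => ρ ⟨x, h x.2⟩) y hy).trans (h2 y hy)) (he1 fun x => ρ ⟨x, h x.2⟩)⟩
    · rw [embed_apply, embed_apply, if_pos, if_pos, he1]
      · exact fun y hy => by rw [he2 _ y hy, h1 y hy]
      · exact fun y hy => (he2 _ y hy).symm
  · symm
    refine Finset.sum_eq_zero fun ρ _ => ?_
    change embed h A σ ρ * embed h B ρ τ = 0
    rw [embed_apply, embed_apply]
    split_ifs with h2 h3
    · exact absurd (fun y hy => (h2 y hy).trans (h3 y hy)) h1
    all_goals simp

theorem embed_star (h : X ⊆ V) (A : Obs n X) : embed h (star A) = star (embed h A) := by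
  ext σ τ
  rw [Matrix.star_apply, embed_apply, embed_apply]
  have : (∀ y : ↥V, (y : 𝒱) ∉ X → τ y = σ y) ↔ ∀ y : ↥V, (y : 𝒱) ∉ X → σ y = τ y :=
    forall₂_congr fun _ _ => eq_comm
  simp only [this]
  split_ifs <;> simp [Matrix.star_apply]

/-- The embedding `A ↦ A ⊗ 𝟙` as a `*`-homomorphism. -/
noncomputable def embedHom (n : 𝒱 → ℕ) (h : X ⊆ V) : Obs n X →⋆ₐ[ℂ] Obs n V where
  toFun := embed h
  map_one' := embed_one h
  map_mul' := embed_mul h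
  map_zero' := by ext σ τ; simp [embed_apply]
  map_add' A B := by
    ext σ τ
    simp only [embed_apply, Matrix.add_apply]
    split_ifs <;> simp
  commutes' c := by
    ext σ τ
    rw [Algebra.algebraMap_eq_smul_one, Algebra.algebraMap_eq_smul_one, ← embed_one (n := n) h]
    simp only [embed_apply, Matrix.smul_apply]
    split_ifs <;> simp
  map_star' := embed_star h

theorem embed_embed (h : X ⊆ Y) (h' : Y ⊆ V) (A : Obs n X) :
    embed h' (embed h A) = embed (h.trans h') A := by
  ext σ τ
  simp only [embed_apply]
  by_cases h1 : ∀ y : ↥V, (y : 𝒱) ∉ X → σ y = τ y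
  · rw [if_pos h1, if_pos fun y hy => h1 y fun hX => hy (h hX)]
    exact if_pos fun (y : ↥Y) hy => h1 ⟨y, h' y.2⟩ hy
  · rw [if_neg h1]
    split_ifs with h2 h3
    · refine absurd (fun y hy => ?_) h1
      by_cases hyY : (y : 𝒱) ∈ Y
      · exact h3 ⟨y, hyY⟩ hy
      · exact h2 y hyY
    · rfl
    · rfl

theorem embed_mul_embed_apply (hX : X ⊆ V) (hY : Y ⊆ V) (hd : Disjoint X Y) (A : Obs n X)
    (B : Obs n Y) (σ τ : Conf n V) :
    (embed hX A * embed hY B) σ τ =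
      if ∀ y : ↥V, (y : 𝒱) ∉ X → (y : 𝒱) ∉ Y → σ y = τ y then
        A (fun x => σ ⟨x, hX x.2⟩) (fun x => τ ⟨x, hX x.2⟩) *
          B (fun x => σ ⟨x, hY x.2⟩) (fun x => τ ⟨x, hY x.2⟩) else 0 := by
  rw [Matrix.mul_apply]
  -- The first factor forces agreement with σ off X, the second agreement with τ off Y, hence on X.
  -- So only this intermediate configuration survives.
  set ρ₀ : Conf n V := fun y => if (y : 𝒱) ∈ X then τ y else σ y with hρ
  have hXY : ∀ y, y ∈ Y → y ∉ X := fun y hy hx => Finset.disjoint_left.1 hd hx hy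
  have e1 : (fun x : ↥X => ρ₀ ⟨x, hX x.2⟩) = fun x : ↥X => τ ⟨x, hX x.2⟩ := by
    funext x; simp [hρ]
  have e2 : (fun x : ↥Y => ρ₀ ⟨x, hY x.2⟩) = fun x : ↥Y => σ ⟨x, hY x.2⟩ := by
    funext x; simp [hρ, hXY x x.2]
  rw [Finset.sum_eq_single ρ₀]
  · rw [embed_apply, embed_apply, e1, e2, if_pos (fun y hy => by simp [hρ, hy])]
    by_cases h1 : ∀ y : ↥V, (y : 𝒱) ∉ X → (y : 𝒱) ∉ Y → σ y = τ y
    · rw [if_pos h1, if_pos]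
      intro y hy
      by_cases hx : (y : 𝒱) ∈ X
      · simp [hρ, hx]
      · simp [hρ, hx, h1 y hx hy]
    · rw [if_neg h1, if_neg, mul_zero]
      intro h2
      refine h1 fun y hx hy => ?_
      have := h2 y hy
      simpa [hρ, hx] using this
  · intro ρ _ hne
    rw [embed_apply, embed_apply]
    split_ifs with h1 h2
    · refine absurd (funext fun y => ?_) hne
      by_cases hx : (y : 𝒱) ∈ X
      · simp only [hρ, hx, if_true]; exact h2 y fun hy => hXY y hy hx
      · simp only [hρ, hx, if_false]; exact (h1 y hx).symm
    all_goals simp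
  · simp

theorem commute_embed (hX : X ⊆ V) (hY : Y ⊆ V) (hd : Disjoint X Y) (A : Obs n X)
    (B : Obs n Y) : Commute (embed hX A) (embed hY B) := by
  ext σ τ
  rw [embed_mul_embed_apply hX hY hd, embed_mul_embed_apply hY hX hd.symm]
  have : (∀ y : ↥V, (y : 𝒱) ∉ X → (y : 𝒱) ∉ Y → σ y = τ y) ↔
    ∀ y : ↥V, (y : 𝒱) ∉ Y → (y : 𝒱) ∉ X → σ y = τ y := forall_congr' fun y => forall_comm
  simp only [this, mul_comm]

theorem embed_injective (hn : ∀ x, 0 < n x) (h : X ⊆ V) :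
    Function.Injective (embed h : Obs n X → Obs n V) := by
  intro A B hAB
  ext κ κ'
  set e : Conf n X → Conf n V := fun κ y =>
    if hy : (y : 𝒱) ∈ X then κ ⟨y, hy⟩ else ⟨0, hn y⟩ with he
  have he1 : ∀ κ, (fun x : ↥X => e κ ⟨x, h x.2⟩) = κ := by
    intro κ; funext x; simp [he]
  have he2 : ∀ y : ↥V, (y : 𝒱) ∉ X → e κ y = e κ' y := by
    intro y hy; simp [he, hy]
  have := congrFun (congrFun hAB (e κ)) (e κ')
  rwa [embed_apply, embed_apply, if_pos he2, if_pos he2, he1, he1] at this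

/-- An injective *-homomorphism of C*-algebras is isometric. Injectivity requires the sites outside
X to have nonempty bases. -/
theorem norm_embed (hn : ∀ x, 0 < n x) (h : X ⊆ V) (A : Obs n X) : ‖embed h A‖ = ‖A‖ :=
  NonUnitalStarAlgHom.norm_map (embedHom n h) (embed_injective hn h) A

theorem norm_embed_le (h : X ⊆ V) (A : Obs n X) : ‖embed h A‖ ≤ ‖A‖ :=
  NonUnitalStarAlgHom.norm_apply_le (embedHom n h) A

/-- The observables on `V` of the form `A ⊗ 𝟙` with `A ∈ 𝒜_X`. -/
noncomputable def localAlgebra (n : 𝒱 → ℕ) (h : X ⊆ V) : StarSubalgebra ℂ (Obs n V) :=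
  (embedHom n h).range

theorem mem_localAlgebra {h : X ⊆ V} {A : Obs n V} :
    A ∈ localAlgebra n h ↔ ∃ B : Obs n X, embed h B = A := Iff.rfl

theorem embed_mem_localAlgebra (h : X ⊆ V) (A : Obs n X) : embed h A ∈ localAlgebra n h := ⟨A, rfl⟩

theorem localAlgebra_mono (h : X ⊆ Y) (hX : X ⊆ V) (hY : Y ⊆ V) {A : Obs n V}
    (hA : A ∈ localAlgebra n hX) : A ∈ localAlgebra n hY := by
  obtain ⟨B, rfl⟩ := hA
  exact ⟨embed h B, embed_embed h hY B⟩

theorem mem_localAlgebra_self (A : Obs n V) : A ∈ localAlgebra n (Finset.Subset.refl V) := by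
  refine ⟨A, ?_⟩
  change embed (Finset.Subset.refl V) A = A
  ext σ τ
  rw [embed_apply, if_pos (fun y hy => absurd y.2 hy)]

theorem commute_of_mem_localAlgebra {hX : X ⊆ V} {hY : Y ⊆ V} (hd : Disjoint X Y) {A B : Obs n V}
    (hA : A ∈ localAlgebra n hX) (hB : B ∈ localAlgebra n hY) : Commute A B := by
  obtain ⟨A, rfl⟩ := hA
  obtain ⟨B, rfl⟩ := hB
  exact commute_embed hX hY hd A B

/-- Closedness keeps time averages of local observables inside the local algebra. -/
theorem isClosed_localAlgebra (h : X ⊆ V) : IsClosed (localAlgebra n h : Set (Obs n V)) :=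
  Submodule.closed_of_finiteDimensional (Subalgebra.toSubmodule (localAlgebra n h).toSubalgebra)

theorem propagator_embed (h : X ⊆ V) (K : Obs n X) (t : ℝ) :
    propagator (embed h K) t = embed h (propagator K t) := by
  let := NormedAlgebra.restrictScalars ℚ ℂ (Obs n X)
  have hc : Continuous (embedHom n h) :=
    (LipschitzWith.of_dist_le_mul (K := 1) fun A B => by
      rw [dist_eq_norm, dist_eq_norm, ← map_sub, NNReal.coe_one, one_mul]
      exact norm_embed_le h _).continuous
  have := NormedSpace.map_exp (embedHom n h) hc ((Complex.I * (t : ℂ)) • K)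
  rw [map_smul] at this
  exact this.symm

theorem propagator_mem {h : X ⊆ V} {K : Obs n V} (hK : K ∈ localAlgebra n h) (t : ℝ) :
    propagator K t ∈ localAlgebra n h := by
  obtain ⟨K, rfl⟩ := hK
  exact ⟨_, (propagator_embed h K t).symm⟩

theorem heisenberg_mem {h : X ⊆ V} {K A : Obs n V} (hK : K ∈ localAlgebra n h)
    (hA : A ∈ localAlgebra n h) (t : ℝ) : heisenberg K t A ∈ localAlgebra n h :=
  mul_mem (mul_mem (propagator_mem hK t) hA) (propagator_mem hK (-t))

open MeasureTheory ProbabilityTheory in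
theorem integral_mem_localAlgebra {h : X ⊆ V} {f : ℝ → Obs n V} {v : NNReal}
    (hf : Integrable f (gaussianReal 0 v)) (hmem : ∀ t, f t ∈ localAlgebra n h) :
    ∫ t, f t ∂(gaussianReal 0 v) ∈ localAlgebra n h := by
  refine Convex.integral_mem (s := (localAlgebra n h : Set (Obs n V))) ?_
    (isClosed_localAlgebra h) (Filter.Eventually.of_forall hmem) hf
  intro A hA B hB a b _ _ _
  refine add_mem ?_ ?_
  · rw [← Complex.coe_smul]; exact (localAlgebra n h).smul_mem hA (a : ℂ)
  · rw [← Complex.coe_smul]; exact (localAlgebra n h).smul_mem hB (b : ℂ)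

theorem smear_mem {h : X ⊆ V} {K A : Obs n V} (hKs : IsSelfAdjoint K) (hK : K ∈ localAlgebra n h)
    (hA : A ∈ localAlgebra n h) (v : NNReal) : smear v K A ∈ localAlgebra n h :=
  integral_mem_localAlgebra (integrable_heisenberg hKs v A) (heisenberg_mem hK hA)

theorem evolve_eq_heisenberg (Φ : Interaction n) (V : Finset 𝒱) (t : ℝ) (A : Obs n V) :
    evolve Φ V t A = heisenberg (hamiltonian Φ V) t A := by
  simp [evolve, heisenberg, propagator]

/-- The interaction term `Φ(X)` as an observable on `V` (zero unless `X ⊆ V`). -/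
noncomputable def Interaction.on (Φ : Interaction n) (V X : Finset 𝒱) : Obs n V :=
  if h : X ⊆ V then embed h (Φ.term X) else 0

theorem Interaction.on_mem (Φ : Interaction n) (hX : X ⊆ Y) (hY : Y ⊆ V) :
    Φ.on V X ∈ localAlgebra n hY := by
  rw [Interaction.on, dif_pos (hX.trans hY)]
  exact localAlgebra_mono hX (hX.trans hY) hY (embed_mem_localAlgebra _ _)

theorem Interaction.isSelfAdjoint_on (Φ : Interaction n) (V X : Finset 𝒱) :
    IsSelfAdjoint (Φ.on V X) := by
  rw [Interaction.on]
  split_ifs with h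
  · have : star (Φ.term X) = Φ.term X := Φ.isHermitian X
    rw [IsSelfAdjoint, ← embed_star, this]
  · exact IsSelfAdjoint.zero _

theorem Interaction.norm_on_le (Φ : Interaction n) {J : ℝ} (hJ : 0 ≤ J) (h : Φ.BoundedBy J)
    (V X : Finset 𝒱) : ‖Φ.on V X‖ ≤ J := by
  rw [Interaction.on]
  split_ifs with hX
  · exact (norm_embed_le hX _).trans (h X)
  · simpa using hJ

theorem Interaction.on_eq_zero (Φ : Interaction n) (V : Finset 𝒱) (h : Φ.term X = 0) :
    Φ.on V X = 0 := by
  rw [Interaction.on]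
  split_ifs with hX
  · rw [h]; exact map_zero (embedHom n hX)
  · rfl

theorem hamiltonian_eq_sum (Φ : Interaction n) (V : Finset 𝒱) :
    hamiltonian Φ V = ∑ X ∈ V.powerset, Φ.on V X := by
  rw [hamiltonian, ← Finset.sum_attach V.powerset]
  exact Finset.sum_congr rfl fun X _ => by
    rw [Interaction.on, dif_pos (Finset.mem_powerset.1 X.2)]

theorem isSelfAdjoint_sum_on (Φ : Interaction n) (V : Finset 𝒱) (s : Finset (Finset 𝒱)) :
    IsSelfAdjoint (∑ X ∈ s, Φ.on V X) :=
  sum_mem (S := selfAdjoint (Obs n V)) fun X _ => Φ.isSelfAdjoint_on V X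

theorem isSelfAdjoint_hamiltonian (Φ : Interaction n) (V : Finset 𝒱) :
    IsSelfAdjoint (hamiltonian Φ V) := by
  rw [hamiltonian_eq_sum]; exact isSelfAdjoint_sum_on Φ V _

theorem sum_on_mem (Φ : Interaction n) (hY : Y ⊆ V) {s : Finset (Finset 𝒱)}
    (hs : ∀ X ∈ s, X ⊆ Y) : ∑ X ∈ s, Φ.on V X ∈ localAlgebra n hY :=
  sum_mem fun X hX => Φ.on_mem (hs X hX) hY

end Local

end SpinSystem

namespace SpinSystem

/-! ### Counting interaction terms with N_Φ and C_Φ. -/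

section Counting

variable {𝒱 : Type*} {n : 𝒱 → ℕ}

theorem Interaction.sum_card_le (Φ : Interaction n) (hN : Φ.bigN < ⊤) (x : 𝒱)
    (s : Finset (Finset 𝒱)) (hs : ∀ X ∈ s, x ∈ X ∧ Φ.term X ≠ 0) :
    ∑ X ∈ s, (X.card : ℝ) ≤ Φ.bigN.toReal := by
  classical
  have h1 : ∑ X ∈ s, (X.card : ℝ≥0∞) ≤ Φ.bigN := by
    calc ∑ X ∈ s, (X.card : ℝ≥0∞)
        = ∑ X ∈ s.subtype (fun X => x ∈ X), ((X : Finset 𝒱).card : ℝ≥0∞) * Φ.chi X := by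
          rw [← Finset.sum_subtype_of_mem (fun X : Finset 𝒱 => (X.card : ℝ≥0∞))
            (fun X hX => (hs X hX).1)]
          refine Finset.sum_congr rfl fun X hX => ?_
          rw [Finset.mem_subtype] at hX
          simp [Interaction.chi, (hs _ hX).2]
      _ ≤ ∑' X : {X : Finset 𝒱 // x ∈ X}, ((X : Finset 𝒱).card : ℝ≥0∞) * Φ.chi X :=
          ENNReal.sum_le_tsum _
      _ ≤ Φ.bigN := le_iSup (fun x : 𝒱 => ∑' X : {X : Finset 𝒱 // x ∈ X},
          ((X : Finset 𝒱).card : ℝ≥0∞) * Φ.chi X) x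
  have h2 := ENNReal.toReal_mono hN.ne h1
  rw [ENNReal.toReal_sum (by simp)] at h2
  simpa using h2

theorem Interaction.bigC_le_bigN (Φ : Interaction n) : Φ.bigC ≤ Φ.bigN := by
  refine iSup_mono fun x => ENNReal.tsum_le_tsum fun X => ?_
  have h : (1 : ℝ≥0∞) ≤ ((X : Finset 𝒱).card : ℝ≥0∞) := by
    exact_mod_cast Finset.card_pos.2 ⟨x, X.2⟩
  calc Φ.chi X = 1 * Φ.chi X := (one_mul _).symm
    _ ≤ _ := by gcongr

theorem Interaction.card_le (Φ : Interaction n) (hN : Φ.bigN < ⊤) (x : 𝒱)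
    (s : Finset (Finset 𝒱)) (hs : ∀ X ∈ s, x ∈ X ∧ Φ.term X ≠ 0) :
    (s.card : ℝ) ≤ Φ.bigC.toReal := by
  classical
  have h1 : ∑ X ∈ s, (1 : ℝ≥0∞) ≤ Φ.bigC := by
    calc ∑ X ∈ s, (1 : ℝ≥0∞)
        = ∑ X ∈ s.subtype (fun X => x ∈ X), Φ.chi X := by
          rw [← Finset.sum_subtype_of_mem (fun _ : Finset 𝒱 => (1 : ℝ≥0∞))
            (fun X hX => (hs X hX).1)]
          refine Finset.sum_congr rfl fun X hX => ?_
          rw [Finset.mem_subtype] at hX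
          simp [Interaction.chi, (hs _ hX).2]
      _ ≤ ∑' X : {X : Finset 𝒱 // x ∈ X}, Φ.chi X := ENNReal.sum_le_tsum _
      _ ≤ Φ.bigC := le_iSup (fun x : 𝒱 => ∑' X : {X : Finset 𝒱 // x ∈ X}, Φ.chi X) x
  have h2 := ENNReal.toReal_mono (Φ.bigC_le_bigN.trans_lt hN).ne h1
  simpa using h2

/-- Once some nonempty term is nonzero, the factors C_Φ and N_Φ in the final estimate can only
enlarge it. -/
theorem one_le_bigC (Φ : Interaction n) (hN : Φ.bigN < ⊤) {X : Finset 𝒱} (hX : X.Nonempty)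
    (h : Φ.term X ≠ 0) : 1 ≤ Φ.bigC.toReal := by
  obtain ⟨x, hx⟩ := hX
  simpa using Φ.card_le hN x {X} (by simpa using ⟨hx, h⟩)

theorem one_le_bigN (Φ : Interaction n) (hN : Φ.bigN < ⊤) {X : Finset 𝒱} (hX : X.Nonempty)
    (h : Φ.term X ≠ 0) : 1 ≤ Φ.bigN.toReal :=
  (one_le_bigC Φ hN hX h).trans (ENNReal.toReal_mono hN.ne Φ.bigC_le_bigN)

variable [DecidableEq 𝒱]

/-- A sum over sets that all meet `D` is at most the sum over the points of `D` of the sums over the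
sets containing the point. -/
theorem sum_le_sum_of_meets (D : Finset 𝒱) (s : Finset (Finset 𝒱))
    (hs : ∀ X ∈ s, ∃ x ∈ D, x ∈ X) (f : Finset 𝒱 → ℝ) (hf : ∀ X ∈ s, 0 ≤ f X) :
    ∑ X ∈ s, f X ≤ ∑ x ∈ D, ∑ X ∈ s with x ∈ X, f X := by
  calc ∑ X ∈ s, f X ≤ ∑ X ∈ s, ∑ x ∈ D with x ∈ X, f X := by
        refine Finset.sum_le_sum fun X hX => ?_
        obtain ⟨x, hxD, hxX⟩ := hs X hX
        exact Finset.single_le_sum (f := fun _ => f X) (fun _ _ => hf X hX)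
          (Finset.mem_filter.2 ⟨hxD, hxX⟩)
    _ = _ := by
        simp only [Finset.sum_filter]
        rw [Finset.sum_comm]

theorem sum_card_le_of_meets (Φ : Interaction n) (hN : Φ.bigN < ⊤) (D : Finset 𝒱)
    (s : Finset (Finset 𝒱)) (hs : ∀ X ∈ s, ∃ x ∈ D, x ∈ X) (hs' : ∀ X ∈ s, Φ.term X ≠ 0) :
    ∑ X ∈ s, (X.card : ℝ) ≤ D.card * Φ.bigN.toReal := by
  refine (sum_le_sum_of_meets D s hs (fun X => (X.card : ℝ)) (fun _ _ => by positivity)).trans ?_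
  rw [← nsmul_eq_mul]
  refine Finset.sum_le_card_nsmul _ _ _ fun x _ => Φ.sum_card_le hN x _ fun X hX => ?_
  rw [Finset.mem_filter] at hX
  exact ⟨hX.2, hs' X hX.1⟩

theorem card_le_of_meets (Φ : Interaction n) (hN : Φ.bigN < ⊤) (D : Finset 𝒱)
    (s : Finset (Finset 𝒱)) (hs : ∀ X ∈ s, ∃ x ∈ D, x ∈ X) (hs' : ∀ X ∈ s, Φ.term X ≠ 0) :
    (s.card : ℝ) ≤ D.card * Φ.bigC.toReal := by
  have h := sum_le_sum_of_meets D s hs (fun X => (1 : ℝ)) (fun _ _ => by positivity)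
  rw [Finset.sum_const, nsmul_eq_mul, mul_one] at h
  refine h.trans ?_
  rw [← nsmul_eq_mul]
  refine Finset.sum_le_card_nsmul _ _ _ fun x _ => ?_
  rw [Finset.sum_const, nsmul_eq_mul, mul_one]
  refine Φ.card_le hN x _ fun X hX => ?_
  rw [Finset.mem_filter] at hX
  exact ⟨hX.2, hs' X hX.1⟩

open Classical in
/-- The finite set of subsets of `V` on which the interaction does not vanish. -/
noncomputable def Interaction.support (Φ : Interaction n) (V : Finset 𝒱) : Finset (Finset 𝒱) :=
  V.powerset.filter fun X => Φ.term X ≠ 0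

theorem Interaction.mem_support {Φ : Interaction n} {V X : Finset 𝒱} :
    X ∈ Φ.support V ↔ X ⊆ V ∧ Φ.term X ≠ 0 := by
  simp [Interaction.support]

theorem hamiltonian_eq_sum_support (Φ : Interaction n) (V : Finset 𝒱) :
    hamiltonian Φ V = ∑ X ∈ Φ.support V, Φ.on V X := by
  rw [hamiltonian_eq_sum, Interaction.support, Finset.sum_filter_of_ne]
  intro X _ hne h0
  exact hne (Φ.on_eq_zero V h0)

theorem Interaction.commute_on (Φ : Interaction n) {V X Y : Finset 𝒱} (h : Disjoint X Y) :
    Commute (Φ.on V X) (Φ.on V Y) := by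
  by_cases hX : X ⊆ V
  · by_cases hY : Y ⊆ V
    · exact commute_of_mem_localAlgebra h (Φ.on_mem subset_rfl hX) (Φ.on_mem subset_rfl hY)
    · rw [Interaction.on, Interaction.on, dif_neg hY]; exact Commute.zero_right _
  · rw [Interaction.on, dif_neg hX]; exact Commute.zero_left _

/-- The commutator of two partial Hamiltonians, when the sets on the two sides that intersect
all meet `D`. -/
theorem norm_commutator_sum_on_le (Φ : Interaction n) (hN : Φ.bigN < ⊤) {J : ℝ} (hJ : 0 ≤ J)
    (hΦ : Φ.BoundedBy J) (V D : Finset 𝒱) (s u : Finset (Finset 𝒱))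
    (hs : ∀ X ∈ s, Φ.term X ≠ 0) (hu : ∀ X ∈ u, Φ.term X ≠ 0)
    (hD : ∀ Y ∈ s, ∀ Z ∈ u, ¬ Disjoint Y Z → ∃ x ∈ D, x ∈ Y) :
    ‖(∑ Z ∈ u, Φ.on V Z) * (∑ Y ∈ s, Φ.on V Y) - (∑ Y ∈ s, Φ.on V Y) * (∑ Z ∈ u, Φ.on V Z)‖ ≤
      2 * J ^ 2 * Φ.bigC.toReal * Φ.bigN.toReal * D.card := by
  classical
  have e : (∑ Z ∈ u, Φ.on V Z) * (∑ Y ∈ s, Φ.on V Y) - (∑ Y ∈ s, Φ.on V Y) * (∑ Z ∈ u, Φ.on V Z)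
      = ∑ Y ∈ s, ∑ Z ∈ u, (Φ.on V Z * Φ.on V Y - Φ.on V Y * Φ.on V Z) := by
    rw [Finset.sum_mul_sum, Finset.sum_mul_sum, Finset.sum_comm, ← Finset.sum_sub_distrib]
    exact Finset.sum_congr rfl fun Y _ => by rw [← Finset.sum_sub_distrib]
  rw [e]
  have hC : 0 ≤ Φ.bigC.toReal := ENNReal.toReal_nonneg
  -- A fixed Y overlaps at most |Y| C_Φ of the sets Z. The remaining sum of |Y| over the Y that meet
  -- D is at most |D| N_Φ.
  have hinner : ∀ Y ∈ s, ‖∑ Z ∈ u, (Φ.on V Z * Φ.on V Y - Φ.on V Y * Φ.on V Z)‖ ≤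
      2 * J ^ 2 * Φ.bigC.toReal * (if ∃ x ∈ D, x ∈ Y then (Y.card : ℝ) else 0) := by
    intro Y hY
    have e1 : ∑ Z ∈ u, (Φ.on V Z * Φ.on V Y - Φ.on V Y * Φ.on V Z) =
        ∑ Z ∈ u with ¬ Disjoint Y Z, (Φ.on V Z * Φ.on V Y - Φ.on V Y * Φ.on V Z) := by
      rw [Finset.sum_filter_of_ne]
      intro Z _ hne hd
      exact hne (sub_eq_zero.2 (Φ.commute_on hd.symm).eq)
    rw [e1]
    by_cases hY' : ∃ x ∈ D, x ∈ Y
    · rw [if_pos hY']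
      have h1 : ∀ Z ∈ u.filter (fun Z => ¬ Disjoint Y Z),
          ‖Φ.on V Z * Φ.on V Y - Φ.on V Y * Φ.on V Z‖ ≤ 2 * J ^ 2 := by
        intro Z _
        have hZ := Φ.norm_on_le hJ hΦ V Z
        have hY := Φ.norm_on_le hJ hΦ V Y
        have h2 : ‖Φ.on V Z * Φ.on V Y‖ ≤ J * J := (norm_mul_le _ _).trans (by gcongr)
        have h3 : ‖Φ.on V Y * Φ.on V Z‖ ≤ J * J := (norm_mul_le _ _).trans (by gcongr)
        linarith [norm_sub_le (Φ.on V Z * Φ.on V Y) (Φ.on V Y * Φ.on V Z)]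
      have h4 := card_le_of_meets Φ hN Y (u.filter (fun Z => ¬ Disjoint Y Z))
        (fun Z hZ => by
          obtain ⟨x, h1, h2⟩ := Finset.not_disjoint_iff.1 (Finset.mem_filter.1 hZ).2
          exact ⟨x, h1, h2⟩)
        (fun Z hZ => hu Z (Finset.mem_filter.1 hZ).1)
      calc _ ≤ ((u.filter (fun Z => ¬ Disjoint Y Z)).card : ℝ) * (2 * J ^ 2) := by
            rw [← nsmul_eq_mul]
            exact (norm_sum_le _ _).trans (Finset.sum_le_card_nsmul _ _ _ h1)
        _ ≤ (Y.card * Φ.bigC.toReal) * (2 * J ^ 2) := by gcongr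
        _ = _ := by ring
    · rw [if_neg hY', mul_zero, Finset.filter_eq_empty_iff.2, Finset.sum_empty, norm_zero]
      intro Z hZ hd
      exact hY' (hD Y hY Z hZ hd)
  calc _ ≤ ∑ Y ∈ s, 2 * J ^ 2 * Φ.bigC.toReal * (if ∃ x ∈ D, x ∈ Y then (Y.card : ℝ) else 0) :=
        (norm_sum_le _ _).trans (Finset.sum_le_sum hinner)
    _ = 2 * J ^ 2 * Φ.bigC.toReal * ∑ Y ∈ s with ∃ x ∈ D, x ∈ Y, (Y.card : ℝ) := by
        rw [← Finset.mul_sum, Finset.sum_filter]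
    _ ≤ 2 * J ^ 2 * Φ.bigC.toReal * (D.card * Φ.bigN.toReal) := by
        gcongr
        exact sum_card_le_of_meets Φ hN D _ (fun X hX => (Finset.mem_filter.1 hX).2)
          (fun X hX => hs X (Finset.mem_filter.1 hX).1)
    _ = _ := by ring

end Counting

/-! ### Distances and the range of the interaction. -/

section Range

variable {𝒱 : Type*} [MetricSpace 𝒱] {n : 𝒱 → ℕ}

theorem Interaction.HasRange.dist_le {Φ : Interaction n} {R : ℝ} (h : Φ.HasRange R)
    {X : Finset 𝒱} (hX : Φ.term X ≠ 0) {x y : 𝒱} (hx : x ∈ X) (hy : y ∈ X) : dist x y ≤ R := by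
  by_contra! hlt
  refine hX (h X (hlt.trans_le ?_))
  exact Metric.dist_le_diam_of_mem X.finite_toSet.isBounded hx hy

theorem setDist_le {X Y : Finset 𝒱} {x y : 𝒱} (hx : x ∈ X) (hy : y ∈ Y) :
    setDist X Y ≤ dist x y :=
  csInf_le ⟨0, by rintro r ⟨a, _, b, _, rfl⟩; exact dist_nonneg⟩ ⟨x, hx, y, hy, rfl⟩

theorem le_setDist {X Y : Finset 𝒱} (hX : X.Nonempty) (hY : Y.Nonempty) {D : ℝ}
    (h : ∀ x ∈ X, ∀ y ∈ Y, D ≤ dist x y) : D ≤ setDist X Y := by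
  obtain ⟨x, hx⟩ := hX
  obtain ⟨y, hy⟩ := hY
  refine le_csInf ⟨_, x, hx, y, hy, rfl⟩ ?_
  rintro r ⟨a, ha, b, hb, rfl⟩
  exact h a ha b hb

theorem setDist_comm (X Y : Finset 𝒱) : setDist X Y = setDist Y X := by
  unfold setDist
  congr 1
  ext r
  constructor <;> rintro ⟨a, ha, b, hb, rfl⟩ <;> exact ⟨b, hb, a, ha, dist_comm _ _⟩

end Range

end SpinSystem

/-! ### Existence of Lieb–Robinson constants. -/

namespace SpinSystem

theorem phiBoundary_subset {𝒱 : Type*} {n : 𝒱 → ℕ} (Φ : Interaction n) (X : Finset 𝒱) : phiBoundary Φ X ⊆ X :=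
  fun _ hx => by classical exact (Finset.mem_filter.1 hx).1

theorem mem_phiBoundary {𝒱 : Type*} {n : 𝒱 → ℕ} {Φ : Interaction n} {X : Finset 𝒱} {x : 𝒱} :
    x ∈ phiBoundary Φ X ↔ x ∈ X ∧ ∃ Y : Finset 𝒱, x ∈ Y ∧ (∃ y ∈ Y, y ∉ X) ∧ Φ.term Y ≠ 0 := by
  simp [phiBoundary]

section LiebRobinson

variable {𝒱 : Type*} [DecidableEq 𝒱] {n : 𝒱 → ℕ}

/-- The Hamiltonian of the sets that do not cross the boundary of `X` generates a dynamics that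
leaves the local algebra of `X` invariant. -/
theorem heisenberg_decoupled_mem (Φ : Interaction n) {V X : Finset 𝒱} (hX : X ⊆ V)
    {s : Finset (Finset 𝒱)} (hs : ∀ Z ∈ s, Z ⊆ X ∨ (Z ⊆ V ∧ Disjoint Z X)) {A : Obs n V}
    (hA : A ∈ localAlgebra n hX) (t : ℝ) :
    heisenberg (∑ Z ∈ s, Φ.on V Z) t A = heisenberg (∑ Z ∈ s with Z ⊆ X, Φ.on V Z) t A := by
  rw [← Finset.sum_filter_add_sum_filter_not s (fun Z => Z ⊆ X)]
  have h1 : ∑ Z ∈ s with Z ⊆ X, Φ.on V Z ∈ localAlgebra n hX :=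
    sum_on_mem Φ hX fun Z hZ => (Finset.mem_filter.1 hZ).2
  have h2 : ∑ Z ∈ s with ¬ Z ⊆ X, Φ.on V Z ∈
      localAlgebra n (Finset.sdiff_subset : V \ X ⊆ V) := by
    refine sum_on_mem Φ _ fun Z hZ => ?_
    obtain ⟨h3, h4⟩ := Finset.mem_filter.1 hZ
    obtain ⟨h5, h6⟩ := (hs Z h3).resolve_left h4
    exact Finset.subset_sdiff.2 ⟨h5, h6⟩
  exact heisenberg_add_of_commute (commute_of_mem_localAlgebra Finset.disjoint_sdiff h1 h2)
    (commute_of_mem_localAlgebra Finset.sdiff_disjoint h2 hA) t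

open Classical in
-- Removing the terms that cross the boundary of X leaves a dynamics preserving the algebra of X.
-- The correction is a time integral of commutators of single crossing terms with B, to which the
-- assumed bound `H` applies. Every crossing term meets the Φ-boundary of X, so the weights resum
-- there, and the time integral turns q into q/2.
theorem lieb_robinson_step (Φ : Interaction n) (hN : Φ.bigN < ⊤) {J : ℝ} (hJ : 0 ≤ J)
    (hΦ : Φ.BoundedBy J) {V Y : Finset 𝒱} (hY : Y ⊆ V) {B : Obs n V}
    (hB : B ∈ localAlgebra n hY) {w : 𝒱 → ℝ} (hw : ∀ x, 0 < w x) {g q : ℝ} (hg : 0 ≤ g) (hq : 0 ≤ q)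
    (hwg : ∀ Z, Φ.term Z ≠ 0 → ∀ x ∈ Z, ∀ y ∈ Z, w y ≤ g * w x) {L : ℝ}
    (hL : L = 2 * J * Φ.bigN.toReal * g)
    (H : ∀ (X : Finset 𝒱) (hX : X ⊆ V), ∀ A ∈ localAlgebra n hX, ∀ t : ℝ,
      ‖heisenberg (hamiltonian Φ V) t A * B - B * heisenberg (hamiltonian Φ V) t A‖ ≤
        2 * ‖A‖ * ‖B‖ * ((∑ x ∈ X, w x) * (q * Real.exp (2 * L * |t|))))
    (X : Finset 𝒱) (hX : X ⊆ V) (A : Obs n V) (hA : A ∈ localAlgebra n hX) (t : ℝ) :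
    ‖heisenberg (hamiltonian Φ V) t A * B - B * heisenberg (hamiltonian Φ V) t A‖ ≤
      2 * ‖A‖ * ‖B‖ * ((if Disjoint X Y then 0 else 1) +
        (∑ x ∈ phiBoundary Φ X, w x) * (q / 2 * Real.exp (2 * L * |t|))) := by
  have hL0 : 0 ≤ L := by rw [hL]; have : 0 ≤ Φ.bigN.toReal := ENNReal.toReal_nonneg; positivity
  set K := hamiltonian Φ V with hKdef
  have hKs : IsSelfAdjoint K := isSelfAdjoint_hamiltonian Φ V
  set c := (Φ.support V).filter fun Z => ¬ (Z ⊆ X ∨ (Z ⊆ V ∧ Disjoint Z X)) with hc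
  set d := (Φ.support V).filter fun Z => Z ⊆ X ∨ (Z ⊆ V ∧ Disjoint Z X) with hd
  set W := ∑ Z ∈ c, Φ.on V Z with hW
  have hWs : IsSelfAdjoint W := isSelfAdjoint_sum_on Φ V c
  have hKW : K - W = ∑ Z ∈ d, Φ.on V Z := by
    rw [hKdef, hamiltonian_eq_sum_support, ← Finset.sum_filter_add_sum_filter_not (Φ.support V)
      (fun Z => Z ⊆ X ∨ (Z ⊆ V ∧ Disjoint Z X)), hW, add_sub_cancel_right]
  set P := ∑ x ∈ phiBoundary Φ X, w x with hP
  have hP0 : 0 ≤ P := Finset.sum_nonneg fun x _ => (hw x).le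
  have hcross : ∀ Z ∈ c, Z ⊆ V ∧ Φ.term Z ≠ 0 ∧ ∃ x ∈ phiBoundary Φ X, x ∈ Z := by
    intro Z hZ
    obtain ⟨h1, h2⟩ := Finset.mem_filter.1 hZ
    obtain ⟨h3, h4⟩ := Interaction.mem_support.1 h1
    push Not at h2
    obtain ⟨x, hxZ, hxX⟩ := Finset.not_disjoint_iff.1 (h2.2 h3)
    refine ⟨h3, h4, x, mem_phiBoundary.2 ⟨hxX, Z, hxZ, ?_, h4⟩, hxZ⟩
    exact Finset.not_subset.1 h2.1
  have hweight : ∑ Z ∈ c, ∑ y ∈ Z, w y ≤ Φ.bigN.toReal * g * P := by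
    refine (sum_le_sum_of_meets (phiBoundary Φ X) c (fun Z hZ => (hcross Z hZ).2.2)
      (fun Z => ∑ y ∈ Z, w y) (fun Z _ => Finset.sum_nonneg fun x _ => (hw x).le)).trans ?_
    rw [hP, Finset.mul_sum]
    refine Finset.sum_le_sum fun x _ => ?_
    calc ∑ Z ∈ c with x ∈ Z, ∑ y ∈ Z, w y ≤ ∑ Z ∈ c with x ∈ Z, (Z.card : ℝ) * (g * w x) := by
          refine Finset.sum_le_sum fun Z hZ => ?_
          obtain ⟨hZ1, hZ2⟩ := Finset.mem_filter.1 hZ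
          rw [← nsmul_eq_mul]
          exact Finset.sum_le_card_nsmul _ _ _ fun y hy => hwg Z (hcross Z hZ1).2.1 x hZ2 y hy
      _ = (∑ Z ∈ c with x ∈ Z, (Z.card : ℝ)) * (g * w x) := by rw [Finset.sum_mul]
      _ ≤ Φ.bigN.toReal * (g * w x) := by
          have := hw x
          gcongr
          exact Φ.sum_card_le hN x _ fun Z hZ =>
            ⟨(Finset.mem_filter.1 hZ).2, (hcross Z (Finset.mem_filter.1 hZ).1).2.1⟩
      _ = _ := by ring
  clear_value P
  -- θ is the sign of time, so that the comparison always runs forward over [0, |t|].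
  obtain ⟨θ, hθ, hθt⟩ : ∃ θ : ℝ, |θ| = 1 ∧ θ * |t| = t := by
    rcases le_total 0 t with h | h
    · exact ⟨1, by simp, by rw [abs_of_nonneg h, one_mul]⟩
    · exact ⟨-1, by simp, by rw [abs_of_nonpos h]; ring⟩
  -- The decoupled evolution keeps A in the algebra of X with the same norm; what then separates A₀
  -- from the full evolution is conjugation by the interaction-picture propagator.
  set A₀ := heisenberg (K - W) t A with hA₀
  have hA₀mem : A₀ ∈ localAlgebra n hX := by
    rw [hA₀, hKW, heisenberg_decoupled_mem Φ hX (fun Z hZ => (Finset.mem_filter.1 hZ).2) hA]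
    exact heisenberg_mem (sum_on_mem Φ hX fun Z hZ => (Finset.mem_filter.1 hZ).2) hA t
  have hnorm : ‖A₀‖ = ‖A‖ := norm_heisenberg (hKs.sub hWs) t A
  -- The crossing terms give the rate q L e^{2Ls}. The exponent is 2L rather than L, so a primitive
  -- carries the factor q/2.
  have hder : ∀ s : ℝ, HasDerivAt (fun s => ‖B‖ * P * (q / 2) * Real.exp (2 * L * s))
      (‖B‖ * P * q * L * Real.exp (2 * L * s)) s := by
    intro s
    have h1 : HasDerivAt (fun s : ℝ => 2 * L * s) (2 * L) s := by
      simpa using (hasDerivAt_id s).const_mul (2 * L)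
    refine (h1.exp.const_mul (‖B‖ * P * (q / 2))).congr_deriv ?_
    ring
  have hM : ∀ s : ℝ, 0 ≤ s → s ≤ |t| →
      ‖heisenberg K (θ * s) W * B - B * heisenberg K (θ * s) W‖ ≤
        ‖B‖ * P * q * L * Real.exp (2 * L * s) := ?_
  · have hg0 : 0 ≤ ‖B‖ * P * (q / 2) * Real.exp (2 * L * 0) :=
      mul_nonneg (mul_nonneg (mul_nonneg (norm_nonneg B) hP0) (div_nonneg hq zero_le_two)) (Real.exp_pos _).le
    have key := norm_commutator_conj_le (𝓐 := Obs n V) (K := K) (W := W) (B := B) hKs hWs (θ := θ)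
      (g := fun s => ‖B‖ * P * (q / 2) * Real.exp (2 * L * s))
      (g' := fun s => ‖B‖ * P * q * L * Real.exp (2 * L * s)) hder hg0 (T := |t|) (abs_nonneg t)
      hθ hM A₀
    rw [hθt, hnorm, hA₀, ← heisenberg_add_time, neg_add_cancel, heisenberg_zero, ← hA₀] at key
    refine key.trans ?_
    have h0 : ‖A₀ * B - B * A₀‖ ≤ 2 * ‖A‖ * ‖B‖ * (if Disjoint X Y then 0 else 1) := by
      split_ifs with hXY
      · rw [(commute_of_mem_localAlgebra hXY hA₀mem hB).eq, sub_self, norm_zero, mul_zero]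
      · have h1 := norm_mul_le A₀ B
        have h2 := norm_mul_le B A₀
        rw [hnorm] at h1 h2
        linarith [norm_sub_le (A₀ * B) (B * A₀)]
    calc _ ≤ 2 * ‖A‖ * ‖B‖ * (if Disjoint X Y then 0 else 1) +
          2 * ‖A‖ * (‖B‖ * P * (q / 2) * Real.exp (2 * L * |t|)) := add_le_add h0 le_rfl
      _ = _ := by ring
  · intro s hs _
    have habs : |θ * s| = s := by rw [abs_mul, hθ, one_mul, abs_of_nonneg hs]
    rw [hW, heisenberg_sum, Finset.sum_mul, Finset.mul_sum, ← Finset.sum_sub_distrib]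
    refine (norm_sum_le _ _).trans ?_
    calc _ ≤ ∑ Z ∈ c, 2 * J * ‖B‖ * ((∑ y ∈ Z, w y) * (q * Real.exp (2 * L * s))) := by
          refine Finset.sum_le_sum fun Z hZ => ?_
          have hZV := (hcross Z hZ).1
          have h1 := H Z hZV (Φ.on V Z) (Φ.on_mem subset_rfl hZV) (θ * s)
          rw [habs] at h1
          refine h1.trans ?_
          have h2 : 0 ≤ ∑ y ∈ Z, w y := Finset.sum_nonneg fun x _ => (hw x).le
          have h3 := Φ.norm_on_le hJ hΦ V Z
          exact mul_le_mul_of_nonneg_right (mul_le_mul_of_nonneg_right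
            (mul_le_mul_of_nonneg_left h3 zero_le_two) (norm_nonneg B))
            (mul_nonneg h2 (mul_nonneg hq (Real.exp_pos _).le))
      _ = 2 * J * ‖B‖ * q * Real.exp (2 * L * s) * ∑ Z ∈ c, ∑ y ∈ Z, w y := by
          rw [Finset.mul_sum]
          exact Finset.sum_congr rfl fun _ _ => by ring
      _ ≤ 2 * J * ‖B‖ * q * Real.exp (2 * L * s) * (Φ.bigN.toReal * g * P) :=
          mul_le_mul_of_nonneg_left hweight (mul_nonneg (mul_nonneg (mul_nonneg
            (mul_nonneg zero_le_two hJ) (norm_nonneg B)) hq) (Real.exp_pos _).le)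
      _ = _ := by rw [hL]; ring

/-- Iterating `lieb_robinson_step` replaces q by 1 + q/2, whose fixed point is 2. In the limit a
last application, with X and Y disjoint, drops the constant term and gives q/2 = 1 with only
boundary weights. -/
theorem lieb_robinson_weighted (Φ : Interaction n) (hN : Φ.bigN < ⊤) {J : ℝ} (hJ : 0 ≤ J)
    (hΦ : Φ.BoundedBy J) {V Y : Finset 𝒱} (hY : Y ⊆ V) {B : Obs n V}
    (hB : B ∈ localAlgebra n hY) {w : 𝒱 → ℝ} (hw : ∀ x, 0 < w x) (hwY : ∀ x ∈ Y, 1 ≤ w x)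
    {g : ℝ} (hg : 0 ≤ g)
    (hwg : ∀ Z, Φ.term Z ≠ 0 → ∀ x ∈ Z, ∀ y ∈ Z, w y ≤ g * w x) {L : ℝ}
    (hL : L = 2 * J * Φ.bigN.toReal * g)
    {X : Finset 𝒱} (hX : X ⊆ V) {A : Obs n V} (hA : A ∈ localAlgebra n hX) (hXY : Disjoint X Y)
    (t : ℝ) :
    ‖heisenberg (hamiltonian Φ V) t A * B - B * heisenberg (hamiltonian Φ V) t A‖ ≤
      2 * ‖A‖ * ‖B‖ * ((∑ x ∈ phiBoundary Φ X, w x) * Real.exp (2 * L * |t|)) := by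
  have hL0 : 0 ≤ L := by rw [hL]; have : 0 ≤ Φ.bigN.toReal := ENNReal.toReal_nonneg; positivity
  have hKs := isSelfAdjoint_hamiltonian Φ V
  -- Q makes the trivial bound 2‖A‖‖B‖ fit the weighted form for nonempty X. It depends on V, but
  -- its contribution is halved at each iteration and disappears.
  set Q : ℝ := ∑ x ∈ V, (w x)⁻¹ with hQ
  have hQ0 : 0 ≤ Q := Finset.sum_nonneg fun x _ => (inv_pos.2 (hw x)).le
  have hsum : ∀ s : Finset 𝒱, 0 ≤ ∑ x ∈ s, w x := fun s => Finset.sum_nonneg fun x _ => (hw x).le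
  have hiter : ∀ k : ℕ, ∀ (X : Finset 𝒱) (hX : X ⊆ V), ∀ A ∈ localAlgebra n hX, ∀ t : ℝ,
      ‖heisenberg (hamiltonian Φ V) t A * B - B * heisenberg (hamiltonian Φ V) t A‖ ≤
        2 * ‖A‖ * ‖B‖ * ((∑ x ∈ X, w x) *
          ((2 + Q * (1 / 2) ^ k) * Real.exp (2 * L * |t|))) := by
    intro k
    induction k with
    | zero =>
      intro X hX A hA t
      rcases X.eq_empty_or_nonempty with rfl | ⟨x, hx⟩
      · have hA' : heisenberg (hamiltonian Φ V) t A ∈ localAlgebra n (Finset.Subset.refl V) :=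
          mem_localAlgebra_self _
        have h1 : Commute (hamiltonian Φ V) A :=
          (commute_of_mem_localAlgebra (Finset.disjoint_empty_left V) hA
            (mem_localAlgebra_self _)).symm
        rw [heisenberg_of_commute h1, (commute_of_mem_localAlgebra (Finset.disjoint_empty_left Y)
          hA hB).eq, sub_self, norm_zero]
        simp
      · have h1 := norm_mul_le (heisenberg (hamiltonian Φ V) t A) B
        have h2 := norm_mul_le B (heisenberg (hamiltonian Φ V) t A)
        rw [norm_heisenberg hKs] at h1 h2
        have h3 : 1 ≤ (∑ x ∈ X, w x) * Q := by
          calc (1 : ℝ) = w x * (w x)⁻¹ := (mul_inv_cancel₀ (hw x).ne').symm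
            _ ≤ (∑ x ∈ X, w x) * Q := by
              refine mul_le_mul (Finset.single_le_sum (fun y _ => (hw y).le) hx)
                (Finset.single_le_sum (f := fun y => (w y)⁻¹) (fun y _ => (inv_pos.2 (hw y)).le)
                  (hX hx)) (inv_pos.2 (hw x)).le (hsum X)
        have h4 : (1 : ℝ) ≤ Real.exp (2 * L * |t|) := Real.one_le_exp (by positivity)
        have h5 : 1 ≤ (∑ x ∈ X, w x) * ((2 + Q * (1 / 2) ^ 0) * Real.exp (2 * L * |t|)) := by
          have h6 : (1 : ℝ) ≤ (∑ x ∈ X, w x) * (2 + Q * (1 / 2) ^ 0) := by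
            simp only [pow_zero, mul_one, mul_add]; linarith [hsum X]
          calc (1 : ℝ) = 1 * 1 := (one_mul 1).symm
            _ ≤ ((∑ x ∈ X, w x) * (2 + Q * (1 / 2) ^ 0)) * Real.exp (2 * L * |t|) := by gcongr
            _ = _ := by ring
        calc _ ≤ 2 * ‖A‖ * ‖B‖ * 1 := by
              linarith [norm_sub_le (heisenberg (hamiltonian Φ V) t A * B)
                (B * heisenberg (hamiltonian Φ V) t A)]
          _ ≤ _ := by gcongr
    | succ k ih =>
      intro X hX A hA t
      refine (lieb_robinson_step Φ hN hJ hΦ hY hB hw hg (q := 2 + Q * (1 / 2) ^ k) (by positivity)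
        hwg hL ih X hX A hA t).trans ?_
      have h1 : (∑ x ∈ phiBoundary Φ X, w x) ≤ ∑ x ∈ X, w x :=
        Finset.sum_le_sum_of_subset_of_nonneg (phiBoundary_subset Φ X) fun x _ _ => (hw x).le
      -- An X that meets Y has weight at least 1, since w ≥ 1 on Y.
      have h2 : (if Disjoint X Y then (0 : ℝ) else 1) ≤ (∑ x ∈ X, w x) * Real.exp (2 * L * |t|) := by
        split_ifs with hd
        · have := hsum X; positivity
        · obtain ⟨x, hx, hy⟩ := Finset.not_disjoint_iff.1 hd
          have h4 : (1 : ℝ) ≤ Real.exp (2 * L * |t|) := Real.one_le_exp (by positivity)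
          have h5 : 1 ≤ ∑ x ∈ X, w x :=
            (hwY x hy).trans (Finset.single_le_sum (fun y _ => (hw y).le) hx)
          calc (1 : ℝ) = 1 * 1 := (one_mul 1).symm
            _ ≤ _ := by gcongr
      have h3 : (∑ x ∈ phiBoundary Φ X, w x) *
          ((2 + Q * (1 / 2) ^ k) / 2 * Real.exp (2 * L * |t|)) ≤
          (∑ x ∈ X, w x) * ((2 + Q * (1 / 2) ^ k) / 2 * Real.exp (2 * L * |t|)) := by
        gcongr
      have h6 : (if Disjoint X Y then (0 : ℝ) else 1) + (∑ x ∈ phiBoundary Φ X, w x) *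
          ((2 + Q * (1 / 2) ^ k) / 2 * Real.exp (2 * L * |t|)) ≤
          (∑ x ∈ X, w x) * ((2 + Q * (1 / 2) ^ (k + 1)) * Real.exp (2 * L * |t|)) := by
        refine (add_le_add h2 h3).trans (le_of_eq ?_)
        rw [pow_succ]; ring
      gcongr
  have hstep : ∀ k : ℕ,
      ‖heisenberg (hamiltonian Φ V) t A * B - B * heisenberg (hamiltonian Φ V) t A‖ ≤
      2 * ‖A‖ * ‖B‖ * ((∑ x ∈ phiBoundary Φ X, w x) *
        ((2 + Q * (1 / 2) ^ k) / 2 * Real.exp (2 * L * |t|))) := by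
    intro k
    have h := lieb_robinson_step Φ hN hJ hΦ hY hB hw hg (q := 2 + Q * (1 / 2) ^ k) (by positivity)
      hwg hL (hiter k) X hX A hA t
    rwa [if_pos hXY, zero_add] at h
  have hlim : Filter.Tendsto (fun k : ℕ => 2 * ‖A‖ * ‖B‖ * ((∑ x ∈ phiBoundary Φ X, w x) *
        ((2 + Q * (1 / 2) ^ k) / 2 * Real.exp (2 * L * |t|)))) Filter.atTop
      (nhds (2 * ‖A‖ * ‖B‖ * ((∑ x ∈ phiBoundary Φ X, w x) *
        ((2 + Q * 0) / 2 * Real.exp (2 * L * |t|))))) := by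
    have h0 : Filter.Tendsto (fun k : ℕ => (1 / 2 : ℝ) ^ k) Filter.atTop (nhds 0) :=
      tendsto_pow_atTop_nhds_zero_of_lt_one (by norm_num) (by norm_num)
    exact ((((h0.const_mul Q).const_add 2).div_const 2).mul_const _).const_mul _ |>.const_mul _
  have := ge_of_tendsto' hlim hstep
  simpa using this

theorem norm_commutator_heisenberg_swap {K A B : Obs n V} (hK : IsSelfAdjoint K) (t : ℝ) :
    ‖heisenberg K t A * B - B * heisenberg K t A‖ =
      ‖heisenberg K (-t) B * A - A * heisenberg K (-t) B‖ := by
  rw [← norm_heisenberg hK (-t), heisenberg_sub, heisenberg_mul, heisenberg_mul,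
    ← heisenberg_add_time, neg_add_cancel, heisenberg_zero, norm_sub_rev]

end LiebRobinson

/-- The weight is w(x) = e^{-μ d(x,Y)}. Within one term it varies by at most e^{μR}, because
distance to Y is 1-Lipschitz. -/
theorem exists_isLiebRobinson {𝒱 : Type*} [DecidableEq 𝒱] [MetricSpace 𝒱] {n : 𝒱 → ℕ}
    (Φ : Interaction n) {R J μ : ℝ} (hR : Φ.HasRange R) (hJ : 0 ≤ J) (hΦ : Φ.BoundedBy J)
    (hN : Φ.bigN < ⊤) (hμ : 0 < μ) : ∃ c v : ℝ, IsLiebRobinson Φ μ c v := by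
  set L := 2 * J * Φ.bigN.toReal * Real.exp (μ * R) with hL
  have hL0 : 0 ≤ L := by rw [hL]; have : 0 ≤ Φ.bigN.toReal := ENNReal.toReal_nonneg; positivity
  have hwR : ∀ (Y Z : Finset 𝒱), Φ.term Z ≠ 0 → ∀ x ∈ Z, ∀ y ∈ Z,
      Real.exp (-μ * Metric.infDist y (Y : Set 𝒱)) ≤
        Real.exp (μ * R) * Real.exp (-μ * Metric.infDist x (Y : Set 𝒱)) := by
    intro Y Z hZ x hx y hy
    rw [← Real.exp_add]
    refine Real.exp_le_exp.2 ?_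
    have h1 := hR.dist_le hZ hx hy
    have h2 := Metric.infDist_le_infDist_add_dist (s := (Y : Set 𝒱)) (x := x) (y := y)
    nlinarith
  have main : ∀ (V X Y : Finset 𝒱) (hX : X ⊆ V) (hY : Y ⊆ V), Disjoint X Y →
      ∀ (A B : Obs n V), A ∈ localAlgebra n hX → B ∈ localAlgebra n hY → ∀ t : ℝ,
      ‖heisenberg (hamiltonian Φ V) t A * B - B * heisenberg (hamiltonian Φ V) t A‖ ≤
        2 * ‖A‖ * ‖B‖ * ((phiBoundary Φ X).card *
          Real.exp (-μ * (setDist X Y - (2 * L / μ + 1) * |t|))) := by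
    intro V X Y hX hY hd A B hA hB t
    rcases Y.eq_empty_or_nonempty with rfl | hYne
    · rw [(commute_of_mem_localAlgebra (Finset.disjoint_empty_right V) (mem_localAlgebra_self _)
        hB).eq, sub_self, norm_zero]
      positivity
    · refine (lieb_robinson_weighted Φ hN hJ hΦ hY hB
        (w := fun x => Real.exp (-μ * Metric.infDist x (Y : Set 𝒱))) (fun x => Real.exp_pos _)
        (fun x hx => ?_) (Real.exp_pos (μ * R)).le (hwR Y) hL hX hA hd t).trans ?_
      · rw [Metric.infDist_zero_of_mem (by exact_mod_cast hx)]; simp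
      · have h1 : ∀ x ∈ phiBoundary Φ X, Real.exp (-μ * Metric.infDist x (Y : Set 𝒱)) ≤
            Real.exp (-μ * setDist X Y) := by
          intro x hx
          refine Real.exp_le_exp.2 ?_
          obtain ⟨y, hy, he⟩ := Y.finite_toSet.isCompact.exists_infDist_eq_dist
            (by exact_mod_cast hYne) x
          rw [he]
          have := setDist_le (phiBoundary_subset Φ X hx) (Finset.mem_coe.1 hy)
          nlinarith
        have h2 := Finset.sum_le_card_nsmul _ _ _ h1
        rw [nsmul_eq_mul] at h2
        have h3 : Real.exp (2 * L * |t|) ≤ Real.exp (μ * ((2 * L / μ + 1) * |t|)) := by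
          refine Real.exp_le_exp.2 ?_
          have : μ * ((2 * L / μ + 1) * |t|) = 2 * L * |t| + μ * |t| := by field_simp
          rw [this]; have := abs_nonneg t; nlinarith
        have h4 : Real.exp (-μ * (setDist X Y - (2 * L / μ + 1) * |t|)) =
            Real.exp (-μ * setDist X Y) * Real.exp (μ * ((2 * L / μ + 1) * |t|)) := by
          rw [← Real.exp_add]; congr 1; ring
        rw [h4, ← mul_assoc (((phiBoundary Φ X).card : ℕ) : ℝ)]
        gcongr
  -- The rate 2L asks for v = 2L/μ; the added 1 keeps v positive when L = 0.
  refine ⟨2, 2 * L / μ + 1, by norm_num, by positivity, ?_⟩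
  intro V X Y hX hY hd A B t
  rw [evolve_eq_heisenberg]
  have hA := norm_embed_le hX A
  have hB := norm_embed_le hY B
  have h1 := main V X Y hX hY hd _ _ (embed_mem_localAlgebra hX A) (embed_mem_localAlgebra hY B) t
  -- Exchanging the observables and reversing time gives the bound with the boundary of Y, hence the
  -- minimum of the two.
  have h2 := main V Y X hY hX hd.symm _ _ (embed_mem_localAlgebra hY B)
    (embed_mem_localAlgebra hX A) (-t)
  rw [← norm_commutator_heisenberg_swap (isSelfAdjoint_hamiltonian Φ V), setDist_comm, abs_neg]
    at h2
  rcases min_choice (phiBoundary Φ X).card (phiBoundary Φ Y).card with h | h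
  · rw [h]
    refine h1.trans ?_
    rw [mul_assoc (2 * ‖A‖ * ‖B‖)]
    gcongr
  · rw [h]
    refine h2.trans ?_
    rw [mul_assoc (2 * ‖A‖ * ‖B‖), mul_right_comm 2 ‖A‖ ‖B‖]
    gcongr

end SpinSystem

namespace SpinSystem

/-! ### Approximating the kernel projection by a factorised operator. -/

section Approximation

open MeasureTheory ProbabilityTheory
open scoped NNReal

variable {𝓐 : Type*} [CStarAlgebra 𝓐]

theorem propagator_mul_of_mul_eq_zero {k p : 𝓐} (hk : IsSelfAdjoint k) (h : k * p = 0) (t : ℝ) :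
    propagator k t * p = p := by
  have := norm_propagator_mul_sub_le hk p t
  rw [h, norm_zero, mul_zero] at this
  exact sub_eq_zero.1 (norm_le_zero_iff.1 this)

theorem integrable_propagator {k : 𝓐} (hk : IsSelfAdjoint k) (v : ℝ≥0) :
    Integrable (propagator k) (gaussianReal 0 v) :=
  integrable_of_continuous_of_norm_le (continuous_propagator k) (norm_propagator_le hk) v

theorem smear_mul_of_mul_eq_zero {k p : 𝓐} (hk : IsSelfAdjoint k) (h : k * p = 0) (v : ℝ≥0)
    (A : 𝓐) : smear v k A * p = (∫ t, propagator k t ∂(gaussianReal 0 v)) * (A * p) := by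
  rw [smear, integral_mul_right_gaussian (integrable_heisenberg hk v A),
    integral_mul_right_gaussian (integrable_propagator hk v)]
  refine integral_congr_ae (Filter.Eventually.of_forall fun t => ?_)
  simp only [heisenberg]
  rw [mul_assoc, propagator_mul_of_mul_eq_zero hk h, mul_assoc]

/-- On the kernel the right propagator acts trivially, so the average of A times p is (p + rk)Ap.
The part pAp cancels the scalar a, and rkAp = r[k,A]p because kp = 0. -/
theorem norm_smear_sub_mul_le {k p r A : 𝓐} (hk : IsSelfAdjoint k) (hkp : k * p = 0) {v : ℝ≥0}
    (hr : ∫ t, propagator k t ∂(gaussianReal 0 v) - p = r * k) {a : ℂ} (ha : p * A * p = a • p)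
    (hp : ‖p‖ ≤ 1) {e : ℝ} (he : ‖r‖ ≤ e) :
    ‖(smear v k A - a • 1) * p‖ ≤ e * ‖k * A - A * k‖ := by
  have h1 : (smear v k A - a • 1) * p = r * (k * A - A * k) * p := by
    have h2 : ∫ t, propagator k t ∂(gaussianReal 0 v) = p + r * k := by rw [← hr]; abel
    rw [sub_mul, smear_mul_of_mul_eq_zero hk hkp, h2, add_mul, ← mul_assoc p, ha, smul_one_mul,
      add_sub_cancel_left]
    have h3 : r * (k * A - A * k) * p = r * k * (A * p) - r * A * (k * p) := by noncomm_ring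
    rw [h3, hkp, mul_zero, sub_zero]
  rw [h1]
  have he0 : 0 ≤ e := (norm_nonneg _).trans he
  calc ‖r * (k * A - A * k) * p‖ ≤ ‖r‖ * ‖k * A - A * k‖ * ‖p‖ :=
        (norm_mul_le _ _).trans (by gcongr; exact norm_mul_le _ _)
    _ ≤ e * ‖k * A - A * k‖ * 1 := by gcongr
    _ = _ := mul_one _

theorem heisenberg_sub_smul_one (K A : 𝓐) (a : ℂ) (t : ℝ) :
    heisenberg (K - a • 1) t A = heisenberg K t A := by
  have h : ∀ B : 𝓐, Commute (-(a • (1 : 𝓐))) B := fun B =>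
    ((Commute.one_left B).smul_left a).neg_left
  rw [sub_eq_add_neg]
  exact heisenberg_add_of_commute (h K).symm (h A) t

theorem continuous_interaction_picture (K D : 𝓐) :
    Continuous fun t => propagator K t * propagator (K - D) (-t) :=
  (continuous_propagator K).mul ((continuous_propagator (K - D)).comp continuous_neg)

theorem norm_interaction_picture_le {K D : 𝓐} (hK : IsSelfAdjoint K) (hD : IsSelfAdjoint D)
    (t : ℝ) : ‖propagator K t * propagator (K - D) (-t)‖ ≤ 1 := by
  refine (norm_mul_le _ _).trans ?_
  calc _ ≤ (1 : ℝ) * 1 := by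
        gcongr
        · exact norm_propagator_le hK t
        · exact norm_propagator_le (hK.sub hD) (-t)
    _ = 1 := one_mul 1

/-- The averaged interaction-picture propagator. -/
noncomputable def averagedPropagator (v : ℝ≥0) (K D : 𝓐) : 𝓐 :=
  ∫ t, propagator K t * propagator (K - D) (-t) ∂(gaussianReal 0 v)

theorem integrable_interaction_picture {K D : 𝓐} (hK : IsSelfAdjoint K) (hD : IsSelfAdjoint D)
    (v : ℝ≥0) :
    Integrable (fun t => propagator K t * propagator (K - D) (-t)) (gaussianReal 0 v) :=
  integrable_of_continuous_of_norm_le (continuous_interaction_picture K D)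
    (norm_interaction_picture_le hK hD) v

theorem norm_averagedPropagator_le {K D : 𝓐} (hK : IsSelfAdjoint K) (hD : IsSelfAdjoint D)
    (v : ℝ≥0) : ‖averagedPropagator v K D‖ ≤ 1 := by
  have := norm_integral_le_of_norm_le_const (μ := gaussianReal 0 v)
    (Filter.Eventually.of_forall fun t => norm_interaction_picture_le hK hD t)
  simpa [averagedPropagator] using this

/-- A Chebyshev estimate: off the spectral projection P the operator m is invertible with inverse of
norm at most 1/δ. -/
theorem norm_one_sub_mul_le {p P r m : 𝓐} {δ e : ℝ} (hδ : 0 < δ) (hr : 1 - P = r * m)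
    (hrδ : δ * ‖r‖ ≤ 1) (hm : ‖m * p‖ ≤ e) : ‖(1 - P) * p‖ ≤ e / δ := by
  rw [hr, mul_assoc]
  have h1 : ‖r‖ ≤ 1 / δ := by rw [le_div_iff₀ hδ, mul_comm]; exact hrδ
  have h2 : ‖r‖ * ‖m * p‖ ≤ 1 / δ * e := by gcongr
  calc ‖r * (m * p)‖ ≤ ‖r‖ * ‖m * p‖ := norm_mul_le _ _
    _ ≤ 1 / δ * e := h2
    _ = e / δ := by ring

theorem norm_le_one_of_isStarProjection {p : 𝓐} (hp : IsStarProjection p) : ‖p‖ ≤ 1 := by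
  have h : ‖p‖ * ‖p‖ = ‖p‖ := by
    rw [← CStarRing.norm_star_mul_self, hp.isSelfAdjoint.star_eq, hp.isIdempotentElem.eq]
  nlinarith [norm_nonneg p]

/-- The factorised approximation of the kernel projection `p` of `k = N + D`, where `D` is local up
to small errors and `N` is close to `m₁ + m₂`. -/
theorem norm_averagedPropagator_mul_sub_le {k D N K' D' p P Q m₁ m₂ s₁ s₂ r₁ r₂ : 𝓐} {v : ℝ≥0}
    (hk : IsSelfAdjoint k) (hD : IsSelfAdjoint D) (hN : N = s₁ + s₂) (hkN : k - D = N)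
    (hK' : IsSelfAdjoint K') (hD' : IsSelfAdjoint D')
    (hp : IsSelfAdjoint p)
    (hP : IsStarProjection P) (hQ : IsStarProjection Q) (hPQ : Commute P Q)
    {e₁ e₂ e₃ δ ε T : ℝ} (hδ : 0 < δ)
    (hs₁ : ‖s₁ - m₁‖ ≤ ε) (hs₂ : ‖s₂ - m₂‖ ≤ ε)
    (hm₁ : ‖m₁ * P‖ ≤ δ) (hm₂ : ‖m₂ * Q‖ ≤ δ)
    (hr₁ : 1 - P = r₁ * m₁) (hr₂ : 1 - Q = r₂ * m₂)
    (hrδ₁ : δ * ‖r₁‖ ≤ 1) (hrδ₂ : δ * ‖r₂‖ ≤ 1)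
    (hmp₁ : ‖m₁ * p‖ ≤ e₂) (hmp₂ : ‖m₂ * p‖ ≤ e₂)
    (hF : ‖∫ t, propagator k t ∂(gaussianReal 0 v) - p‖ ≤ e₁)
    (hT : ∫ t, |t| ∂(gaussianReal 0 v) ≤ T)
    {η : ℝ → ℝ} (hη : ∀ t s, |s| ≤ |t| → ‖heisenberg k s D - heisenberg K' s D'‖ ≤ η t)
    (hηi : Integrable (fun t => |t| * η t) (gaussianReal 0 v))
    (hηe : ∫ t, |t| * η t ∂(gaussianReal 0 v) ≤ e₃) :
    ‖averagedPropagator v K' D' * P * Q - p‖ ≤ e₁ + e₃ + T * (2 * ε + 2 * δ) + 2 * (e₂ / δ) := by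
  have hP1 := norm_le_one_of_isStarProjection hP
  have hQ1 := norm_le_one_of_isStarProjection hQ
  have hPQ1 : ‖P * Q‖ ≤ 1 := (norm_mul_le _ _).trans (by
    calc ‖P‖ * ‖Q‖ ≤ 1 * 1 := by gcongr
      _ = 1 := one_mul 1)
  have hNs : IsSelfAdjoint N := hkN ▸ hk.sub hD
  have hdiff : ‖averagedPropagator v K' D' - averagedPropagator v k D‖ ≤ e₃ := by
    rw [averagedPropagator, averagedPropagator, ← integral_sub
      (integrable_interaction_picture hK' hD' v) (integrable_interaction_picture hk hD v)]
    refine (norm_integral_le_of_norm_le hηi (Filter.Eventually.of_forall fun t => ?_)).trans hηe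
    rw [norm_sub_rev]
    exact norm_interaction_picture_sub_le hk hD hK' hD' (hη t)
  -- P and Q commute, so each local operator can be brought next to its own spectral projection.
  have hNPQ : ‖N * (P * Q)‖ ≤ 2 * ε + 2 * δ := by
    have e : N * (P * Q) = (s₁ - m₁) * (P * Q) + (s₂ - m₂) * (P * Q) + m₁ * P * Q + m₂ * Q * P := by
      rw [hN, mul_assoc m₂, ← hPQ.eq]; noncomm_ring
    have hε : 0 ≤ ε := (norm_nonneg _).trans hs₁
    have h1 : ‖(s₁ - m₁) * (P * Q)‖ ≤ ε * 1 := (norm_mul_le _ _).trans (by gcongr)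
    have h2 : ‖(s₂ - m₂) * (P * Q)‖ ≤ ε * 1 := (norm_mul_le _ _).trans (by gcongr)
    have h3 : ‖m₁ * P * Q‖ ≤ δ * 1 := (norm_mul_le _ _).trans (by gcongr)
    have h4 : ‖m₂ * Q * P‖ ≤ δ * 1 := (norm_mul_le _ _).trans (by gcongr)
    rw [e]
    have h5 := norm_add_le ((s₁ - m₁) * (P * Q) + (s₂ - m₂) * (P * Q) + m₁ * P * Q) (m₂ * Q * P)
    have h6 := norm_add_le ((s₁ - m₁) * (P * Q) + (s₂ - m₂) * (P * Q)) (m₁ * P * Q)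
    have h7 := norm_add_le ((s₁ - m₁) * (P * Q)) ((s₂ - m₂) * (P * Q))
    linarith
  have habs : Integrable (fun t : ℝ => |t|) (gaussianReal 0 v) := by
    refine (integrable_exp_mul_abs_gaussianReal v 1).mono' (by fun_prop)
      (Filter.Eventually.of_forall fun t => ?_)
    rw [Real.norm_eq_abs, abs_abs, one_mul]
    linarith [Real.add_one_le_exp |t|]
  have hFV : ‖(∫ t, propagator k t ∂(gaussianReal 0 v)) * (P * Q)
      - averagedPropagator v k D * (P * Q)‖ ≤ T * (2 * ε + 2 * δ) := by
    rw [averagedPropagator, integral_mul_right_gaussian (integrable_propagator hk v),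
      integral_mul_right_gaussian (integrable_interaction_picture hk hD v),
      ← integral_sub ((integrable_propagator hk v).mul_const _)
        ((integrable_interaction_picture hk hD v).mul_const _)]
    have h0 : 0 ≤ 2 * ε + 2 * δ := (norm_nonneg _).trans hNPQ
    refine (norm_integral_le_of_norm_le (habs.mul_const (2 * ε + 2 * δ))
      (Filter.Eventually.of_forall fun t => ?_)).trans ?_
    -- Factoring out the interaction-picture propagator leaves e^{itN}PQ − PQ, which is small
    -- because N PQ is.
    · have e : propagator k t * (P * Q) - propagator k t * propagator (k - D) (-t) * (P * Q)
          = (propagator k t * propagator (k - D) (-t)) * (propagator N t * (P * Q) - P * Q) := by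
        have h1 : propagator (k - D) (-t) * propagator N t = 1 := by
          rw [hkN]; exact propagator_neg_mul N t
        calc _ = propagator k t * 1 * (P * Q)
            - propagator k t * propagator (k - D) (-t) * (P * Q) := by rw [mul_one]
          _ = _ := by rw [← h1]; simp only [mul_sub, mul_assoc]
      rw [e]
      calc _ ≤ ‖propagator k t * propagator (k - D) (-t)‖ * ‖propagator N t * (P * Q) - P * Q‖ :=
            norm_mul_le _ _
        _ ≤ 1 * (|t| * (2 * ε + 2 * δ)) := by
            gcongr
            · exact norm_interaction_picture_le hk hD t
            · exact (norm_propagator_mul_sub_le hNs _ t).trans (by gcongr)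
        _ = _ := one_mul _
    · rw [integral_mul_const]
      gcongr
  -- The Chebyshev estimate bounds (1 − P)p; self-adjointness moves p to the left.
  have hpP : ‖p * (1 - P)‖ ≤ e₂ / δ := by
    have h := norm_one_sub_mul_le hδ hr₁ hrδ₁ hmp₁
    rw [← norm_star, star_mul, star_sub, star_one, hp.star_eq, hP.isSelfAdjoint.star_eq] at h
    exact h
  have hpQ : ‖p * (1 - Q)‖ ≤ e₂ / δ := by
    have h := norm_one_sub_mul_le hδ hr₂ hrδ₂ hmp₂
    rw [← norm_star, star_mul, star_sub, star_one, hp.star_eq, hQ.isSelfAdjoint.star_eq] at h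
    exact h
  set F := ∫ t, propagator k t ∂(gaussianReal 0 v)
  -- The errors, in order: localising the propagator, discarding e^{-it(k-D)} on PQ, replacing F by
  -- p, and the defects of P and Q on p.
  have e : averagedPropagator v K' D' * P * Q - p =
      (averagedPropagator v K' D' - averagedPropagator v k D) * (P * Q)
      - (F * (P * Q) - averagedPropagator v k D * (P * Q)) + (F - p) * (P * Q)
      - p * (1 - P) * Q - p * (1 - Q) := by noncomm_ring
  rw [e]
  have he₃ : 0 ≤ e₃ := (norm_nonneg _).trans hdiff
  have he₁ : 0 ≤ e₁ := (norm_nonneg _).trans hF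
  have he₂ : 0 ≤ e₂ / δ := (norm_nonneg _).trans hpP
  have h1 : ‖(averagedPropagator v K' D' - averagedPropagator v k D) * (P * Q)‖ ≤ e₃ * 1 :=
    (norm_mul_le _ _).trans (by gcongr)
  have h2 : ‖(F - p) * (P * Q)‖ ≤ e₁ * 1 := (norm_mul_le _ _).trans (by gcongr)
  have h3 : ‖p * (1 - P) * Q‖ ≤ e₂ / δ * 1 := (norm_mul_le _ _).trans (by gcongr)
  refine (norm_sub_le _ _).trans ?_
  refine (add_le_add ((norm_sub_le _ _).trans (add_le_add ((norm_add_le _ _).trans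
    (add_le_add ((norm_sub_le _ _).trans (add_le_add h1 hFV)) h2)) h3)) hpQ).trans (le_of_eq ?_)
  ring

end Approximation

end SpinSystem

namespace SpinSystem

/-! ### Comparing Gaussian averages under two dynamics. -/

section SmearComparison

open MeasureTheory ProbabilityTheory
open scoped NNReal

variable {𝓐 : Type*} [CStarAlgebra 𝓐]

/-- Powers of time are absorbed into an exponential of rate 1/l. For a variance proportional to l
this changes the Gaussian integrals only by bounded factors. -/
theorem abs_le_mul_exp {l : ℝ} (hl : 0 < l) (s : ℝ) : |s| ≤ l * Real.exp (1 / l * |s|) := by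
  have h := Real.add_one_le_exp (1 / l * |s|)
  calc |s| = l * (1 / l * |s|) := by field_simp
    _ ≤ l * Real.exp (1 / l * |s|) := by gcongr; linarith

theorem sq_le_mul_exp {l : ℝ} (hl : 0 < l) (s : ℝ) :
    |s| * |s| ≤ 2 * l ^ 2 * Real.exp (1 / l * |s|) := by
  have h := Real.quadratic_le_exp_of_nonneg (x := 1 / l * |s|) (by positivity)
  calc |s| * |s| = 2 * l ^ 2 * ((1 / l * |s|) ^ 2 / 2) := by field_simp
    _ ≤ 2 * l ^ 2 * Real.exp (1 / l * |s|) := by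
      gcongr
      have : 0 ≤ 1 / l * |s| := by positivity
      linarith

theorem integral_abs_gaussianReal_le (v : ℝ≥0) {l : ℝ} (hl : 0 < l) :
    ∫ t, |t| ∂(gaussianReal 0 v) ≤ l * (2 * Real.exp (v * (1 / l) ^ 2 / 2)) := by
  calc ∫ t, |t| ∂(gaussianReal 0 v) ≤ ∫ t, l * Real.exp (1 / l * |t|) ∂(gaussianReal 0 v) := by
        refine integral_mono_of_nonneg (Filter.Eventually.of_forall fun t => abs_nonneg t)
          ((integrable_exp_mul_abs_gaussianReal v _).const_mul l)
          (Filter.Eventually.of_forall fun t => abs_le_mul_exp hl t)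
    _ = l * ∫ t, Real.exp (1 / l * |t|) ∂(gaussianReal 0 v) := integral_const_mul _ _
    _ ≤ _ := by gcongr; exact integral_exp_mul_abs_gaussianReal_le v _

theorem norm_smear_sub_smear_le {K L A : 𝓐} (hK : IsSelfAdjoint K) (hL : IsSelfAdjoint L)
    {v : ℝ≥0} {M a l : ℝ} (hM : 0 ≤ M) (hl : 0 < l)
    (h : ∀ t, ‖heisenberg K t A - heisenberg L t A‖ ≤ |t| * |t| * (M * Real.exp (a * |t|))) :
    ‖smear v K A - smear v L A‖ ≤
      2 * l ^ 2 * M * (2 * Real.exp (v * (a + 1 / l) ^ 2 / 2)) := by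
  rw [smear, smear, ← integral_sub (integrable_heisenberg hK v A) (integrable_heisenberg hL v A)]
  refine (norm_integral_le_of_norm_le ((integrable_exp_mul_abs_gaussianReal v (a + 1 / l)).const_mul
    (2 * l ^ 2 * M)) (Filter.Eventually.of_forall fun t => (h t).trans ?_)).trans ?_
  · calc |t| * |t| * (M * Real.exp (a * |t|))
        ≤ 2 * l ^ 2 * Real.exp (1 / l * |t|) * (M * Real.exp (a * |t|)) := by
          exact mul_le_mul_of_nonneg_right (sq_le_mul_exp hl t) (by positivity)
      _ = 2 * l ^ 2 * M * (Real.exp (a * |t|) * Real.exp (1 / l * |t|)) := by ring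
      _ = _ := by rw [← Real.exp_add]; ring_nf
  · rw [integral_const_mul]
    gcongr
    exact integral_exp_mul_abs_gaussianReal_le v _

theorem heisenberg_smear_sub_le {K L A : 𝓐} (hK : IsSelfAdjoint K) (hL : IsSelfAdjoint L)
    {v : ℝ≥0} {M a l : ℝ} (hM : 0 ≤ M) (ha : 0 ≤ a) (hl : 0 < l)
    (h : ∀ t, ‖heisenberg K t A - heisenberg L t A‖ ≤ |t| * (M * Real.exp (a * |t|)))
    (t s : ℝ) (hst : |s| ≤ |t|) :
    ‖heisenberg K s (smear v K A) - heisenberg L s (smear v L A)‖ ≤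
      l * M * Real.exp ((a + 1 / l) * |t|) * (2 * Real.exp (v * (a + 1 / l) ^ 2 / 2)) := by
  have hi : ∀ {K : 𝓐}, IsSelfAdjoint K →
      Integrable (fun r => heisenberg K (s + r) A) (gaussianReal 0 v) := fun {K} hK =>
    integrable_of_continuous_of_norm_le ((continuous_heisenberg K A).comp (by fun_prop))
      (fun r => (norm_heisenberg hK _ A).le) v
  rw [heisenberg_smear hK, heisenberg_smear hL, ← integral_sub (hi hK) (hi hL)]
  refine (norm_integral_le_of_norm_le ((integrable_exp_mul_abs_gaussianReal v (a + 1 / l)).const_mul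
    (l * M * Real.exp ((a + 1 / l) * |t|)))
    (Filter.Eventually.of_forall fun r => (h (s + r)).trans ?_)).trans ?_
  · calc |s + r| * (M * Real.exp (a * |s + r|))
        ≤ l * Real.exp (1 / l * |s + r|) * (M * Real.exp (a * |s + r|)) := by
          gcongr; exact abs_le_mul_exp hl _
      _ = l * M * (Real.exp (a * |s + r|) * Real.exp (1 / l * |s + r|)) := by ring
      _ = l * M * Real.exp ((a + 1 / l) * |s + r|) := by rw [← Real.exp_add]; ring_nf
      -- The evolution time s and the averaging time r add up; since |s| ≤ |t|, the exponentials
      -- separate.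
      _ ≤ l * M * Real.exp ((a + 1 / l) * |t| + (a + 1 / l) * |r|) := by
          gcongr
          rw [← mul_add]
          have := abs_add_le s r
          gcongr
          linarith
      _ = _ := by rw [Real.exp_add]; ring
  · rw [integral_const_mul]
    gcongr
    exact integral_exp_mul_abs_gaussianReal_le v _

theorem integrable_abs_mul_exp (v : ℝ≥0) {l c b : ℝ} (hl : 0 < l) (hc : 0 ≤ c) :
    Integrable (fun t => |t| * (c * Real.exp (b * |t|))) (gaussianReal 0 v) ∧
    ∫ t, |t| * (c * Real.exp (b * |t|)) ∂(gaussianReal 0 v) ≤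
      l * c * (2 * Real.exp (v * (b + 1 / l) ^ 2 / 2)) := by
  have hle : ∀ t : ℝ, |t| * (c * Real.exp (b * |t|)) ≤ l * c * Real.exp ((b + 1 / l) * |t|) := by
    intro t
    calc |t| * (c * Real.exp (b * |t|)) ≤ l * Real.exp (1 / l * |t|) * (c * Real.exp (b * |t|)) := by
          gcongr; exact abs_le_mul_exp hl _
      _ = l * c * (Real.exp (b * |t|) * Real.exp (1 / l * |t|)) := by ring
      _ = _ := by rw [← Real.exp_add]; ring_nf
  have hg := (integrable_exp_mul_abs_gaussianReal v (b + 1 / l)).const_mul (l * c)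
  have hi : Integrable (fun t => |t| * (c * Real.exp (b * |t|))) (gaussianReal 0 v) :=
    hg.mono' (by fun_prop) (Filter.Eventually.of_forall fun t => by
      rw [Real.norm_of_nonneg (by positivity)]; exact hle t)
  refine ⟨hi, (integral_mono hi hg hle).trans ?_⟩
  rw [integral_const_mul]
  gcongr
  exact integral_exp_mul_abs_gaussianReal_le v _

end SmearComparison

/-! ### Terms that couple a region to its complement. -/

section Crossing

variable {𝒱 : Type*} [DecidableEq 𝒱] {n : 𝒱 → ℕ}

/-- The terms of the Hamiltonian on `V` that couple `G` to its complement. -/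
noncomputable def Interaction.crossing (Φ : Interaction n) (V G : Finset 𝒱) :
    Finset (Finset 𝒱) :=
  (Φ.support V).filter fun Y => ¬ (Y ⊆ G ∨ (Y ⊆ V ∧ Disjoint Y G))

/-- The Hamiltonian of the terms inside `G`, as an observable on `V`. -/
noncomputable def innerHamiltonian (Φ : Interaction n) (V G : Finset 𝒱) : Obs n V :=
  ∑ Y ∈ Φ.support V with Y ⊆ G, Φ.on V Y

theorem isSelfAdjoint_innerHamiltonian (Φ : Interaction n) (V G : Finset 𝒱) :
    IsSelfAdjoint (innerHamiltonian Φ V G) := isSelfAdjoint_sum_on Φ V _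

theorem innerHamiltonian_mem (Φ : Interaction n) {V G : Finset 𝒱} (hG : G ⊆ V) :
    innerHamiltonian Φ V G ∈ localAlgebra n hG :=
  sum_on_mem Φ hG fun _ hY => (Finset.mem_filter.1 hY).2

theorem mem_crossing {Φ : Interaction n} {V G Y : Finset 𝒱} :
    Y ∈ Φ.crossing V G ↔ Y ∈ Φ.support V ∧ ¬ Y ⊆ G ∧ ¬ Disjoint Y G := by
  rw [Interaction.crossing, Finset.mem_filter]
  refine and_congr_right fun h => ?_
  have := (Interaction.mem_support.1 h).1
  tauto

/-- Comparison of the full dynamics with the dynamics inside `G`. -/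
theorem norm_heisenberg_sub_inner_le (Φ : Interaction n) {V G : Finset 𝒱} (hG : G ⊆ V)
    {A : Obs n V} (hA : A ∈ localAlgebra n hG) {t M : ℝ}
    (hM : ∀ s, |s| ≤ |t| →
      ‖(∑ Y ∈ Φ.crossing V G, Φ.on V Y) * heisenberg (hamiltonian Φ V) s A
        - heisenberg (hamiltonian Φ V) s A * (∑ Y ∈ Φ.crossing V G, Φ.on V Y)‖ ≤ M) :
    ‖heisenberg (hamiltonian Φ V) t A - heisenberg (innerHamiltonian Φ V G) t A‖ ≤ |t| * M := by
  classical
  -- The comparison dynamics also keeps the terms outside G. They do not move an observable in G,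
  -- and the generators then differ exactly by the crossing terms.
  set d := (Φ.support V).filter fun Z => Z ⊆ G ∨ (Z ⊆ V ∧ Disjoint Z G) with hd
  have hsum : hamiltonian Φ V - ∑ Z ∈ d, Φ.on V Z = ∑ Y ∈ Φ.crossing V G, Φ.on V Y := by
    rw [hamiltonian_eq_sum_support, ← Finset.sum_filter_add_sum_filter_not (Φ.support V)
      (fun Z => Z ⊆ G ∨ (Z ⊆ V ∧ Disjoint Z G)), hd, add_sub_cancel_left, Interaction.crossing]
  have hinner : heisenberg (∑ Z ∈ d, Φ.on V Z) t A = heisenberg (innerHamiltonian Φ V G) t A := by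
    rw [heisenberg_decoupled_mem Φ hG (fun Z hZ => (Finset.mem_filter.1 hZ).2) hA,
      Finset.filter_filter, innerHamiltonian]
    congr 2
    ext Z
    simp only [Finset.mem_filter]
    tauto
  rw [← hinner]
  refine norm_heisenberg_sub_le (isSelfAdjoint_sum_on Φ V d) A ?_
  rw [hsum]
  exact hM

end Crossing

/-! ### Lieb–Robinson bounds for sums of terms. -/

section Locality

variable {𝒱 : Type*} [DecidableEq 𝒱] [MetricSpace 𝒱] {n : 𝒱 → ℕ}

theorem IsLiebRobinson.norm_commutator_le {Φ : Interaction n} {μ c v : ℝ}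
    (h : IsLiebRobinson Φ μ c v) (hμ : 0 ≤ μ) (hn : ∀ x, 0 < n x) {V S Y : Finset 𝒱} (hS : S ⊆ V)
    (hY : Y ⊆ V) {D : ℝ} (hD : 0 < D) (hd : ∀ x ∈ S, ∀ y ∈ Y, D ≤ dist x y) {A B : Obs n V}
    (hA : A ∈ localAlgebra n hS) (hB : B ∈ localAlgebra n hY) (t : ℝ) :
    ‖B * heisenberg (hamiltonian Φ V) t A - heisenberg (hamiltonian Φ V) t A * B‖ ≤
      c * ‖A‖ * ‖B‖ * Y.card * (Real.exp (-μ * D) * Real.exp (μ * v * |t|)) := by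
  obtain ⟨hc, -, h⟩ := h
  have hdisj : Disjoint S Y := Finset.disjoint_left.2 fun x hx hy => by
    have := hd x hx x hy
    rw [dist_self] at this
    linarith
  obtain ⟨A, rfl⟩ := hA
  obtain ⟨B, rfl⟩ := hB
  have h1 := h V S Y hS hY hdisj A B t
  rw [evolve_eq_heisenberg] at h1
  change ‖embed hY B * heisenberg (hamiltonian Φ V) t (embed hS A)
    - heisenberg (hamiltonian Φ V) t (embed hS A) * embed hY B‖ ≤
    c * ‖embed hS A‖ * ‖embed hY B‖ * Y.card * _
  rw [norm_embed hn, norm_embed hn, norm_sub_rev]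
  refine h1.trans ?_
  have hcard : ((phiBoundary Φ Y).card : ℝ) ≤ Y.card := by
    exact_mod_cast Finset.card_le_card (phiBoundary_subset Φ Y)
  -- For an empty set `setDist` is the infimum of the empty set and says nothing about D; the empty
  -- Φ-boundary makes the bound vanish instead.
  rcases S.eq_empty_or_nonempty with rfl | hSne
  · have : phiBoundary Φ (∅ : Finset 𝒱) = ∅ := Finset.subset_empty.1 (phiBoundary_subset Φ ∅)
    rw [this]
    simp only [Finset.card_empty, Nat.zero_min, Nat.cast_zero, mul_zero, zero_mul]
    positivity
  rcases Y.eq_empty_or_nonempty with rfl | hYne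
  · have : phiBoundary Φ (∅ : Finset 𝒱) = ∅ := Finset.subset_empty.1 (phiBoundary_subset Φ ∅)
    rw [this]
    simp
  have hsd := le_setDist hSne hYne hd
  have h2 : Real.exp (-μ * (setDist S Y - v * |t|)) ≤
      Real.exp (-μ * D) * Real.exp (μ * v * |t|) := by
    rw [← Real.exp_add]
    refine Real.exp_le_exp.2 ?_
    nlinarith
  have h3 : ((min (phiBoundary Φ S).card (phiBoundary Φ Y).card : ℕ) : ℝ) ≤ Y.card :=
    (Nat.cast_le.2 (min_le_right _ _)).trans hcard
  gcongr

theorem IsLiebRobinson.norm_commutator_sum_le {Φ : Interaction n} {μ c v : ℝ}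
    (h : IsLiebRobinson Φ μ c v) (hμ : 0 ≤ μ) (hn : ∀ x, 0 < n x) (hN : Φ.bigN < ⊤) {J : ℝ}
    (hJ : 0 ≤ J) (hΦ : Φ.BoundedBy J) {V S E : Finset 𝒱} (hS : S ⊆ V) {u : Finset (Finset 𝒱)}
    (hu : ∀ Y ∈ u, Y ∈ Φ.support V) (hE : ∀ Y ∈ u, ∃ x ∈ E, x ∈ Y)
    {D : ℝ} (hD : 0 < D) (hd : ∀ Y ∈ u, ∀ x ∈ S, ∀ y ∈ Y, D ≤ dist x y) {A : Obs n V}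
    (hA : A ∈ localAlgebra n hS) (t : ℝ) :
    ‖(∑ Y ∈ u, Φ.on V Y) * heisenberg (hamiltonian Φ V) t A
      - heisenberg (hamiltonian Φ V) t A * (∑ Y ∈ u, Φ.on V Y)‖ ≤
      c * ‖A‖ * J * (E.card * Φ.bigN.toReal) * (Real.exp (-μ * D) * Real.exp (μ * v * |t|)) := by
  have hc := h.1
  rw [Finset.sum_mul, Finset.mul_sum, ← Finset.sum_sub_distrib]
  refine (norm_sum_le _ _).trans ?_
  have h1 := sum_card_le_of_meets Φ hN E u hE fun Y hY => (Interaction.mem_support.1 (hu Y hY)).2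
  calc _ ≤ ∑ Y ∈ u, c * ‖A‖ * J * (Real.exp (-μ * D) * Real.exp (μ * v * |t|)) * Y.card := by
        refine Finset.sum_le_sum fun Y hY => ?_
        have hYV := (Interaction.mem_support.1 (hu Y hY)).1
        refine (h.norm_commutator_le hμ hn hS hYV hD (hd Y hY) hA (Φ.on_mem subset_rfl hYV)
          t).trans ?_
        have h3 := Φ.norm_on_le hJ hΦ V Y
        rw [mul_right_comm]
        gcongr
    _ = c * ‖A‖ * J * (Real.exp (-μ * D) * Real.exp (μ * v * |t|)) * ∑ Y ∈ u, (Y.card : ℝ) := by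
        rw [Finset.mul_sum]
    _ ≤ c * ‖A‖ * J * (Real.exp (-μ * D) * Real.exp (μ * v * |t|)) *
        (E.card * Φ.bigN.toReal) := by gcongr
    _ = _ := by ring

end Locality

end SpinSystem

namespace SpinSystem

/-! ### Interior, exterior and border. -/

section Regions

variable {𝒱 : Type*} [MetricSpace 𝒱]

open Classical in
/-- The points of `G` at distance at least `l` from `E`. -/
noncomputable def farPart (E G : Finset 𝒱) (l : ℝ) : Finset 𝒱 :=
  G.filter fun x => ∀ y ∈ E, l ≤ dist x y

theorem mem_farPart {E G : Finset 𝒱} {l : ℝ} {x : 𝒱} :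
    x ∈ farPart E G l ↔ x ∈ G ∧ ∀ y ∈ E, l ≤ dist x y := by
  simp [farPart]

theorem interiorSet_eq (R : ℝ) (V X : Finset 𝒱) (l : ℝ) :
    interiorSet R V X l = farPart (bdry R V X) X l := rfl

theorem mem_borderSet {R : ℝ} {V X : Finset 𝒱} {l : ℝ} {x : 𝒱} :
    x ∈ borderSet R V X l ↔ x ∈ V ∧ ∃ y ∈ bdry R V X, dist x y < l := by
  simp [borderSet]

theorem mem_bdry {R : ℝ} {V X : Finset 𝒱} {x : 𝒱} :
    x ∈ bdry R V X ↔ x ∈ X ∧ ∃ y ∈ V, y ∉ X ∧ dist x y ≤ R := by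
  simp [bdry]

theorem borderSet_mono (R : ℝ) (V X : Finset 𝒱) {l l' : ℝ} (h : l ≤ l') :
    borderSet R V X l ⊆ borderSet R V X l' := by
  intro x hx
  obtain ⟨h1, y, hy, h2⟩ := mem_borderSet.1 hx
  exact mem_borderSet.2 ⟨h1, y, hy, h2.trans_le h⟩

end Regions

section Meeting

variable {𝒱 : Type*} [DecidableEq 𝒱] {n : 𝒱 → ℕ}

/-- Crossing is symmetric under complement, so the boundary of X, a subset of X, also serves as the
reference set for the exterior side. -/
theorem crossing_sdiff (Φ : Interaction n) {V X Y : Finset 𝒱} (h : Y ∈ Φ.crossing V (V \ X)) :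
    Y ∈ Φ.crossing V X := by
  obtain ⟨h1, h2, h3⟩ := mem_crossing.1 h
  have hYV := (Interaction.mem_support.1 h1).1
  obtain ⟨y, hyY, hyX⟩ := Finset.not_subset.1 h2
  obtain ⟨x, hxY, hxX⟩ := Finset.not_disjoint_iff.1 h3
  rw [Finset.mem_sdiff] at hxX hyX
  refine mem_crossing.2 ⟨h1, fun h => hxX.2 (h hxY), Finset.not_disjoint_iff.2 ⟨y, hyY, ?_⟩⟩
  by_contra hy
  exact hyX ⟨hYV hyY, hy⟩

/-- The terms of the Hamiltonian on `V` that meet `I`. -/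
noncomputable def Interaction.meeting (Φ : Interaction n) (V I : Finset 𝒱) :
    Finset (Finset 𝒱) :=
  (Φ.support V).filter fun Y => ∃ x ∈ I, x ∈ Y

theorem mem_meeting {Φ : Interaction n} {V I Y : Finset 𝒱} :
    Y ∈ Φ.meeting V I ↔ Y ∈ Φ.support V ∧ ∃ x ∈ I, x ∈ Y := Finset.mem_filter

end Meeting

/-! ### Splitting the Hamiltonian and localising its three pieces. -/

section Geometry

variable {𝒱 : Type*} [DecidableEq 𝒱] [MetricSpace 𝒱] {n : 𝒱 → ℕ}

theorem exteriorSet_eq (R : ℝ) (V X : Finset 𝒱) (l : ℝ) :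
    exteriorSet R V X l = farPart (bdry R V X) (V \ X) l := by
  ext x
  simp [exteriorSet, mem_farPart, and_assoc]

/-- Every term that couples `X` to its complement meets the `R`-boundary of `X`. -/
theorem exists_mem_bdry_of_crossing {Φ : Interaction n} {R : ℝ} (hR : Φ.HasRange R)
    {V X Y : Finset 𝒱} (h : Y ∈ Φ.crossing V X) : ∃ x ∈ bdry R V X, x ∈ Y := by
  obtain ⟨h1, h2, h3⟩ := mem_crossing.1 h
  obtain ⟨hYV, hY⟩ := Interaction.mem_support.1 h1
  obtain ⟨y, hyY, hyX⟩ := Finset.not_subset.1 h2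
  obtain ⟨x, hxY, hxX⟩ := Finset.not_disjoint_iff.1 h3
  exact ⟨x, mem_bdry.2 ⟨hxX, y, hYV hyY, hyX, hR.dist_le hY hxY hyY⟩, hxY⟩

theorem subset_of_mem_meeting_farPart {Φ : Interaction n} {R : ℝ} (hR : Φ.HasRange R)
    {V G E : Finset 𝒱} (hE : ∀ Y ∈ Φ.crossing V G, ∃ x ∈ E, x ∈ Y) {l : ℝ} (hl : R < l)
    {Y : Finset 𝒱} (hY : Y ∈ Φ.meeting V (farPart E G l)) : Y ⊆ G := by
  obtain ⟨h1, x, hx, hxY⟩ := mem_meeting.1 hY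
  obtain ⟨hxG, hxE⟩ := mem_farPart.1 hx
  by_contra h2
  obtain ⟨z, hz, hzY⟩ := hE Y (mem_crossing.2 ⟨h1, h2, Finset.not_disjoint_iff.2 ⟨x, hxY, hxG⟩⟩)
  have h3 := hxE z hz
  have h4 := hR.dist_le (Interaction.mem_support.1 h1).2 hxY hzY
  linarith

theorem sum_meeting_mem {Φ : Interaction n} {R : ℝ} (hR : Φ.HasRange R)
    {V G E : Finset 𝒱} (hG : G ⊆ V) (hE : ∀ Y ∈ Φ.crossing V G, ∃ x ∈ E, x ∈ Y) {l : ℝ}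
    (hl : R < l) : ∑ Y ∈ Φ.meeting V (farPart E G l), Φ.on V Y ∈ localAlgebra n hG :=
  sum_on_mem Φ hG fun _ hY => subset_of_mem_meeting_farPart hR hE hl hY

/-- Only terms missing I can contribute to the commutator. A term meeting I that overlaps one of
them has a point outside I, so by finite range it meets the R-boundary of I. -/
theorem norm_commutator_meeting_le (Φ : Interaction n) (hN : Φ.bigN < ⊤) {J R : ℝ} (hJ : 0 ≤ J)
    (hΦ : Φ.BoundedBy J) (hR : Φ.HasRange R) (V I : Finset 𝒱) :
    ‖hamiltonian Φ V * (∑ Y ∈ Φ.meeting V I, Φ.on V Y)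
      - (∑ Y ∈ Φ.meeting V I, Φ.on V Y) * hamiltonian Φ V‖ ≤
      2 * J ^ 2 * Φ.bigC.toReal * Φ.bigN.toReal * (bdry R V I).card := by
  set u := (Φ.support V).filter fun Y => ¬ ∃ x ∈ I, x ∈ Y with hu
  have hsum : hamiltonian Φ V = ∑ Y ∈ Φ.meeting V I, Φ.on V Y + ∑ Y ∈ u, Φ.on V Y := by
    rw [hamiltonian_eq_sum_support, ← Finset.sum_filter_add_sum_filter_not (Φ.support V)
      (fun Y => ∃ x ∈ I, x ∈ Y), hu, Interaction.meeting]
  have h := norm_commutator_sum_on_le Φ hN hJ hΦ V (bdry R V I) (Φ.meeting V I) u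
    (fun X hX => (Interaction.mem_support.1 (mem_meeting.1 hX).1).2)
    (fun X hX => (Interaction.mem_support.1 (Finset.mem_filter.1 hX).1).2) (fun Y hY Z hZ hd => ?_)
  · rw [hsum, add_mul, mul_add, add_sub_add_left_eq_sub]
    exact h
  · obtain ⟨hY1, x, hxI, hxY⟩ := mem_meeting.1 hY
    obtain ⟨hZ1, hZ2⟩ := Finset.mem_filter.1 hZ
    obtain ⟨y, hyY, hyZ⟩ := Finset.not_disjoint_iff.1 hd
    exact ⟨x, mem_bdry.2 ⟨hxI, y, (Interaction.mem_support.1 hZ1).1 hyZ,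
      fun hyI => hZ2 ⟨y, hyI, hyZ⟩, hR.dist_le (Interaction.mem_support.1 hY1).2 hxY hyY⟩, hxY⟩

/-- Starting from a point at distance l from E, two overlapping terms come closer to E by at most
2R. -/
theorem commutator_meeting_mem (Φ : Interaction n) {R : ℝ} (hR0 : 0 ≤ R) (hR : Φ.HasRange R)
    (V E G : Finset 𝒱) {l : ℝ} :
    hamiltonian Φ V * (∑ Y ∈ Φ.meeting V (farPart E G l), Φ.on V Y)
      - (∑ Y ∈ Φ.meeting V (farPart E G l), Φ.on V Y) * hamiltonian Φ V ∈
      localAlgebra n (show farPart E V (l - 2 * R) ⊆ V from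
        fun _ hx => (mem_farPart.1 hx).1) := by
  have e : hamiltonian Φ V * (∑ Y ∈ Φ.meeting V (farPart E G l), Φ.on V Y)
      - (∑ Y ∈ Φ.meeting V (farPart E G l), Φ.on V Y) * hamiltonian Φ V
      = ∑ Y ∈ Φ.meeting V (farPart E G l), ∑ Z ∈ Φ.support V,
        (Φ.on V Z * Φ.on V Y - Φ.on V Y * Φ.on V Z) := by
    rw [hamiltonian_eq_sum_support, Finset.sum_mul_sum, Finset.sum_mul_sum, Finset.sum_comm,
      ← Finset.sum_sub_distrib]
    exact Finset.sum_congr rfl fun Y _ => by rw [← Finset.sum_sub_distrib]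
  rw [e]
  refine sum_mem fun Y hY => sum_mem fun Z hZ => ?_
  obtain ⟨hY1, x, hx, hxY⟩ := mem_meeting.1 hY
  obtain ⟨hYV, hY0⟩ := Interaction.mem_support.1 hY1
  obtain ⟨hZV, hZ0⟩ := Interaction.mem_support.1 hZ
  by_cases hd : Disjoint Y Z
  · rw [(Φ.commute_on hd.symm).eq, sub_self]
    exact zero_mem _
  · obtain ⟨u, huY, huZ⟩ := Finset.not_disjoint_iff.1 hd
    have hYS : Y ⊆ farPart E V (l - 2 * R) := by
      refine fun y hy => mem_farPart.2 ⟨hYV hy, fun z hz => ?_⟩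
      have h1 := (mem_farPart.1 hx).2 z hz
      have h2 := hR.dist_le hY0 hxY hy
      linarith [dist_triangle x y z]
    have hZS : Z ⊆ farPart E V (l - 2 * R) := by
      refine fun y hy => mem_farPart.2 ⟨hZV hy, fun z hz => ?_⟩
      have h1 := (mem_farPart.1 hx).2 z hz
      have h2 := hR.dist_le hY0 hxY huY
      have h3 := hR.dist_le hZ0 huZ hy
      linarith [dist_triangle x u z, dist_triangle u y z]
    exact sub_mem (mul_mem (Φ.on_mem hZS _) (Φ.on_mem hYS _))
      (mul_mem (Φ.on_mem hYS _) (Φ.on_mem hZS _))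

/-- The dynamics of the terms deep inside `G` is almost the dynamics generated inside `G`. -/
theorem norm_heisenberg_meeting_sub_le {Φ : Interaction n} {μ c v : ℝ}
    (hLR : IsLiebRobinson Φ μ c v) (hμ : 0 ≤ μ) (hn : ∀ x, 0 < n x) (hN : Φ.bigN < ⊤) {J R : ℝ}
    (hJ : 0 ≤ J) (hΦ : Φ.BoundedBy J) (hR0 : 0 ≤ R) (hR : Φ.HasRange R) {V G E : Finset 𝒱}
    (hG : G ⊆ V) (hE : ∀ Y ∈ Φ.crossing V G, ∃ x ∈ E, x ∈ Y) {l : ℝ} (hl : 3 * R < l) {n₁ : ℝ}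
    (hn₁ : ‖hamiltonian Φ V * (∑ Y ∈ Φ.meeting V (farPart E G l), Φ.on V Y)
      - (∑ Y ∈ Φ.meeting V (farPart E G l), Φ.on V Y) * hamiltonian Φ V‖ ≤ n₁) (t : ℝ) :
    ‖heisenberg (hamiltonian Φ V) t (∑ Y ∈ Φ.meeting V (farPart E G l), Φ.on V Y)
      - heisenberg (innerHamiltonian Φ V G) t (∑ Y ∈ Φ.meeting V (farPart E G l), Φ.on V Y)‖ ≤
      |t| * |t| * (c * n₁ * J * (E.card * Φ.bigN.toReal) * Real.exp (-μ * (l - 3 * R)) *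
        Real.exp (μ * v * |t|)) := by
  have hc := hLR.1
  have hv := hLR.2.1
  have hn0 : 0 ≤ n₁ := (norm_nonneg _).trans hn₁
  have hN0 : 0 ≤ Φ.bigN.toReal := ENNReal.toReal_nonneg
  rw [mul_assoc |t|]
  refine norm_heisenberg_sub_inner_le Φ hG (sum_meeting_mem hR hG hE (by linarith)) fun s hs => ?_
  -- A crossing term overlapping one that meets the far part would put a point of E within 2R of a
  -- point at distance at least l. Being initially zero, the commutator can be controlled through
  -- [H, A].
  have hcomm : Commute (∑ Y ∈ Φ.crossing V G, Φ.on V Y)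
      (∑ Y ∈ Φ.meeting V (farPart E G l), Φ.on V Y) := by
    refine Commute.sum_left _ _ _ fun Y hY => Commute.sum_right _ _ _ fun Z hZ => ?_
    refine Φ.commute_on (Finset.disjoint_left.2 fun u huY huZ => ?_)
    obtain ⟨z, hzE, hzY⟩ := hE Y hY
    obtain ⟨hZ1, x, hx, hxZ⟩ := mem_meeting.1 hZ
    have h1 := (mem_farPart.1 hx).2 z hzE
    have h2 := hR.dist_le (Interaction.mem_support.1 hZ1).2 hxZ huZ
    have h3 := hR.dist_le (Interaction.mem_support.1 (mem_crossing.1 hY).1).2 huY hzY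
    linarith [dist_triangle x u z]
  have hB : 0 ≤ c * n₁ * J * (E.card * Φ.bigN.toReal) * Real.exp (-μ * (l - 3 * R)) *
      Real.exp (μ * v * |t|) := by positivity
  refine (norm_commutator_heisenberg_le _ _ _ hcomm (M := c * n₁ * J * (E.card * Φ.bigN.toReal) *
      Real.exp (-μ * (l - 3 * R)) * Real.exp (μ * v * |t|)) fun r hr => ?_).trans
    (mul_le_mul_of_nonneg_right hs hB)
  -- The commutator [H, A] loses 2R of the distance l and the crossing term, which meets E, another
  -- R; hence l − 3R.
  refine (hLR.norm_commutator_sum_le hμ hn hN hJ hΦ _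
    (fun Y hY => (mem_crossing.1 hY).1) hE (D := l - 3 * R) (by linarith) (fun Y hY x hx y hy => ?_)
    (commutator_meeting_mem Φ hR0 hR V E G) r).trans ?_
  · obtain ⟨z, hzE, hzY⟩ := hE Y hY
    have h1 := (mem_farPart.1 hx).2 z hzE
    have h3 := hR.dist_le (Interaction.mem_support.1 (mem_crossing.1 hY).1).2 hy hzY
    linarith [dist_triangle x y z]
  · have : |r| ≤ |t| := hr.trans hs
    rw [← mul_assoc]
    gcongr

/-- The terms of the Hamiltonian near the boundary of `X`. -/
noncomputable def Interaction.borderTerms (Φ : Interaction n) (R : ℝ) (V X : Finset 𝒱) (l : ℝ) :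
    Finset (Finset 𝒱) :=
  (Φ.support V).filter fun Y => Y ∉ Φ.meeting V (farPart (bdry R V X) X l) ∧
    Y ∉ Φ.meeting V (farPart (bdry R V X) (V \ X) l)

theorem subset_borderSet {Φ : Interaction n} {R : ℝ} {V X : Finset 𝒱} {l : ℝ} {Y : Finset 𝒱}
    (hY : Y ∈ Φ.borderTerms R V X l) : Y ⊆ borderSet R V X l := by
  obtain ⟨h1, h2, h3⟩ := Finset.mem_filter.1 hY
  rw [mem_meeting] at h2 h3
  intro x hx
  have hxV := (Interaction.mem_support.1 h1).1 hx
  refine mem_borderSet.2 ⟨hxV, ?_⟩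
  by_contra! h
  by_cases hxX : x ∈ X
  · exact h2 ⟨h1, x, mem_farPart.2 ⟨hxX, h⟩, hx⟩
  · exact h3 ⟨h1, x, mem_farPart.2 ⟨Finset.mem_sdiff.2 ⟨hxV, hxX⟩, h⟩, hx⟩

/-- No term is counted twice: for l > R a term that meets the interior lies inside X, so it misses
the exterior. -/
theorem hamiltonian_eq_add_add {Φ : Interaction n} {R : ℝ} (hR : Φ.HasRange R) (V X : Finset 𝒱)
    {l : ℝ} (hl : R < l) :
    hamiltonian Φ V = ∑ Y ∈ Φ.meeting V (farPart (bdry R V X) X l), Φ.on V Y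
      + ∑ Y ∈ Φ.meeting V (farPart (bdry R V X) (V \ X) l), Φ.on V Y
      + ∑ Y ∈ Φ.borderTerms R V X l, Φ.on V Y := by
  classical
  set s := Φ.meeting V (farPart (bdry R V X) X l) with hs
  set u := Φ.meeting V (farPart (bdry R V X) (V \ X) l) with hu
  have hd : Disjoint s u := by
    refine Finset.disjoint_left.2 fun Y hY hY' => ?_
    have h1 := subset_of_mem_meeting_farPart hR (fun Y hY => exists_mem_bdry_of_crossing hR hY)
      hl hY
    obtain ⟨-, x, hx, hxY⟩ := mem_meeting.1 hY'
    exact (Finset.mem_sdiff.1 (mem_farPart.1 hx).1).2 (h1 hxY)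
  rw [← Finset.sum_union hd, hamiltonian_eq_sum_support,
    ← Finset.sum_filter_add_sum_filter_not (Φ.support V) (fun Y => Y ∈ s ∪ u)]
  congr 1
  · refine Finset.sum_congr ?_ fun _ _ => rfl
    ext Y
    simp only [Finset.mem_filter, Finset.mem_union, hs, hu, mem_meeting]
    exact ⟨fun h => h.2, fun h => ⟨h.elim And.left And.left, h⟩⟩
  · refine Finset.sum_congr ?_ fun _ _ => rfl
    ext Y
    simp only [Finset.mem_filter, Finset.mem_union, Interaction.borderTerms, not_or, hs, hu]

/-- The added 1 accounts for the scalar term Φ(∅), which meets no site and is not counted by C_Φ. -/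
theorem norm_sum_borderTerms_le (Φ : Interaction n) (hN : Φ.bigN < ⊤) {J : ℝ} (hJ : 0 ≤ J)
    (hΦ : Φ.BoundedBy J) (R : ℝ) (V X : Finset 𝒱) (l : ℝ) :
    ‖∑ Y ∈ Φ.borderTerms R V X l, Φ.on V Y‖ ≤
      ((borderSet R V X l).card * Φ.bigC.toReal + 1) * J := by
  classical
  set s := Φ.borderTerms R V X l with hs
  have h1 := card_le_of_meets Φ hN (borderSet R V X l) (s.erase ∅) (fun Y hY => by
      obtain ⟨h2, h3⟩ := Finset.mem_erase.1 hY
      obtain ⟨x, hx⟩ := Finset.nonempty_iff_ne_empty.2 h2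
      exact ⟨x, subset_borderSet h3 hx, hx⟩)
    (fun Y hY => (Interaction.mem_support.1
      (Finset.mem_filter.1 (Finset.mem_erase.1 hY).2).1).2)
  have h2 : (s.card : ℝ) ≤ (s.erase ∅).card + 1 := by
    have := Finset.pred_card_le_card_erase (s := s) (a := ∅)
    exact_mod_cast (by omega : s.card ≤ (s.erase ∅).card + 1)
  calc _ ≤ (s.card : ℝ) * J := by
        rw [← nsmul_eq_mul]
        exact (norm_sum_le _ _).trans
          (Finset.sum_le_card_nsmul _ _ _ fun Y _ => Φ.norm_on_le hJ hΦ V Y)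
    _ ≤ _ := by gcongr; linarith

/-- The dynamics of the border terms is almost the dynamics generated in a larger border. -/
theorem norm_heisenberg_border_sub_le {Φ : Interaction n} {μ c v : ℝ}
    (hLR : IsLiebRobinson Φ μ c v) (hμ : 0 ≤ μ) (hn : ∀ x, 0 < n x) (hN : Φ.bigN < ⊤) {J R : ℝ}
    (hJ : 0 ≤ J) (hΦ : Φ.BoundedBy J) (hR0 : 0 ≤ R) (hR : Φ.HasRange R) {V X : Finset 𝒱}
    {l : ℝ} (hl : R < l) (t : ℝ) :
    ‖heisenberg (hamiltonian Φ V) t (∑ Y ∈ Φ.borderTerms R V X l, Φ.on V Y)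
      - heisenberg (innerHamiltonian Φ V (borderSet R V X (3 * l))) t
        (∑ Y ∈ Φ.borderTerms R V X l, Φ.on V Y)‖ ≤
      |t| * (c * ‖∑ Y ∈ Φ.borderTerms R V X l, Φ.on V Y‖ * J *
        ((borderSet R V X (3 * l)).card * Φ.bigN.toReal) * Real.exp (-μ * (2 * l - R)) *
        Real.exp (μ * v * |t|)) := by
  have hc := hLR.1
  have hv := hLR.2.1
  have hN0 : 0 ≤ Φ.bigN.toReal := ENNReal.toReal_nonneg
  have hmem : ∑ Y ∈ Φ.borderTerms R V X l, Φ.on V Y ∈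
      localAlgebra n (borderSet_subset R V X l) :=
    sum_on_mem Φ _ fun Y hY => subset_borderSet hY
  refine norm_heisenberg_sub_inner_le Φ (borderSet_subset R V X (3 * l))
    (localAlgebra_mono (borderSet_mono R V X (by linarith)) _ _ hmem) fun s hs => ?_
  refine (hLR.norm_commutator_sum_le hμ hn hN hJ hΦ (borderSet_subset R V X l)
    (E := borderSet R V X (3 * l)) (fun Y hY => (mem_crossing.1 hY).1) (fun Y hY => ?_)
    (D := 2 * l - R) (by linarith) (fun Y hY x hx y hy => ?_) hmem s).trans ?_
  · obtain ⟨x, hxY, hx⟩ := Finset.not_disjoint_iff.1 (mem_crossing.1 hY).2.2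
    exact ⟨x, hx, hxY⟩
  -- A term leaving the 3l-border stays at distance 3l − R from each boundary point, while the
  -- border terms live within l of one. The separation 2l − R is what will pay for two Gaussian
  -- averages.
  · obtain ⟨h1, h2, -⟩ := mem_crossing.1 hY
    obtain ⟨hYV, hY0⟩ := Interaction.mem_support.1 h1
    obtain ⟨u, huY, hu⟩ := Finset.not_subset.1 h2
    obtain ⟨-, z, hz, hxz⟩ := mem_borderSet.1 hx
    have h3 : 3 * l ≤ dist u z := by
      by_contra! h
      exact hu (mem_borderSet.2 ⟨hYV huY, z, hz, h⟩)
    have h4 := hR.dist_le hY0 huY hy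
    linarith [dist_triangle u y z, dist_triangle y x z, dist_comm y x]
  · rw [← mul_assoc]
    gcongr

end Geometry

end SpinSystem

namespace SpinSystem

/-! ### The gapped ground state and exact factorisation. -/

section GroundState

variable {𝒱 : Type*} [DecidableEq 𝒱] {n : 𝒱 → ℕ} {V : Finset 𝒱}

theorem projOnto_eq_vecMulVec (ψ : Hilb n V) :
    projOnto ψ = Matrix.vecMulVec ψ.ofLp (star ψ.ofLp) := rfl

theorem star_dotProduct_self {ψ : Hilb n V} (h : ‖ψ‖ = 1) : star ψ.ofLp ⬝ᵥ ψ.ofLp = 1 := by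
  have := inner_self_eq_norm_sq_to_K (𝕜 := ℂ) ψ
  rw [h, EuclideanSpace.inner_eq_star_dotProduct, dotProduct_comm] at this
  simpa using this

theorem IsGappedGroundState.exists_energy {H : Obs n V} (hH : IsSelfAdjoint H) {ψ₀ : Hilb n V}
    {γ : ℝ} (h : IsGappedGroundState H ψ₀ γ) :
    ∃ E₀ : ℝ, H *ᵥ ψ₀.ofLp = (E₀ : ℂ) • ψ₀.ofLp ∧
      (∀ φ : Conf n V → ℂ, H *ᵥ φ = (E₀ : ℂ) • φ → ∃ c : ℂ, φ = c • ψ₀.ofLp) ∧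
      ∀ x ∈ spectrum ℝ (H - (E₀ : ℂ) • 1), x = 0 ∨ γ ≤ x := by
  obtain ⟨h1, -, E₀, h2, h3⟩ := h
  have hvec : ∀ φ : Hilb n V, ∀ E : ℂ, φ ∈ Module.End.eigenspace (Matrix.toEuclideanLin H) E ↔
      H *ᵥ φ.ofLp = E • φ.ofLp := by
    intro φ E
    rw [Module.End.mem_eigenspace_iff, Matrix.toLpLin_apply]
    constructor
    · intro h; simpa using congrArg WithLp.ofLp h
    · intro h; rw [h]; rfl
  refine ⟨E₀, ?_, fun φ hφ => ?_, fun x hx => ?_⟩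
  · rw [← hvec, h2]; exact Submodule.mem_span_singleton_self ψ₀
  · have : WithLp.toLp 2 φ ∈ Module.End.eigenspace (Matrix.toEuclideanLin H) (E₀ : ℂ) := by
      rw [hvec]; exact hφ
    rw [h2, Submodule.mem_span_singleton] at this
    obtain ⟨c, hc⟩ := this
    exact ⟨c, by rw [← WithLp.ofLp_smul, hc]⟩
  · have hE : IsSelfAdjoint ((E₀ : ℂ) • (1 : Obs n V)) := by
      rw [IsSelfAdjoint, star_smul, star_one]; simp
    have hK : (H - (E₀ : ℂ) • 1).IsHermitian := hH.sub hE
    rw [hK.spectrum_real_eq_range_eigenvalues] at hx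
    obtain ⟨i, rfl⟩ := hx
    have h4 := hK.mulVec_eigenvectorBasis i
    rw [Matrix.sub_mulVec, Matrix.smul_mulVec, Matrix.one_mulVec, sub_eq_iff_eq_add] at h4
    have h5 : H *ᵥ (hK.eigenvectorBasis i).ofLp =
        ((hK.eigenvalues i + E₀ : ℝ) : ℂ) • (hK.eigenvectorBasis i).ofLp := by
      rw [h4, Complex.ofReal_add, add_smul]
      exact congrArg₂ (· + ·) (Complex.coe_smul _ _).symm rfl
    by_cases h0 : hK.eigenvalues i = 0
    · exact Or.inl h0
    · right
      have h6 : Module.End.HasEigenvalue (Matrix.toEuclideanLin H)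
          ((hK.eigenvalues i + E₀ : ℝ) : ℂ) :=
        Module.End.hasEigenvalue_of_hasEigenvector
          ⟨(hvec _ _).2 h5, hK.eigenvectorBasis.orthonormal.ne_zero i⟩
      have := h3 _ h6 (by simpa using h0)
      linarith

/-- By uniqueness of the ground state each column of T is a multiple of ψ₀, so T has rank at most
one; self-adjointness and Tψ₀ = ψ₀ fix its other factor. -/
theorem eq_projOnto {H T : Obs n V} {ψ₀ : Hilb n V} (hψ : ‖ψ₀‖ = 1) {E : ℂ}
    (hE : ∀ φ : Conf n V → ℂ, H *ᵥ φ = E • φ → ∃ c : ℂ, φ = c • ψ₀.ofLp)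
    (hT : IsSelfAdjoint T) (hHT : H * T = E • T) (hTψ : T *ᵥ ψ₀.ofLp = ψ₀.ofLp) :
    T = projOnto ψ₀ := by
  have h1 : ∀ j, ∃ c : ℂ, T.col j = c • ψ₀.ofLp := by
    intro j
    refine hE _ ?_
    rw [← Matrix.mulVec_single_one, Matrix.mulVec_mulVec, hHT, Matrix.smul_mulVec]
  choose c hc using h1
  have h2 : T = Matrix.vecMulVec ψ₀.ofLp c := by
    ext i j
    have := congrFun (hc j) i
    rw [Matrix.col_apply] at this
    rw [this, Matrix.vecMulVec_apply, Pi.smul_apply, smul_eq_mul, mul_comm]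
  have h3 : star ψ₀.ofLp ᵥ* T = star ψ₀.ofLp := by
    have := congrArg star hTψ
    rw [Matrix.star_mulVec] at this
    have hT' : Tᴴ = T := hT
    rwa [hT'] at this
  rw [h2, Matrix.vecMul_vecMulVec, star_dotProduct_self hψ, one_smul] at h3
  rw [h2, h3, projOnto_eq_vecMulVec]

theorem projOnto_mul_mul {ψ : Hilb n V} {A : Obs n V} (hA : IsSelfAdjoint A) :
    ∃ a : ℝ, projOnto ψ * A * projOnto ψ = (a : ℂ) • projOnto ψ := by
  have hA' : A.IsHermitian := hA
  refine ⟨(star ψ.ofLp ⬝ᵥ A *ᵥ ψ.ofLp).re, ?_⟩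
  have h1 : ((star ψ.ofLp ⬝ᵥ A *ᵥ ψ.ofLp).re : ℂ) = star ψ.ofLp ⬝ᵥ A *ᵥ ψ.ofLp := by
    apply Complex.ext
    · simp
    · simpa using (hA'.im_star_dotProduct_mulVec_self ψ.ofLp).symm
  rw [h1, projOnto_eq_vecMulVec, mul_assoc, Matrix.mul_vecMulVec, Matrix.vecMulVec_mul_vecMulVec,
    Matrix.vecMulVec_smul]

/-- A self-adjoint element of a local algebra has local spectral projections. -/
theorem exists_local_spectral_projection (hn : ∀ x, 0 < n x) {X : Finset 𝒱} (hX : X ⊆ V)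
    {M : Obs n V} (hM : IsSelfAdjoint M) (hMX : M ∈ localAlgebra n hX) {δ : ℝ} (hδ : 0 ≤ δ) :
    ∃ (p : Obs n X) (r : Obs n V), IsStarProjection p ∧ ‖M * embed hX p‖ ≤ δ ∧
      1 - embed hX p = r * M ∧ δ * ‖r‖ ≤ 1 := by
  obtain ⟨m, rfl⟩ := hMX
  have hm : IsSelfAdjoint m := by
    refine embed_injective hn hX ?_
    rw [embed_star]
    exact hM
  obtain ⟨p, r, hp, h1, h2, h3⟩ := exists_spectral_projection hm Matrix.finite_real_spectrum hδ
  refine ⟨p, embed hX r, hp, ?_, ?_, ?_⟩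
  · change ‖embed hX m * embed hX p‖ ≤ δ
    rw [← embed_mul]
    exact (norm_embed_le hX _).trans h1
  · change 1 - embed hX p = embed hX r * embed hX m
    rw [← embed_mul, ← h2, ← embed_one hX]
    exact (map_sub (embedHom n hX) 1 p).symm
  · exact (mul_le_mul_of_nonneg_left (norm_embed_le hX r) hδ).trans h3

theorem isStarProjection_embed {X : Finset 𝒱} (hX : X ⊆ V) {p : Obs n X}
    (hp : IsStarProjection p) : IsStarProjection (embed hX p) :=
  ⟨by rw [IsIdempotentElem, ← embed_mul, hp.isIdempotentElem.eq],
    by rw [IsSelfAdjoint, ← embed_star, hp.isSelfAdjoint.star_eq]⟩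

theorem isSelfAdjoint_real_smul_one (a : ℝ) : IsSelfAdjoint ((a : ℂ) • (1 : Obs n V)) := by
  rw [IsSelfAdjoint, star_smul, star_one]; simp

/-- When no term couples `X` to its complement, the ground state projection factorises. -/
theorem exists_factorization_of_decoupled (hn : ∀ x, 0 < n x) {X Y : Finset 𝒱} (hX : X ⊆ V)
    (hY : Y ⊆ V) (hd : Disjoint X Y) {A B : Obs n V} (hA : IsSelfAdjoint A) (hB : IsSelfAdjoint B)
    (hAX : A ∈ localAlgebra n hX) (hBY : B ∈ localAlgebra n hY) {ψ₀ : Hilb n V} {γ : ℝ}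
    (h : IsGappedGroundState (A + B) ψ₀ γ) :
    ∃ (p : Obs n X) (q : Obs n Y), IsStarProjection p ∧ IsStarProjection q ∧
      embed hX p * embed hY q = projOnto ψ₀ := by
  have hψ := h.1
  obtain ⟨E₀, hE, huniq, -⟩ := h.exists_energy (hA.add hB)
  have hψ1 := star_dotProduct_self hψ
  have hAB : Commute A B := commute_of_mem_localAlgebra hd hAX hBY
  -- An operator commuting with the Hamiltonian preserves the one-dimensional ground space, so ψ₀ is
  -- an eigenvector of A and of B separately. The projections below are taken with δ = 0, onto these
  -- eigenspaces.
  have heig : ∀ C : Obs n V, IsSelfAdjoint C → Commute C (A + B) →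
      ∃ a : ℝ, C *ᵥ ψ₀.ofLp = (a : ℂ) • ψ₀.ofLp := by
    intro C hC hcomm
    obtain ⟨a, ha⟩ := huniq (C *ᵥ ψ₀.ofLp) (by
      rw [Matrix.mulVec_mulVec, ← hcomm.eq, ← Matrix.mulVec_mulVec, hE, Matrix.mulVec_smul])
    have hC' : C.IsHermitian := hC
    have him := hC'.im_star_dotProduct_mulVec_self ψ₀.ofLp
    rw [ha, dotProduct_smul, hψ1, smul_eq_mul, mul_one] at him
    refine ⟨a.re, ?_⟩
    rw [ha]
    congr 1
    apply Complex.ext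
    · simp
    · simpa using him
  obtain ⟨a, ha⟩ := heig A hA ((Commute.refl A).add_right hAB)
  obtain ⟨b, hb⟩ := heig B hB (hAB.symm.add_right (Commute.refl B))
  obtain ⟨p, r, hp, hp1, hp2, -⟩ := exists_local_spectral_projection hn hX
    (hA.sub (isSelfAdjoint_real_smul_one a))
    (sub_mem hAX ((localAlgebra n hX).smul_mem (one_mem _) (a : ℂ))) le_rfl
  obtain ⟨q, s, hq, hq1, hq2, -⟩ := exists_local_spectral_projection hn hY
    (hB.sub (isSelfAdjoint_real_smul_one b))
    (sub_mem hBY ((localAlgebra n hY).smul_mem (one_mem _) (b : ℂ))) le_rfl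
  refine ⟨p, q, hp, hq, ?_⟩
  have hP := isStarProjection_embed hX hp
  have hQ := isStarProjection_embed hY hq
  have hPQ : Commute (embed hX p) (embed hY q) := commute_embed hX hY hd p q
  set P := embed hX p
  set Q := embed hY q
  have hAP : A * P = (a : ℂ) • P := by
    have := norm_le_zero_iff.1 hp1
    rwa [sub_mul, smul_one_mul, sub_eq_zero] at this
  have hBQ : B * Q = (b : ℂ) • Q := by
    have := norm_le_zero_iff.1 hq1
    rwa [sub_mul, smul_one_mul, sub_eq_zero] at this
  have hPψ : P *ᵥ ψ₀.ofLp = ψ₀.ofLp := by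
    have h1 : (1 - P) *ᵥ ψ₀.ofLp = 0 := by
      rw [hp2, ← Matrix.mulVec_mulVec, Matrix.sub_mulVec, Matrix.smul_mulVec, Matrix.one_mulVec, ha,
        sub_self, Matrix.mulVec_zero]
    rw [Matrix.sub_mulVec, Matrix.one_mulVec, sub_eq_zero] at h1
    exact h1.symm
  have hQψ : Q *ᵥ ψ₀.ofLp = ψ₀.ofLp := by
    have h1 : (1 - Q) *ᵥ ψ₀.ofLp = 0 := by
      rw [hq2, ← Matrix.mulVec_mulVec, Matrix.sub_mulVec, Matrix.smul_mulVec, Matrix.one_mulVec, hb,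
        sub_self, Matrix.mulVec_zero]
    rw [Matrix.sub_mulVec, Matrix.one_mulVec, sub_eq_zero] at h1
    exact h1.symm
  have hE' : (E₀ : ℂ) • ψ₀.ofLp = ((a : ℂ) + b) • ψ₀.ofLp := by
    rw [← hE, Matrix.add_mulVec, ha, hb, add_smul]
  have hEab : (E₀ : ℂ) = (a : ℂ) + b := by
    have := congrArg (fun φ => star ψ₀.ofLp ⬝ᵥ φ) hE'
    simpa only [dotProduct_smul, hψ1, smul_eq_mul, mul_one] using this
  refine eq_projOnto hψ huniq ?_ ?_ ?_
  · rw [IsSelfAdjoint, star_mul, hP.isSelfAdjoint.star_eq, hQ.isSelfAdjoint.star_eq, hPQ.eq]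
  · have h1 : B * (P * Q) = (b : ℂ) • (P * Q) := by
      rw [hPQ.eq, ← mul_assoc, hBQ, smul_mul_assoc]
    rw [add_mul, h1, ← mul_assoc, hAP, smul_mul_assoc, hEab, add_smul]
  · rw [← Matrix.mulVec_mulVec, hQψ, hPψ]

end GroundState

end SpinSystem

namespace SpinSystem

/-! ### The approximation at a fixed scale. -/

section Main

open MeasureTheory ProbabilityTheory
open scoped NNReal

variable {𝒱 : Type*} [DecidableEq 𝒱] [MetricSpace 𝒱] {n : 𝒱 → ℕ}

/-- The Gaussian bound for `∫ e^{b|t|}`. -/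
noncomputable def gaussBound (w : ℝ≥0) (b : ℝ) : ℝ := 2 * Real.exp (w * b ^ 2 / 2)

theorem gaussBound_nonneg (w : ℝ≥0) (b : ℝ) : 0 ≤ gaussBound w b := by
  unfold gaussBound; positivity

/-- A local projection on one side of the boundary that almost fixes the ground state. -/
theorem exists_side_projection {Φ : Interaction n} {μ c v : ℝ}
    (hLR : IsLiebRobinson Φ μ c v) (hμ : 0 ≤ μ) (hn : ∀ x, 0 < n x) (hN : Φ.bigN < ⊤) {J R : ℝ}
    (hJ : 0 ≤ J) (hΦ : Φ.BoundedBy J) (hR0 : 0 ≤ R) (hR : Φ.HasRange R) {V G E : Finset 𝒱}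
    (hG : G ⊆ V) (hE : ∀ Y ∈ Φ.crossing V G, ∃ x ∈ E, x ∈ Y) {l : ℝ} (hl0 : 0 < l)
    (hl : 3 * R < l) {n₁ : ℝ}
    (hn₁ : 2 * J ^ 2 * Φ.bigC.toReal * Φ.bigN.toReal * (bdry R V (farPart E G l)).card ≤ n₁)
    {k p₀ r₀ : Obs n V} {E₀ : ℂ} (hkH : k = hamiltonian Φ V - E₀ • 1) (hk : IsSelfAdjoint k)
    (hkp : k * p₀ = 0) {w : ℝ≥0}
    (hr₀ : ∫ t, propagator k t ∂(gaussianReal 0 w) - p₀ = r₀ * k) (hp₀ : ‖p₀‖ ≤ 1) {e : ℝ}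
    (he : ‖r₀‖ ≤ e) {a : ℝ}
    (ha : p₀ * (∑ Y ∈ Φ.meeting V (farPart E G l), Φ.on V Y) * p₀ = (a : ℂ) • p₀)
    {δ : ℝ} (hδ : 0 ≤ δ) {ε : ℝ}
    (hε : ε = 2 * l ^ 2 * (c * n₁ * J * (E.card * Φ.bigN.toReal) * Real.exp (-μ * (l - 3 * R))) *
      gaussBound w (μ * v + 1 / l)) :
    ∃ (p : Obs n G) (m r : Obs n V), IsStarProjection p ∧ ‖m * embed hG p‖ ≤ δ ∧
      1 - embed hG p = r * m ∧ δ * ‖r‖ ≤ 1 ∧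
      ‖smear w k (∑ Y ∈ Φ.meeting V (farPart E G l), Φ.on V Y) - (a : ℂ) • 1 - m‖ ≤ ε ∧
      ‖m * p₀‖ ≤ ε + e * n₁ := by
  set A := ∑ Y ∈ Φ.meeting V (farPart E G l), Φ.on V Y with hA
  have hAs : IsSelfAdjoint A := isSelfAdjoint_sum_on Φ V _
  have hAG : A ∈ localAlgebra n hG := sum_meeting_mem hR hG hE (by linarith)
  have hH := isSelfAdjoint_hamiltonian Φ V
  have hin := isSelfAdjoint_innerHamiltonian Φ V G
  have hcomm : ‖hamiltonian Φ V * A - A * hamiltonian Φ V‖ ≤ n₁ :=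
    (norm_commutator_meeting_le Φ hN hJ hΦ hR V (farPart E G l)).trans hn₁
  have hn0 : 0 ≤ n₁ := (norm_nonneg _).trans hcomm
  have hsm : smear w k A = smear w (hamiltonian Φ V) A := by
    simp only [smear, hkH, heisenberg_sub_smul_one]
  have hdiff : ‖smear w k A - smear w (innerHamiltonian Φ V G) A‖ ≤ ε := by
    rw [hsm, hε]
    have hc := hLR.1
    have hN0 : 0 ≤ Φ.bigN.toReal := ENNReal.toReal_nonneg
    have h0 : 0 ≤ c * n₁ * J * (E.card * Φ.bigN.toReal) * Real.exp (-μ * (l - 3 * R)) :=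
      mul_nonneg (mul_nonneg (mul_nonneg (mul_nonneg hc.le hn0) hJ)
        (mul_nonneg (Nat.cast_nonneg _) hN0)) (Real.exp_pos _).le
    exact norm_smear_sub_smear_le hH hin h0 hl0
      (norm_heisenberg_meeting_sub_le hLR hμ hn hN hJ hΦ hR0 hR hG hE hl hcomm)
  -- Averaging with the inner dynamics puts m exactly in the algebra of G, so its spectral
  -- projections are local as well.
  set m := smear w (innerHamiltonian Φ V G) A - (a : ℂ) • 1 with hm
  have hms : IsSelfAdjoint m := (isSelfAdjoint_smear hin hAs w).sub (isSelfAdjoint_real_smul_one a)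
  have hmG : m ∈ localAlgebra n hG :=
    sub_mem (smear_mem hin (innerHamiltonian_mem Φ hG) hAG w)
      ((localAlgebra n hG).smul_mem (one_mem _) (a : ℂ))
  obtain ⟨p, r, hp, h1, h2, h3⟩ := exists_local_spectral_projection hn hG hms hmG hδ
  have hclose : ‖smear w k A - (a : ℂ) • 1 - m‖ ≤ ε := by
    rw [hm, sub_sub_sub_cancel_right]
    exact hdiff
  refine ⟨p, m, r, hp, h1, h2, h3, hclose, ?_⟩
  have hkA : k * A - A * k = hamiltonian Φ V * A - A * hamiltonian Φ V := by
    rw [hkH, sub_mul, mul_sub, smul_one_mul, mul_smul_one]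
    abel
  have h4 := norm_smear_sub_mul_le hk hkp hr₀ ha hp₀ he
  rw [hkA] at h4
  have he0 : 0 ≤ e := (norm_nonneg _).trans he
  have h5 : m * p₀ = (smear w k A - (a : ℂ) • 1) * p₀ - (smear w k A - (a : ℂ) • 1 - m) * p₀ := by
    noncomm_ring
  have h6 : ‖(smear w k A - (a : ℂ) • 1 - m) * p₀‖ ≤ ε * 1 :=
    (norm_mul_le _ _).trans (mul_le_mul hclose hp₀ (norm_nonneg _) ((norm_nonneg _).trans hclose))
  have h7 : e * ‖hamiltonian Φ V * A - A * hamiltonian Φ V‖ ≤ e * n₁ :=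
    mul_le_mul_of_nonneg_left hcomm he0
  rw [h5]
  refine (norm_sub_le _ _).trans ?_
  linarith

/-- The variance w and the spectral cutoff δ are left free here; they are balanced only when the
constants are estimated. -/
theorem exists_approximation {Φ : Interaction n} {μ c v : ℝ}
    (hLR : IsLiebRobinson Φ μ c v) (hμ : 0 ≤ μ) (hn : ∀ x, 0 < n x) (hN : Φ.bigN < ⊤) {J R : ℝ}
    (hJ : 0 ≤ J) (hΦ : Φ.BoundedBy J) (hR0 : 0 ≤ R) (hR : Φ.HasRange R) {V 𝒳 : Finset 𝒱}
    {ψ₀ : Hilb n V} {γ : ℝ} (hgs : IsGappedGroundState (hamiltonian Φ V) ψ₀ γ) (h𝒳 : 𝒳 ⊆ V)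
    {l : ℝ} (hl0 : 0 < l) (hl : 3 * R < l) {n₁ nB : ℝ}
    (hint : 2 * J ^ 2 * Φ.bigC.toReal * Φ.bigN.toReal *
      (bdry R V (interiorSet R V 𝒳 l)).card ≤ n₁)
    (hext : 2 * J ^ 2 * Φ.bigC.toReal * Φ.bigN.toReal *
      (bdry R V (exteriorSet R V 𝒳 l)).card ≤ n₁)
    (hnB : ((borderSet R V 𝒳 l).card * Φ.bigC.toReal + 1) * J ≤ nB)
    {δ : ℝ} (hδ : 0 < δ) (w : ℝ≥0) {ε e₁ M : ℝ}
    (hε : ε = 2 * l ^ 2 * (c * n₁ * J * ((bdry R V 𝒳).card * Φ.bigN.toReal) *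
      Real.exp (-μ * (l - 3 * R))) * gaussBound w (μ * v + 1 / l))
    (he₁ : e₁ = Real.exp (-(w * γ ^ 2 / 2)))
    (hM : c * nB * J * ((borderSet R V 𝒳 (3 * l)).card * Φ.bigN.toReal) *
      Real.exp (-μ * (2 * l - R)) ≤ M) :
    ∃ (p : Obs n 𝒳) (q : Obs n (V \ 𝒳)) (b : Obs n (borderSet R V 𝒳 (3 * l))),
      IsStarProjection p ∧ IsStarProjection q ∧ ‖b‖ ≤ 1 ∧
      ‖embed (borderSet_subset R V 𝒳 (3 * l)) b * embed h𝒳 p * embed Finset.sdiff_subset q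
        - projOnto ψ₀‖ ≤
        e₁ + l * (l * M * gaussBound w (μ * v + 1 / l)) * gaussBound w (μ * v + 1 / l + 1 / l)
          + l * gaussBound w (1 / l) * (2 * ε + 2 * δ) + 2 * ((ε + e₁ / γ * n₁) / δ) := by
  have hγ := hgs.2.1
  have hψ := hgs.1
  have hc := hLR.1
  have hv := hLR.2.1
  have hN0 : 0 ≤ Φ.bigN.toReal := ENNReal.toReal_nonneg
  have hH := isSelfAdjoint_hamiltonian Φ V
  obtain ⟨E₀, hE, huniq, hgap⟩ := hgs.exists_energy hH
  have hk : IsSelfAdjoint (hamiltonian Φ V - (E₀ : ℂ) • 1) :=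
    hH.sub (isSelfAdjoint_real_smul_one E₀)
  obtain ⟨p₀, s₀, r₀, hp₀, hkp, hs₀, hr₀, hF, hr₀n⟩ :=
    exists_kernel_projection hk Matrix.finite_real_spectrum hγ hgap w
  have hproj : IsStarProjection p₀ := by
    refine ⟨?_, hp₀⟩
    have h1 : (1 - p₀) * p₀ = 0 := by rw [hs₀, mul_assoc, hkp, mul_zero]
    rw [sub_mul, one_mul, sub_eq_zero] at h1
    exact h1.symm
  have hp₀1 := norm_le_one_of_isStarProjection hproj
  have hp₀ψ : p₀ = projOnto ψ₀ := by
    refine eq_projOnto hψ huniq hp₀ ?_ ?_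
    · rwa [sub_mul, smul_one_mul, sub_eq_zero] at hkp
    · have h1 : (1 - p₀) *ᵥ ψ₀.ofLp = 0 := by
        rw [hs₀, ← Matrix.mulVec_mulVec, Matrix.sub_mulVec, Matrix.smul_mulVec, Matrix.one_mulVec,
          hE, sub_self, Matrix.mulVec_zero]
      rw [Matrix.sub_mulVec, Matrix.one_mulVec, sub_eq_zero] at h1
      exact h1.symm
  have hsum := hamiltonian_eq_add_add hR V 𝒳 (l := l) (by linarith)
  obtain ⟨a₁, ha₁⟩ := projOnto_mul_mul (ψ := ψ₀)
    (isSelfAdjoint_sum_on Φ V (Φ.meeting V (farPart (bdry R V 𝒳) 𝒳 l)))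
  obtain ⟨a₂, ha₂⟩ := projOnto_mul_mul (ψ := ψ₀)
    (isSelfAdjoint_sum_on Φ V (Φ.meeting V (farPart (bdry R V 𝒳) (V \ 𝒳) l)))
  rw [← hp₀ψ] at ha₁ ha₂
  rw [interiorSet_eq] at hint
  rw [exteriorSet_eq] at hext
  rw [← he₁] at hF hr₀n
  obtain ⟨p, m₁, r₁, hp, hm₁, hr₁, hrδ₁, hs₁, hmp₁⟩ := exists_side_projection hLR hμ hn hN hJ hΦ
    hR0 hR h𝒳 (fun Y hY => exists_mem_bdry_of_crossing hR hY) hl0 hl hint rfl hk hkp hr₀ hp₀1 hr₀n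
    ha₁ hδ.le hε
  obtain ⟨q, m₂, r₂, hq, hm₂, hr₂, hrδ₂, hs₂, hmp₂⟩ := exists_side_projection hLR hμ hn hN hJ hΦ
    hR0 hR Finset.sdiff_subset
    (fun Y hY => exists_mem_bdry_of_crossing hR (crossing_sdiff Φ hY)) hl0 hl hext rfl hk hkp hr₀
    hp₀1 hr₀n ha₂ hδ.le hε
  have hbd := fun t => norm_heisenberg_border_sub_le hLR hμ hn hN hJ hΦ hR0 hR (V := V) (X := 𝒳)
    (l := l) (by linarith) t
  have hB₁ := (norm_sum_borderTerms_le Φ hN hJ hΦ R V 𝒳 l).trans hnB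
  set Λ := borderSet R V 𝒳 (3 * l) with hΛ
  have hΛV : Λ ⊆ V := borderSet_subset R V 𝒳 (3 * l)
  have hBs : IsSelfAdjoint (∑ Y ∈ Φ.borderTerms R V 𝒳 l, Φ.on V Y) := isSelfAdjoint_sum_on Φ V _
  have hBΛ : ∑ Y ∈ Φ.borderTerms R V 𝒳 l, Φ.on V Y ∈ localAlgebra n hΛV :=
    sum_on_mem Φ _ fun Y hY => (subset_borderSet hY).trans (borderSet_mono R V 𝒳 (by linarith))
  generalize ∑ Y ∈ Φ.borderTerms R V 𝒳 l, Φ.on V Y = B at *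
  generalize ∑ Y ∈ Φ.meeting V (farPart (bdry R V 𝒳) 𝒳 l), Φ.on V Y = A₁ at *
  generalize ∑ Y ∈ Φ.meeting V (farPart (bdry R V 𝒳) (V \ 𝒳) l), Φ.on V Y = A₂ at *
  have hinΛ := isSelfAdjoint_innerHamiltonian Φ V Λ
  have hinΛmem := innerHamiltonian_mem Φ hΛV
  generalize innerHamiltonian Φ V Λ = L at *
  set k := hamiltonian Φ V - (E₀ : ℂ) • 1 with hkdef
  -- The scalar is chosen so that k − D is the sum of the two centred averages, each of which almost
  -- annihilates the ground state.
  set D := smear w k B - ((E₀ - a₁ - a₂ : ℝ) : ℂ) • (1 : Obs n V) with hD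
  set D' := smear w L B - ((E₀ - a₁ - a₂ : ℝ) : ℂ) • (1 : Obs n V) with hD'
  have hDs : IsSelfAdjoint D := (isSelfAdjoint_smear hk hBs w).sub (isSelfAdjoint_real_smul_one _)
  have hD's : IsSelfAdjoint D' :=
    (isSelfAdjoint_smear hinΛ hBs w).sub (isSelfAdjoint_real_smul_one _)
  have hkD : k - D = (smear w k A₁ - (a₁ : ℂ) • 1) + (smear w k A₂ - (a₂ : ℂ) • 1) := by
    have h1 : smear w k (hamiltonian Φ V) = hamiltonian Φ V := by
      refine smear_of_commute ?_ w
      rw [hkdef]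
      exact (Commute.refl _).sub_left ((Commute.one_left _).smul_left _)
    have h2 : hamiltonian Φ V = smear w k A₁ + smear w k A₂ + smear w k B := by
      rw [← smear_add hk, ← smear_add hk, ← hsum, h1]
    have h3 : k = smear w k A₁ + smear w k A₂ + smear w k B - (E₀ : ℂ) • 1 := by rw [← h2]
    calc k - D = smear w k A₁ + smear w k A₂ + smear w k B - (E₀ : ℂ) • 1
          - (smear w k B - ((E₀ - a₁ - a₂ : ℝ) : ℂ) • (1 : Obs n V)) := by rw [← h3]
      _ = _ := by
        push_cast
        rw [sub_smul, sub_smul]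
        abel
  have hM0 : 0 ≤ M := by
    refine le_trans ?_ hM
    have hnB0 : 0 ≤ nB := (norm_nonneg B).trans hB₁
    exact mul_nonneg (mul_nonneg (mul_nonneg (mul_nonneg hc.le hnB0) hJ)
      (mul_nonneg (Nat.cast_nonneg _) hN0)) (Real.exp_pos _).le
  have hbd' : ∀ t, ‖heisenberg k t B - heisenberg L t B‖ ≤
      |t| * (M * Real.exp (μ * v * |t|)) := by
    intro t
    rw [hkdef, heisenberg_sub_smul_one]
    refine (hbd t).trans ?_
    refine mul_le_mul_of_nonneg_left (mul_le_mul_of_nonneg_right (le_trans ?_ hM)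
      (Real.exp_pos _).le) (abs_nonneg t)
    refine mul_le_mul_of_nonneg_right (mul_le_mul_of_nonneg_right (mul_le_mul_of_nonneg_right
      (mul_le_mul_of_nonneg_left hB₁ hc.le) hJ) (mul_nonneg (Nat.cast_nonneg _) hN0))
      (Real.exp_pos _).le
  have hη : ∀ t s, |s| ≤ |t| → ‖heisenberg k s D - heisenberg L s D'‖ ≤
      (l * M * gaussBound w (μ * v + 1 / l)) * Real.exp ((μ * v + 1 / l) * |t|) := by
    intro t s hst
    have h1 := heisenberg_smear_sub_le hk hinΛ (v := w) hM0 (mul_nonneg hμ hv.le) hl0 hbd' t s hst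
    rw [hD, hD', heisenberg_sub, heisenberg_sub, heisenberg_smul, heisenberg_smul, heisenberg_one,
      heisenberg_one, sub_sub_sub_cancel_right]
    refine h1.trans (le_of_eq ?_)
    rw [gaussBound]; ring
  have hg0 := gaussBound_nonneg w (μ * v + 1 / l)
  obtain ⟨hηi, hηe⟩ := integrable_abs_mul_exp w (b := μ * v + 1 / l) hl0
    (mul_nonneg (mul_nonneg hl0.le hM0) hg0)
  have hP := isStarProjection_embed h𝒳 hp
  have hQ := isStarProjection_embed (Finset.sdiff_subset (s := V) (t := 𝒳)) hq
  have hPQ : Commute (embed h𝒳 p) (embed Finset.sdiff_subset q) :=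
    commute_embed h𝒳 _ Finset.disjoint_sdiff p q
  have hmain := norm_averagedPropagator_mul_sub_le (v := w) hk hDs rfl hkD hinΛ hD's hp₀ hP hQ hPQ
    hδ hs₁ hs₂ hm₁ hm₂ hr₁ hr₂ hrδ₁ hrδ₂ hmp₁ hmp₂ hF (integral_abs_gaussianReal_le w hl0) hη hηi hηe
  have hD'mem : D' ∈ localAlgebra n hΛV :=
    sub_mem (smear_mem hinΛ hinΛmem hBΛ w)
      ((localAlgebra n hΛV).smul_mem (one_mem _) (((E₀ - a₁ - a₂ : ℝ) : ℂ)))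
  -- Both L and D' live on the 3l-border, hence so does the averaged interaction-picture propagator,
  -- the border observable.
  have hbmem : averagedPropagator w L D' ∈ localAlgebra n hΛV :=
    integral_mem_localAlgebra (integrable_interaction_picture hinΛ hD's w) fun t =>
      mul_mem (propagator_mem hinΛmem t) (propagator_mem (sub_mem hinΛmem hD'mem) (-t))
  obtain ⟨b, hb⟩ := mem_localAlgebra.1 hbmem
  refine ⟨p, q, b, hp, hq, ?_, ?_⟩
  · rw [← norm_embed hn hΛV b, hb]
    exact norm_averagedPropagator_le hinΛ hD's w
  · rw [hb, ← hp₀ψ]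
    exact hmain

end Main

end SpinSystem

namespace SpinSystem

/-! ### Balancing the scales and collecting the constants. -/

section Constants

open scoped NNReal

/-- Half of the exponential pays for the surplus l^{1/2}, which for l > R is at most l/R^{1/2}. -/
theorem pow_four_mul_exp_le {R ξ l : ℝ} (hR : 0 < R) (hξ : 0 < ξ) (hl : R < l) :
    l ^ 4 * Real.exp (-(l / ξ)) ≤
      2 * ξ / R ^ (1 / 2 : ℝ) * (l ^ (7 / 2 : ℝ) * Real.exp (-(l / (2 * ξ)))) := by
  have hl0 : 0 < l := hR.trans hl
  have h1 : l ^ 4 = l ^ (7 / 2 : ℝ) * l ^ (1 / 2 : ℝ) := by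
    rw [← Real.rpow_add hl0, ← Real.rpow_natCast]; norm_num
  have h2 : l = l ^ (1 / 2 : ℝ) * l ^ (1 / 2 : ℝ) := by
    rw [← Real.rpow_add hl0]; norm_num
  have h3 : R ^ (1 / 2 : ℝ) ≤ l ^ (1 / 2 : ℝ) := Real.rpow_le_rpow hR.le hl.le (by norm_num)
  have hRp : 0 < R ^ (1 / 2 : ℝ) := Real.rpow_pos_of_pos hR _
  have hlp : 0 < l ^ (1 / 2 : ℝ) := Real.rpow_pos_of_pos hl0 _
  have h4 : l ≤ 2 * ξ * Real.exp (l / (2 * ξ)) := by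
    have := Real.add_one_le_exp (l / (2 * ξ))
    calc l = 2 * ξ * (l / (2 * ξ)) := by field_simp
      _ ≤ _ := by gcongr; linarith
  have h5 : l ^ (1 / 2 : ℝ) ≤ 2 * ξ / R ^ (1 / 2 : ℝ) * Real.exp (l / (2 * ξ)) := by
    rw [div_mul_eq_mul_div, le_div_iff₀ hRp]
    refine le_trans ?_ h4
    conv_rhs => rw [h2]
    gcongr
  have h6 : Real.exp (-(l / ξ)) = Real.exp (-(l / (2 * ξ))) * Real.exp (-(l / (2 * ξ))) := by
    rw [← Real.exp_add]; congr 1; field_simp; ring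
  have h7 : Real.exp (l / (2 * ξ)) * Real.exp (-(l / (2 * ξ))) = 1 := by
    rw [← Real.exp_add]; simp
  calc l ^ 4 * Real.exp (-(l / ξ))
      = l ^ (7 / 2 : ℝ) * l ^ (1 / 2 : ℝ) *
        (Real.exp (-(l / (2 * ξ))) * Real.exp (-(l / (2 * ξ)))) := by rw [h1, h6]
    _ ≤ l ^ (7 / 2 : ℝ) * (2 * ξ / R ^ (1 / 2 : ℝ) * Real.exp (l / (2 * ξ))) *
        (Real.exp (-(l / (2 * ξ))) * Real.exp (-(l / (2 * ξ)))) := by gcongr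
    _ = 2 * ξ / R ^ (1 / 2 : ℝ) * l ^ (7 / 2 : ℝ) * (Real.exp (l / (2 * ξ)) *
        Real.exp (-(l / (2 * ξ)))) * Real.exp (-(l / (2 * ξ))) := by ring
    _ = _ := by rw [h7]; ring

theorem exists_polynomial_bound {R c₁ d₁ c₂ k₁ k₂ : ℝ} (hR : 0 < R) (hc₁ : 0 ≤ c₁) (hd₁ : 0 ≤ d₁)
    (hc₂ : 0 ≤ c₂) (hk₁ : 0 ≤ k₁) (hk₂ : 0 ≤ k₂) :
    ∃ K : ℝ, 0 ≤ K ∧ ∀ l m ρ : ℝ, R < l → 1 ≤ m → 0 < ρ → ρ ≤ 1 →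
      ρ ^ 2 + c₁ * l ^ 2 * ((l * m + d₁) * (l * m)) * ρ ^ 4
        + c₂ * l * (2 * (k₁ * l ^ 3 * m ^ 2 * ρ ^ 2) + 2 * ρ)
        + 2 * (k₁ * l ^ 3 * m ^ 2 * ρ + k₂ * l * m * ρ) ≤ K * m ^ 2 * (l ^ 4 * ρ) := by
  refine ⟨1 / R ^ 4 + c₁ * (1 + d₁ / R) + c₂ * (2 * k₁ + 2 / R ^ 3) + 2 * (k₁ / R + k₂ / R ^ 3),
    by positivity, ?_⟩
  intro l m ρ hl hm hρ hρ1
  have hl0 : 0 < l := hR.trans hl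
  have hr : 1 ≤ l / R := (one_le_div hR).2 hl.le
  have hp1 : 1 ≤ l ^ 4 / R ^ 4 := by rw [← div_pow]; exact one_le_pow₀ hr
  have hp2 : l ≤ l ^ 4 / R ^ 3 := by
    have : l ^ 4 / R ^ 3 = l * (l / R) ^ 3 := by field_simp
    rw [this]; exact le_mul_of_one_le_right hl0.le (one_le_pow₀ hr)
  have hp3 : l ^ 3 ≤ l ^ 4 / R := by
    have : l ^ 4 / R = l ^ 3 * (l / R) := by field_simp
    rw [this]; exact le_mul_of_one_le_right (by positivity) hr
  have hm2 : m ≤ m ^ 2 := by nlinarith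
  have hm1 : 1 ≤ m ^ 2 := by nlinarith
  have hρ2 : ρ ^ 2 ≤ ρ := by nlinarith
  have hρ4 : ρ ^ 4 ≤ ρ := by nlinarith [pow_le_one₀ hρ.le hρ1 (n := 3)]
  have t1 : ρ ^ 2 ≤ 1 / R ^ 4 * (m ^ 2 * (l ^ 4 * ρ)) := by
    calc ρ ^ 2 ≤ 1 * (1 * ρ) := by linarith
      _ ≤ m ^ 2 * (l ^ 4 / R ^ 4 * ρ) := by gcongr
      _ = _ := by ring
  have t2 : c₁ * l ^ 2 * ((l * m + d₁) * (l * m)) * ρ ^ 4 ≤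
      c₁ * (1 + d₁ / R) * (m ^ 2 * (l ^ 4 * ρ)) := by
    calc c₁ * l ^ 2 * ((l * m + d₁) * (l * m)) * ρ ^ 4
        = c₁ * (l ^ 4 * m ^ 2 + d₁ * (l ^ 3 * m)) * ρ ^ 4 := by ring
      _ ≤ c₁ * (l ^ 4 * m ^ 2 + d₁ * (l ^ 4 / R * m ^ 2)) * ρ := by gcongr
      _ = _ := by ring
  have t3 : c₂ * l * (2 * (k₁ * l ^ 3 * m ^ 2 * ρ ^ 2) + 2 * ρ) ≤
      c₂ * (2 * k₁ + 2 / R ^ 3) * (m ^ 2 * (l ^ 4 * ρ)) := by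
    calc c₂ * l * (2 * (k₁ * l ^ 3 * m ^ 2 * ρ ^ 2) + 2 * ρ)
        = c₂ * (2 * (k₁ * l ^ 4 * m ^ 2 * ρ ^ 2) + 2 * (1 * l * ρ)) := by ring
      _ ≤ c₂ * (2 * (k₁ * l ^ 4 * m ^ 2 * ρ) + 2 * (m ^ 2 * (l ^ 4 / R ^ 3) * ρ)) := by gcongr
      _ = _ := by ring
  have t4 : 2 * (k₁ * l ^ 3 * m ^ 2 * ρ + k₂ * l * m * ρ) ≤
      2 * (k₁ / R + k₂ / R ^ 3) * (m ^ 2 * (l ^ 4 * ρ)) := by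
    calc 2 * (k₁ * l ^ 3 * m ^ 2 * ρ + k₂ * l * m * ρ)
        ≤ 2 * (k₁ * (l ^ 4 / R) * m ^ 2 * ρ + k₂ * (l ^ 4 / R ^ 3) * m ^ 2 * ρ) := by gcongr
      _ = _ := by ring
  refine (add_le_add (add_le_add (add_le_add t1 t2) t3) t4).trans (le_of_eq ?_)
  ring

/-- The error bound of `exists_approximation` for the choice of scales
`w = 2 μ l / (μ² v² + γ²)` and `δ = e^{-l/ξ}`. -/
noncomputable def totalError (J CΦ NΦ μ c v γ R C l m : ℝ) : ℝ :=
  let w : ℝ≥0 := (2 * μ * l / (μ ^ 2 * v ^ 2 + γ ^ 2)).toNNReal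
  let δ : ℝ := Real.exp (-(l / xi μ v γ))
  let n₁ : ℝ := 2 * J ^ 2 * CΦ * NΦ * (C * l * m)
  let nB : ℝ := (C * l * m * CΦ + 1) * J
  let e₁ : ℝ := Real.exp (-(w * γ ^ 2 / 2))
  let ε : ℝ := 2 * l ^ 2 * (c * n₁ * J * (m * NΦ) * Real.exp (-μ * (l - 3 * R))) *
    gaussBound w (μ * v + 1 / l)
  let M : ℝ := c * nB * J * (C * (3 * l) * m * NΦ) * Real.exp (-μ * (2 * l - R))
  e₁ + l * (l * M * gaussBound w (μ * v + 1 / l)) * gaussBound w (μ * v + 1 / l + 1 / l)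
    + l * gaussBound w (1 / l) * (2 * ε + 2 * δ) + 2 * ((ε + e₁ / γ * n₁) / δ)

/-- The variance is proportional to l, so raising the rate from μv to μv + 2/l changes the exponent
only by a bounded amount for l > R. -/
theorem gaussBound_le {μ v γ R l b : ℝ} (hμ : 0 < μ) (hv : 0 < v) (hγ : 0 < γ) (hR : 0 < R)
    (hl : R < l) (hb0 : 0 ≤ b) (hb : b ≤ μ * v + 2 / l) :
    gaussBound (2 * μ * l / (μ ^ 2 * v ^ 2 + γ ^ 2)).toNNReal b ≤
      2 * Real.exp (μ * (4 * (μ * v) + 4 / R) / (μ ^ 2 * v ^ 2 + γ ^ 2)) *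
        Real.exp (μ * l * (μ * v) ^ 2 / (μ ^ 2 * v ^ 2 + γ ^ 2)) := by
  have hl0 : 0 < l := hR.trans hl
  have hS : 0 < μ ^ 2 * v ^ 2 + γ ^ 2 := by positivity
  rw [gaussBound, Real.coe_toNNReal _ (by positivity), mul_assoc 2 (Real.exp _), ← Real.exp_add]
  refine mul_le_mul_of_nonneg_left (Real.exp_le_exp.2 ?_) zero_le_two
  have h1 : b ^ 2 ≤ (μ * v + 2 / l) ^ 2 := by gcongr
  calc 2 * μ * l / (μ ^ 2 * v ^ 2 + γ ^ 2) * b ^ 2 / 2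
      ≤ 2 * μ * l / (μ ^ 2 * v ^ 2 + γ ^ 2) * (μ * v + 2 / l) ^ 2 / 2 := by gcongr
    _ = μ * (4 * (μ * v) + 4 / l) / (μ ^ 2 * v ^ 2 + γ ^ 2)
        + μ * l * (μ * v) ^ 2 / (μ ^ 2 * v ^ 2 + γ ^ 2) := by field_simp; ring
    _ ≤ _ := by gcongr

theorem gaussBound_one_div_le {μ v γ R l : ℝ} (hμ : 0 < μ) (hv : 0 < v) (hγ : 0 < γ) (hR : 0 < R)
    (hl : R < l) :
    gaussBound (2 * μ * l / (μ ^ 2 * v ^ 2 + γ ^ 2)).toNNReal (1 / l) ≤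
      2 * Real.exp (μ * (4 * (μ * v) + 4 / R) / (μ ^ 2 * v ^ 2 + γ ^ 2)) := by
  have hl0 : 0 < l := hR.trans hl
  have hS : 0 < μ ^ 2 * v ^ 2 + γ ^ 2 := by positivity
  rw [gaussBound, Real.coe_toNNReal _ (by positivity)]
  refine mul_le_mul_of_nonneg_left (Real.exp_le_exp.2 ?_) zero_le_two
  calc 2 * μ * l / (μ ^ 2 * v ^ 2 + γ ^ 2) * (1 / l) ^ 2 / 2
      = μ * (1 / l) / (μ ^ 2 * v ^ 2 + γ ^ 2) := by field_simp
    _ ≤ μ * (4 * (μ * v) + 4 / R) / (μ ^ 2 * v ^ 2 + γ ^ 2) := by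
        gcongr
        have h1 : 1 / l ≤ 1 / R := by gcongr
        have h2 : 4 / R = 4 * (1 / R) := by ring
        have h3 : 0 < 1 / R := by positivity
        have h4 : 0 < μ * v := by positivity
        linarith

theorem totalError_le {J CΦ NΦ μ c v γ R C : ℝ} (hJ : 0 < J) (hC : 0 ≤ CΦ) (hN : 0 ≤ NΦ)
    (hμ : 0 < μ) (hc : 0 < c) (hv : 0 < v) (hγ : 0 < γ) (hR : 0 < R) (hC' : 0 < C) :
    ∃ K : ℝ, 0 ≤ K ∧ ∀ l m : ℝ, R < l → 1 ≤ m →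
      totalError J CΦ NΦ μ c v γ R C l m ≤
        K * m ^ 2 * (l ^ 4 * Real.exp (-(l / xi μ v γ))) := by
  set S := μ ^ 2 * v ^ 2 + γ ^ 2 with hS
  have hS0 : 0 < S := by positivity
  set G := 2 * Real.exp (μ * (4 * (μ * v) + 4 / R) / S) with hG
  have hG0 : 0 < G := by positivity
  clear_value G
  obtain ⟨K, hK, h⟩ := exists_polynomial_bound (R := R)
    (c₁ := c * J ^ 2 * (CΦ * C + 1) * (3 * C * NΦ) * Real.exp (μ * R) * G ^ 2) (d₁ := 1)
    (c₂ := G) (k₁ := 2 * (c * (2 * J ^ 2 * CΦ * NΦ * C) * J * NΦ * Real.exp (3 * μ * R)) * G)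
    (k₂ := 2 * J ^ 2 * CΦ * NΦ * C / γ) hR
    (by positivity) zero_le_one (by positivity) (by positivity) (by positivity)
  refine ⟨K, hK, fun l m hl hm => ?_⟩
  have hl0 : 0 < l := hR.trans hl
  have hξ : 0 < xi μ v γ := by unfold xi; positivity
  set ρ := Real.exp (-(l / xi μ v γ)) with hρ
  have hρ0 : 0 < ρ := Real.exp_pos _
  have hρ1 : ρ ≤ 1 := Real.exp_le_one_iff.2 (neg_nonpos.2 (by positivity))
  refine le_trans ?_ (h l m ρ hl hm hρ0 hρ1)
  have hxi : l / xi μ v γ = μ * l * γ ^ 2 / S / 2 := by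
    rw [xi, ← hS]; field_simp
  have hρ2 : ρ ^ 2 = Real.exp (-(μ * l * γ ^ 2 / S)) := by
    rw [hρ, ← Real.exp_nat_mul, hxi]; congr 1; push_cast; ring
  -- The balance that determines w: the spatial decay, reduced by the Gaussian growth, equals the
  -- gap error ρ² of `he₁`.
  have hdec : Real.exp (-(μ * l)) * Real.exp (μ * l * (μ * v) ^ 2 / S) = ρ ^ 2 := by
    rw [hρ2, ← Real.exp_add]; congr 1
    rw [hS]; field_simp; ring
  set X := Real.exp (μ * l * (μ * v) ^ 2 / S) with hX
  have hX0 : 0 < X := Real.exp_pos _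
  have hg1 := gaussBound_le (b := μ * v + 1 / l) hμ hv hγ hR hl (by positivity) (by gcongr; norm_num)
  have hg2 := gaussBound_le (b := μ * v + 1 / l + 1 / l) hμ hv hγ hR hl (by positivity)
    (le_of_eq (by ring))
  have hg3 := gaussBound_one_div_le (γ := γ) hμ hv hγ hR hl
  rw [← hS, ← hG, ← hX] at hg1 hg2
  rw [← hS, ← hG] at hg3
  have he₁ : Real.exp (-(((2 * μ * l / S).toNNReal : ℝ) * γ ^ 2 / 2)) = ρ ^ 2 := by
    rw [Real.coe_toNNReal _ (by positivity), hρ2]; congr 1; ring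
  unfold totalError
  simp only [← hS, ← hρ]
  rw [he₁]
  have hexp1 : Real.exp (-μ * (l - 3 * R)) = Real.exp (3 * μ * R) * Real.exp (-(μ * l)) := by
    rw [← Real.exp_add]; congr 1; ring
  have hexp2 : Real.exp (-μ * (2 * l - R)) =
      Real.exp (μ * R) * (Real.exp (-(μ * l)) * Real.exp (-(μ * l))) := by
    rw [← Real.exp_add, ← Real.exp_add]; congr 1; ring
  rw [hexp1, hexp2]
  set g₁ := gaussBound (2 * μ * l / S).toNNReal (μ * v + 1 / l)
  set g₂ := gaussBound (2 * μ * l / S).toNNReal (μ * v + 1 / l + 1 / l)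
  set g₃ := gaussBound (2 * μ * l / S).toNNReal (1 / l)
  have hg₁0 : 0 ≤ g₁ := gaussBound_nonneg _ _
  have hg₂0 : 0 ≤ g₂ := gaussBound_nonneg _ _
  have hg₃0 : 0 ≤ g₃ := gaussBound_nonneg _ _
  clear_value g₁ g₂ g₃ X ρ
  set Z := Real.exp (-(μ * l)) with hZ
  have hZ0 : 0 < Z := Real.exp_pos _
  clear_value Z
  have hε : 2 * l ^ 2 * (c * (2 * J ^ 2 * CΦ * NΦ * (C * l * m)) * J * (m * NΦ) *
      (Real.exp (3 * μ * R) * Z)) * g₁ ≤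
      2 * (c * (2 * J ^ 2 * CΦ * NΦ * C) * J * NΦ * Real.exp (3 * μ * R)) * G * l ^ 3 * m ^ 2 *
        ρ ^ 2 := by
    calc _ ≤ 2 * l ^ 2 * (c * (2 * J ^ 2 * CΦ * NΦ * (C * l * m)) * J * (m * NΦ) *
      (Real.exp (3 * μ * R) * Z)) * (G * X) := by gcongr
      _ = 2 * (c * (2 * J ^ 2 * CΦ * NΦ * C) * J * NΦ * Real.exp (3 * μ * R)) * G * l ^ 3 * m ^ 2 *
        (Z * X) := by ring
      _ = _ := by rw [hdec]
  generalize 2 * l ^ 2 * (c * (2 * J ^ 2 * CΦ * NΦ * (C * l * m)) * J * (m * NΦ) *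
      (Real.exp (3 * μ * R) * Z)) * g₁ = ε at hε ⊢
  set k₁ := 2 * (c * (2 * J ^ 2 * CΦ * NΦ * C) * J * NΦ * Real.exp (3 * μ * R)) * G
  have hk₁ : 0 ≤ k₁ := by positivity
  clear_value k₁
  -- Each of the two Gaussian factors is compensated by one factor e^{-μl}, which leaves ρ⁴.
  have hB : l * (l * (c * ((C * l * m * CΦ + 1) * J) * J * (C * (3 * l) * m * NΦ) *
      (Real.exp (μ * R) * (Z * Z))) * g₁) * g₂ ≤
      c * J ^ 2 * (CΦ * C + 1) * (3 * C * NΦ) * Real.exp (μ * R) * G ^ 2 * l ^ 2 *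
        ((l * m + 1) * (l * m)) * ρ ^ 4 := by
    have hlm : C * l * m * CΦ + 1 ≤ (CΦ * C + 1) * (l * m + 1) := by
      have : 0 ≤ CΦ * C := by positivity
      have : 0 ≤ l * m := by positivity
      nlinarith
    calc _ ≤ l * (l * (c * (((CΦ * C + 1) * (l * m + 1)) * J) * J * (C * (3 * l) * m * NΦ) *
      (Real.exp (μ * R) * (Z * Z))) * (G * X)) * (G * X) := by gcongr
      _ = c * J ^ 2 * (CΦ * C + 1) * (3 * C * NΦ) * Real.exp (μ * R) * G ^ 2 * l ^ 2 *
        ((l * m + 1) * (l * m)) * (Z * X) ^ 2 := by ring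
      _ = _ := by rw [hdec]; ring
  -- Dividing by the cutoff δ = ρ costs one of the two powers of ρ; this and the term 2δ determine
  -- the final rate.
  have hlast : (ε + ρ ^ 2 / γ * (2 * J ^ 2 * CΦ * NΦ * (C * l * m))) / ρ ≤
      k₁ * l ^ 3 * m ^ 2 * ρ + 2 * J ^ 2 * CΦ * NΦ * C / γ * l * m * ρ := by
    rw [div_le_iff₀ hρ0]
    have e : ρ ^ 2 / γ * (2 * J ^ 2 * CΦ * NΦ * (C * l * m)) =
      2 * J ^ 2 * CΦ * NΦ * C / γ * l * m * ρ * ρ := by ring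
    rw [e]
    linarith
  have hmid : l * g₃ * (2 * ε + 2 * ρ) ≤ G * l * (2 * (k₁ * l ^ 3 * m ^ 2 * ρ ^ 2) + 2 * ρ) := by
    calc l * g₃ * (2 * ε + 2 * ρ) ≤ l * g₃ * (2 * (k₁ * l ^ 3 * m ^ 2 * ρ ^ 2) + 2 * ρ) := by gcongr
      _ ≤ l * G * (2 * (k₁ * l ^ 3 * m ^ 2 * ρ ^ 2) + 2 * ρ) := by gcongr
      _ = _ := by ring
  linarith

theorem exists_constant {J CΦ NΦ μ c v γ R C : ℝ} (hJ : 0 < J) (hC : 1 ≤ CΦ) (hN : 1 ≤ NΦ)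
    (hμ : 0 < μ) (hc : 0 < c) (hv : 0 < v) (hγ : 0 < γ) (hR : 0 < R) (hC' : 0 < C) :
    ∃ K : ℝ, ∀ l m : ℝ, R < l → 1 ≤ m →
      (l ≤ 3 * R → 2 ≤ K * CΦ * NΦ * m ^ 2 * l ^ (7 / 2 : ℝ) *
        Real.exp (-(l / (2 * xi μ v γ)))) ∧
      2 * totalError J CΦ NΦ μ c v γ R C l m ≤ K * CΦ * NΦ * m ^ 2 * l ^ (7 / 2 : ℝ) *
        Real.exp (-(l / (2 * xi μ v γ))) := by
  have hξ : 0 < xi μ v γ := by unfold xi; positivity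
  obtain ⟨K₁, hK₁, h₁⟩ := totalError_le hJ (by linarith) (by linarith) hμ hc hv hγ hR hC'
    (CΦ := CΦ) (NΦ := NΦ)
  generalize xi μ v γ = ξ at *
  have hRp : 0 < R ^ (7 / 2 : ℝ) := Real.rpow_pos_of_pos hR _
  have hRp' : 0 < R ^ (1 / 2 : ℝ) := Real.rpow_pos_of_pos hR _
  -- K₂ makes the bound at least 2 on R < l ≤ 3R, where trivial projections are used; K₃ serves the
  -- approximation itself.
  set K₂ := 2 / R ^ (7 / 2 : ℝ) * Real.exp (3 * R / (2 * ξ)) with hK₂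
  set K₃ := 2 * K₁ * (2 * ξ / R ^ (1 / 2 : ℝ)) with hK₃
  have hK₂0 : 0 ≤ K₂ := by positivity
  have hK₃0 : 0 ≤ K₃ := by positivity
  have hprod : ∀ k, 0 ≤ k → ∀ m l : ℝ, R < l → k * (m ^ 2 * (l ^ (7 / 2 : ℝ) *
      Real.exp (-(l / (2 * ξ))))) ≤ k * CΦ * NΦ * m ^ 2 * l ^ (7 / 2 : ℝ) *
      Real.exp (-(l / (2 * ξ))) := by
    intro k hk m l hl
    have hl7 : 0 < l ^ (7 / 2 : ℝ) := Real.rpow_pos_of_pos (hR.trans hl) _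
    have h1 : 1 ≤ CΦ * NΦ := one_le_mul_of_one_le_of_one_le hC hN
    calc _ = k * 1 * (m ^ 2 * (l ^ (7 / 2 : ℝ) * Real.exp (-(l / (2 * ξ))))) := by ring
      _ ≤ k * (CΦ * NΦ) * (m ^ 2 * (l ^ (7 / 2 : ℝ) * Real.exp (-(l / (2 * ξ))))) := by gcongr
      _ = _ := by ring
  refine ⟨K₂ + K₃, fun l m hl hm => ⟨fun hl3 => ?_, ?_⟩⟩
  · refine le_trans ?_ (hprod (K₂ + K₃) (by positivity) m l hl)
    have h2 : R ^ (7 / 2 : ℝ) ≤ l ^ (7 / 2 : ℝ) := Real.rpow_le_rpow hR.le hl.le (by norm_num)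
    have h3 : Real.exp (-(3 * R / (2 * ξ))) ≤ Real.exp (-(l / (2 * ξ))) := by gcongr
    have hm1 : 1 ≤ m ^ 2 := by nlinarith
    have h4 : Real.exp (3 * R / (2 * ξ)) * Real.exp (-(3 * R / (2 * ξ))) = 1 := by
      rw [← Real.exp_add]; simp
    calc (2 : ℝ) = 2 / R ^ (7 / 2 : ℝ) * R ^ (7 / 2 : ℝ) * (Real.exp (3 * R / (2 * ξ)) *
          Real.exp (-(3 * R / (2 * ξ)))) := by rw [h4]; field_simp
      _ = K₂ * (1 * (R ^ (7 / 2 : ℝ) * Real.exp (-(3 * R / (2 * ξ))))) := by rw [hK₂]; ring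
      _ ≤ (K₂ + K₃) * (m ^ 2 * (l ^ (7 / 2 : ℝ) * Real.exp (-(l / (2 * ξ))))) := by
          have hl7 : 0 < l ^ (7 / 2 : ℝ) := Real.rpow_pos_of_pos (hR.trans hl) _
          gcongr
          linarith
  · refine le_trans ?_ (hprod (K₂ + K₃) (by positivity) m l hl)
    have hl7 : 0 < l ^ (7 / 2 : ℝ) := Real.rpow_pos_of_pos (hR.trans hl) _
    have h2 := pow_four_mul_exp_le hR hξ hl
    calc _ ≤ 2 * (K₁ * m ^ 2 * (l ^ 4 * Real.exp (-(l / ξ)))) := by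
          have := h₁ l m hl hm
          linarith
      _ ≤ 2 * (K₁ * m ^ 2 * (2 * ξ / R ^ (1 / 2 : ℝ) * (l ^ (7 / 2 : ℝ) *
          Real.exp (-(l / (2 * ξ)))))) := by gcongr
      _ = K₃ * (m ^ 2 * (l ^ (7 / 2 : ℝ) * Real.exp (-(l / (2 * ξ))))) := by rw [hK₃]; ring
      _ ≤ _ := by gcongr; linarith

end Constants

end SpinSystem

namespace SpinSystem

/-! ### The two estimates and the exceptional cases. -/

section Conclusion

/-- Choosing K as a function of the parameters before any system is given makes it uniform in the
volume, the region and ℓ. Nonnegativity is kept for all parameters because the decoupled case needs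
it even if C_Φ = 0. -/
theorem exists_errorConstant : ∃ K : (J CΦ NΦ μ c v γ R C : ℝ) → ℝ,
    ∀ J CΦ NΦ μ c v γ R C, 0 ≤ K J CΦ NΦ μ c v γ R C ∧
      (0 < J → 1 ≤ CΦ → 1 ≤ NΦ → 0 < μ → 0 < c → 0 < v → 0 < γ → 0 < R → 0 < C →
        ∀ l m : ℝ, R < l → 1 ≤ m →
          (l ≤ 3 * R → 2 ≤ K J CΦ NΦ μ c v γ R C * CΦ * NΦ * m ^ 2 * l ^ (7 / 2 : ℝ) *
            Real.exp (-(l / (2 * xi μ v γ)))) ∧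
          2 * totalError J CΦ NΦ μ c v γ R C l m ≤
            K J CΦ NΦ μ c v γ R C * CΦ * NΦ * m ^ 2 * l ^ (7 / 2 : ℝ) *
              Real.exp (-(l / (2 * xi μ v γ)))) := by
  have key : ∀ J CΦ NΦ μ c v γ R C : ℝ, ∃ K : ℝ, 0 ≤ K ∧
      (0 < J → 1 ≤ CΦ → 1 ≤ NΦ → 0 < μ → 0 < c → 0 < v → 0 < γ → 0 < R → 0 < C →
        ∀ l m : ℝ, R < l → 1 ≤ m →
          (l ≤ 3 * R → 2 ≤ K * CΦ * NΦ * m ^ 2 * l ^ (7 / 2 : ℝ) *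
            Real.exp (-(l / (2 * xi μ v γ)))) ∧
          2 * totalError J CΦ NΦ μ c v γ R C l m ≤
            K * CΦ * NΦ * m ^ 2 * l ^ (7 / 2 : ℝ) * Real.exp (-(l / (2 * xi μ v γ)))) := by
    intro J CΦ NΦ μ c v γ R C
    by_cases h : 0 < J ∧ 1 ≤ CΦ ∧ 1 ≤ NΦ ∧ 0 < μ ∧ 0 < c ∧ 0 < v ∧ 0 < γ ∧ 0 < R ∧ 0 < C
    · obtain ⟨hJ, hC, hN, hμ, hc, hv, hγ, hR, hC'⟩ := h
      obtain ⟨K, hK⟩ := exists_constant hJ hC hN hμ hc hv hγ hR hC'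
      refine ⟨max 0 K, le_max_left _ _, fun _ _ _ _ _ _ _ _ _ l m hl hm => ?_⟩
      have hl0 : 0 ≤ l ^ (7 / 2 : ℝ) := Real.rpow_nonneg (hR.trans hl).le _
      have hle : K * CΦ * NΦ * m ^ 2 * l ^ (7 / 2 : ℝ) * Real.exp (-(l / (2 * xi μ v γ))) ≤
          max 0 K * CΦ * NΦ * m ^ 2 * l ^ (7 / 2 : ℝ) * Real.exp (-(l / (2 * xi μ v γ))) := by
        gcongr
        exact le_max_right _ _
      exact ⟨fun h => ((hK l m hl hm).1 h).trans hle, (hK l m hl hm).2.trans hle⟩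
    · exact ⟨0, le_rfl, fun h1 h2 h3 h4 h5 h6 h7 h8 h9 =>
        absurd ⟨h1, h2, h3, h4, h5, h6, h7, h8, h9⟩ h⟩
  choose K hK using key
  exact ⟨K, hK⟩

variable {𝒱 : Type*} [DecidableEq 𝒱] {n : 𝒱 → ℕ} {V : Finset 𝒱}

theorem isStarProjection_projOnto {ψ : Hilb n V} (h : ‖ψ‖ = 1) : IsStarProjection (projOnto ψ) := by
  rw [projOnto_eq_vecMulVec]
  constructor
  · rw [IsIdempotentElem, Matrix.vecMulVec_mul_vecMulVec, star_dotProduct_self h, one_smul]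
  · rw [IsSelfAdjoint, Matrix.star_eq_conjTranspose, Matrix.conjTranspose_vecMulVec, star_star]

theorem posSemidef_and_norm_sub_le {B P Q P₀ : Obs n V} (hP : IsStarProjection P)
    (hQ : IsStarProjection Q) (hP₀ : IsStarProjection P₀) (hB : ‖B‖ ≤ 1) :
    (Q * P * star B * B * P * Q).PosSemidef ∧
      ‖Q * P * star B * B * P * Q - P₀‖ ≤ 2 * ‖B * P * Q - P₀‖ := by
  have heq : Q * P * star B * B * P * Q = star (B * P * Q) * (B * P * Q) := by
    rw [star_mul, star_mul, hP.isSelfAdjoint.star_eq, hQ.isSelfAdjoint.star_eq]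
    simp only [mul_assoc]
  have hT : ‖B * P * Q‖ ≤ 1 := by
    refine (norm_mul_le _ _).trans (mul_le_one₀ ((norm_mul_le _ _).trans
      (mul_le_one₀ hB (norm_nonneg _) (norm_le_one_of_isStarProjection hP))) (norm_nonneg _)
      (norm_le_one_of_isStarProjection hQ))
  generalize B * P * Q = T at *
  rw [heq]
  refine ⟨Matrix.posSemidef_conjTranspose_mul_self T, ?_⟩
  -- With ‖T‖ ≤ 1 and ‖P₀‖ ≤ 1 each summand costs one copy of the first error, hence the factor 2.
  have h1 : star T * T - P₀ = star T * (T - P₀) + star (T - P₀) * P₀ := by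
    rw [star_sub, hP₀.isSelfAdjoint.star_eq, mul_sub, sub_mul, hP₀.isIdempotentElem.eq]
    abel
  rw [h1]
  refine (norm_add_le _ _).trans ?_
  have h2 : ‖star T * (T - P₀)‖ ≤ 1 * ‖T - P₀‖ := (norm_mul_le _ _).trans
    (mul_le_mul_of_nonneg_right (by rwa [norm_star]) (norm_nonneg _))
  have h3 : ‖star (T - P₀) * P₀‖ ≤ ‖T - P₀‖ * 1 := (norm_mul_le _ _).trans
    (by
      rw [norm_star]
      exact mul_le_mul_of_nonneg_left (norm_le_one_of_isStarProjection hP₀) (norm_nonneg _))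
  linarith

/-- Without terms coupling `X` to its complement the Hamiltonian decouples. -/
theorem exists_factorization_of_crossing_eq_empty (hn : ∀ x, 0 < n x) {Φ : Interaction n}
    {X : Finset 𝒱} (hX : X ⊆ V) (h : Φ.crossing V X = ∅) {ψ₀ : Hilb n V} {γ : ℝ}
    (hgs : IsGappedGroundState (hamiltonian Φ V) ψ₀ γ) :
    ∃ (p : Obs n X) (q : Obs n (V \ X)), IsStarProjection p ∧ IsStarProjection q ∧
      embed hX p * embed Finset.sdiff_subset q = projOnto ψ₀ := by
  rw [hamiltonian_eq_sum_support,
    ← Finset.sum_filter_add_sum_filter_not (Φ.support V) (fun Y => Y ⊆ X)] at hgs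
  refine exists_factorization_of_decoupled hn hX Finset.sdiff_subset Finset.disjoint_sdiff
    (isSelfAdjoint_sum_on Φ V _) (isSelfAdjoint_sum_on Φ V _)
    (sum_on_mem Φ hX fun Y hY => (Finset.mem_filter.1 hY).2)
    (sum_on_mem Φ _ fun Y hY => ?_) hgs
  obtain ⟨hYs, hYX⟩ := Finset.mem_filter.1 hY
  have hd : Disjoint Y X := by
    by_contra hd
    have : Y ∈ Φ.crossing V X := mem_crossing.2 ⟨hYs, hYX, hd⟩
    simp [h] at this
  exact Finset.subset_sdiff.2 ⟨(Interaction.mem_support.1 hYs).1, hd⟩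

end Conclusion

end SpinSystem

open SpinSystem in
theorem corollary2p3 :
    -- `K` depends only on `J, C_Φ, N_Φ, μ, c, v, γ, R, κ_{μ/2}, C`
    ∃ K : (J CΦ NΦ μ c v γ R κ C : ℝ) → ℝ,
    ∀ (𝒱 : Type*) [DecidableEq 𝒱] [MetricSpace 𝒱] [Countable 𝒱]
      (_ : ∀ (x : 𝒱) (r : ℝ), (Metric.ball x r).Finite)
      (n : 𝒱 → ℕ) (_ : ∀ x, 0 < n x) (Φ : Interaction n)
      (μ₀ R J : ℝ) (_ : 0 < μ₀) (_ : kappa 𝒱 μ₀ < ⊤)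
      (_ : 0 < R) (_ : Φ.HasRange R) (_ : 0 < J) (_ : Φ.BoundedBy J) (_ : Φ.bigN < ⊤)
      (μ : ℝ) (_ : 2 * μ₀ ≤ μ),
      (∃ c v : ℝ, IsLiebRobinson Φ μ c v) ∧
      ∀ (c v : ℝ) (_ : IsLiebRobinson Φ μ c v)
        (V : Finset 𝒱) (ψ₀ : Hilb n V) (γ : ℝ)
        (_ : IsGappedGroundState (hamiltonian Φ V) ψ₀ γ)
        (𝒳 : Finset 𝒱) (h𝒳 : 𝒳 ⊆ V) (C : ℝ) (_ : 0 < C) (_ : HasRegularBoundary R V 𝒳 C)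
        (l : ℝ) (_ : R < l),
        ∃ (p : Obs n 𝒳) (q : Obs n (V \ 𝒳)) (b : Obs n (borderSet R V 𝒳 (3 * l))),
          IsStarProjection p ∧ IsStarProjection q ∧ ‖b‖ ≤ 1 ∧
          let P : Obs n V := embed h𝒳 p
          let Q : Obs n V := embed Finset.sdiff_subset q
          let B : Obs n V := embed (borderSet_subset R V 𝒳 (3 * l)) b
          let bound : ℝ := K J Φ.bigC.toReal Φ.bigN.toReal μ c v γ R (kappa 𝒱 (μ / 2)).toReal C *
            Φ.bigC.toReal * Φ.bigN.toReal * ((bdry R V 𝒳).card : ℝ) ^ 2 * l ^ (7 / 2 : ℝ) *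
            Real.exp (-(l / (2 * xi μ v γ)))
          ‖B * P * Q - projOnto ψ₀‖ ≤ bound ∧
          (Q * P * star B * B * P * Q).PosSemidef ∧
          ‖Q * P * star B * B * P * Q - projOnto ψ₀‖ ≤ bound := by
  obtain ⟨K, hK⟩ := exists_errorConstant
  refine ⟨fun J CΦ NΦ μ c v γ R _ C => K J CΦ NΦ μ c v γ R C, ?_⟩
  intro 𝒱 _ _ _ _ n hn Φ μ₀ R J hμ₀ _ hR0 hR hJ hΦ hN μ hμμ₀
  have hμ : 0 < μ := by linarith
  refine ⟨exists_isLiebRobinson Φ hR hJ.le hΦ hN hμ, ?_⟩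
  intro c v hLR V ψ₀ γ hgs 𝒳 h𝒳 C hC hreg l hl
  obtain ⟨hK0, hK⟩ := hK J Φ.bigC.toReal Φ.bigN.toReal μ c v γ R C
  have hl0 : 0 < l := hR0.trans hl
  have hP₀ := isStarProjection_projOnto hgs.1
  have hP₀1 := norm_le_one_of_isStarProjection hP₀
  -- Without crossing terms the right-hand side may vanish, so an exact factorisation is required,
  -- with border observable 1. A crossing term, in contrast, forces C_Φ, N_Φ and |∂𝒳| to be at least
  -- 1.
  by_cases hcross : Φ.crossing V 𝒳 = ∅
  · obtain ⟨p, q, hp, hq, hpq⟩ := exists_factorization_of_crossing_eq_empty hn h𝒳 hcross hgs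
    have hbound : 0 ≤ K J Φ.bigC.toReal Φ.bigN.toReal μ c v γ R C * Φ.bigC.toReal *
        Φ.bigN.toReal * ((bdry R V 𝒳).card : ℝ) ^ 2 * l ^ (7 / 2 : ℝ) *
        Real.exp (-(l / (2 * xi μ v γ))) := by
      have h1 : 0 ≤ Φ.bigC.toReal := ENNReal.toReal_nonneg
      have h2 : 0 ≤ Φ.bigN.toReal := ENNReal.toReal_nonneg
      have h3 : 0 ≤ l ^ (7 / 2 : ℝ) := Real.rpow_nonneg hl0.le _
      exact mul_nonneg (mul_nonneg (mul_nonneg (mul_nonneg (mul_nonneg hK0 h1) h2)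
        (sq_nonneg _)) h3) (Real.exp_pos _).le
    have hone := norm_le_one_of_isStarProjection
      (IsStarProjection.one (R := Obs n (borderSet R V 𝒳 (3 * l))))
    have hfin := posSemidef_and_norm_sub_le (isStarProjection_embed h𝒳 hp)
      (isStarProjection_embed Finset.sdiff_subset hq) hP₀
      ((norm_embed_le (borderSet_subset R V 𝒳 (3 * l)) 1).trans hone)
    have hz : ‖embed (borderSet_subset R V 𝒳 (3 * l)) 1 * embed h𝒳 p *
        embed Finset.sdiff_subset q - projOnto ψ₀‖ = 0 := by
      rw [embed_one, one_mul, hpq, sub_self, norm_zero]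
    rw [hz, mul_zero] at hfin
    exact ⟨p, q, 1, hp, hq, hone, hz.le.trans hbound, hfin.1, hfin.2.trans hbound⟩
  obtain ⟨Y, hY⟩ := Finset.nonempty_iff_ne_empty.2 hcross
  obtain ⟨x, hx, hxY⟩ := exists_mem_bdry_of_crossing hR hY
  have hY0 := (Interaction.mem_support.1 (mem_crossing.1 hY).1).2
  have hCΦ := one_le_bigC Φ hN ⟨x, hxY⟩ hY0
  have hNΦ := one_le_bigN Φ hN ⟨x, hxY⟩ hY0
  have hm : (1 : ℝ) ≤ (bdry R V 𝒳).card := by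
    exact_mod_cast Finset.card_pos.2 ⟨x, hx⟩
  obtain ⟨hsmall, hlarge⟩ :=
    hK hJ hCΦ hNΦ hμ hLR.1 hLR.2.1 hgs.2.1 hR0 hC l _ hl hm
  -- The locality estimates need l > 3R. Below that, all three operators are taken to be 1 and the
  -- error is at most 2.
  rcases le_or_gt l (3 * R) with hl3 | hl3
  · have hone := norm_le_one_of_isStarProjection
      (IsStarProjection.one (R := Obs n (borderSet R V 𝒳 (3 * l))))
    have hone' : ‖(1 : Obs n V)‖ ≤ 1 := norm_le_one_of_isStarProjection (.one _)
    have hfin := posSemidef_and_norm_sub_le (isStarProjection_embed h𝒳 (p := 1) (.one _))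
      (isStarProjection_embed (Finset.sdiff_subset (s := V) (t := 𝒳)) (p := 1) (.one _)) hP₀
      ((norm_embed_le (borderSet_subset R V 𝒳 (3 * l)) 1).trans hone)
    refine ⟨1, 1, 1, .one _, .one _, hone, ?_, hfin.1, ?_⟩
    · refine le_trans ?_ (hsmall hl3)
      simp only [embed_one, one_mul]
      exact (norm_sub_le _ _).trans (by linarith)
    · refine le_trans ?_ (hsmall hl3)
      simp only [embed_one, one_mul, star_one]
      exact (norm_sub_le _ _).trans (by linarith)
  · have hb := hreg l hl
    have hb3 := hreg (3 * l) (by linarith)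
    have hJ2 : 0 ≤ 2 * J ^ 2 * Φ.bigC.toReal * Φ.bigN.toReal := by positivity
    have hc := hLR.1
    obtain ⟨p, q, b, hp, hq, hb1, hbd⟩ := exists_approximation hLR hμ.le hn hN hJ.le hΦ hR0.le hR
      hgs h𝒳 hl0 hl3 (mul_le_mul_of_nonneg_left hb.1 hJ2) (mul_le_mul_of_nonneg_left hb.2.2 hJ2)
      (nB := (C * l * (bdry R V 𝒳).card * Φ.bigC.toReal + 1) * J)
      (mul_le_mul_of_nonneg_right (by
        have := mul_le_mul_of_nonneg_right hb.2.1 (zero_le_one.trans hCΦ)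
        linarith) hJ.le)
      (Real.exp_pos (-(l / xi μ v γ))) (2 * μ * l / (μ ^ 2 * v ^ 2 + γ ^ 2)).toNNReal rfl rfl
      (M := c * ((C * l * (bdry R V 𝒳).card * Φ.bigC.toReal + 1) * J) * J *
        (C * (3 * l) * (bdry R V 𝒳).card * Φ.bigN.toReal) * Real.exp (-μ * (2 * l - R)))
      (mul_le_mul_of_nonneg_right (mul_le_mul_of_nonneg_left
        (mul_le_mul_of_nonneg_right hb3.2.1 (zero_le_one.trans hNΦ)) (by positivity))
        (Real.exp_pos _).le)
    have hfin := posSemidef_and_norm_sub_le (isStarProjection_embed h𝒳 hp)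
      (isStarProjection_embed Finset.sdiff_subset hq) hP₀
      ((norm_embed_le (borderSet_subset R V 𝒳 (3 * l)) b).trans hb1)
    have hbd' : ‖embed (borderSet_subset R V 𝒳 (3 * l)) b * embed h𝒳 p *
        embed Finset.sdiff_subset q - projOnto ψ₀‖ ≤
        totalError J Φ.bigC.toReal Φ.bigN.toReal μ c v γ R C l (bdry R V 𝒳).card := hbd
    have htwo := (mul_le_mul_of_nonneg_left hbd' zero_le_two).trans hlarge
    have hnn := norm_nonneg (embed (borderSet_subset R V 𝒳 (3 * l)) b * embed h𝒳 p *
        embed Finset.sdiff_subset q - projOnto ψ₀)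
    exact ⟨p, q, b, hp, hq, hb1, by
      show _ ≤ _
      exact (le_mul_of_one_le_left hnn one_le_two).trans htwo, hfin.1, hfin.2.trans htwo⟩
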